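/- Let $\mathbb{D}=\{|z|<1\}\subset\mathbb{C}\cong\mathbb{R}^2$ be the Euclidean unit disk and $S\mathbb{D}=\mathbb{D}\times\mathbb{S}^1$ its unit circle bundle, with $\mathbb{S}^1=\mathbb{R}/2\pi\mathbb{Z}$, points $(x,\theta)$ and measure $dx\,d\theta$. All functions are complex-valued. For an integer $m\ge 0$, an $m$-tensor is a function $f\in L^2(S\mathbb{D})$ of the form $f(x,\theta)=\sum_{j=0}^m f_{m-2j}(x)e^{i(m-2j)\theta}$ with $f_{m-2j}\in L^2(\mathbb{D})$ (these functions correspond to the symmetric covariant $m$-tensor fields, by pairing $m$ times with the direction $(\cos\theta,\sin\theta)$). The X-ray transform of $f\in L^2(S\mathbb{D})$ is, for almost every $(\beta,\alpha)\in\mathbb{S}^1\times(-\frac\pi2,\frac\pi2)$, $$If(\beta,\alpha)=\int_0^{2\cos\alpha} f\big(e^{i\beta}+te^{i(\beta+\pi+\alpha)},\,\beta+\pi+\alpha\big)\,dt .$$ Put $\partial=\frac12(\partial_x-i\partial_y)$, $\bar\partial=\frac12(\partial_x+i\partial_y)$, $\eta_+=e^{i\theta}\partial$, $\eta_-=e^{-i\theta}\bar\partial$,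 $X_\perp=\frac1i(\eta_+-\eta_-)=\sin\theta\,\partial_x-\cos\theta\,\partial_y$. For $k\in\mathbb{Z}$ let $$\ker^k\eta_+=\{u(x)e^{ik\theta}: u\in L^2(\mathbb{D}),\ \partial u=0\},\qquad \ker^k\eta_-=\{u(x)e^{ik\theta}: u\in L^2(\mathbb{D}),\ \bar\partial u=0\},$$ the equations being understood in the sense of distributions. Let $\dot H^1(\mathbb{D})$ be the space of $u\in H^1(\mathbb{D})$ whose boundary trace satisfies $\int_{\mathbb{S}^1}u(e^{i\beta})\,d\beta=0$. **Theorem (Decomposition).** Let $m\ge0$. For every $m$-tensor $f\in L^2(S\mathbb{D})$ there is a unique $m$-tensor $g\in L^2(S\mathbb{D})$ such that $If=Ig$ almost everywhere and $g$ has the following form: (i) if $m=2n$ is even, $g=g_0+\sum_{j=1}^n\big(g_{2j}e^{2ij\theta}+g_{-2j}e^{-2ij\theta}\big)$ with $g_0\in L^2(\mathbb{D})$, and $g_{2j}e^{2ij\theta}\in\ker^{2j}\eta_-$, $g_{-2j}e^{-2ij\theta}\in\ker^{-2j}\eta_+$ for all $1\le j\le n$; (ii) if $m=2n+1$ is odd,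 $g=X_\perp g_0+\sum_{j=1}^n\big(g_{2j+1}e^{i(2j+1)\theta}+g_{-(2j+1)}e^{-i(2j+1)\theta}\big)$ with $g_0\in\dot H^1(\mathbb{D})$, and $g_{2j+1}e^{i(2j+1)\theta}\in\ker^{2j+1}\eta_-$, $g_{-(2j+1)}e^{-i(2j+1)\theta}\in\ker^{-(2j+1)}\eta_+$ for all $1\le j\le n$. Moreover, in both cases there is a constant $C_m$, depending only on $m$, such that $\|g\|_{L^2(S\mathbb{D})}\le C_m\|f\|_{L^2(S\mathbb{D})}$ for all such $f$ and $g$. -/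

import Mathlib

open MeasureTheory Filter Topology
open scoped Real ContDiff Distributions

noncomputable section

namespace DiskTensor

/-- The length `2π` of the circle of directions is positive. -/
instance factTwoPiPos : Fact ((0 : ℝ) < 2 * π) := ⟨Real.two_pi_pos⟩

/-- The circle `𝕊¹ = ℝ / 2πℤ` of angles; its `volume` is `dθ`, of total mass `2π`. -/
abbrev Angles : Type := AddCircle (2 * π)

/-- The function `θ ↦ e^{ikθ}` on the circle of angles, for an integer `k`. -/
def expI (k : ℤ) (θ : Angles) : ℂ := fourier k θ

theorem expI_coe (k : ℤ) (t : ℝ) : expI k (t : Angles) = Complex.exp (Complex.I * k * t) := by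
  have h : (π : ℂ) ≠ 0 := by exact_mod_cast Real.pi_ne_zero
  rw [expI, fourier_coe_apply]
  congr 1
  push_cast
  field_simp

/-- The open unit disk `𝔻`, as an open subset of `ℂ = ℝ²`. -/
def disk : TopologicalSpace.Opens ℂ := ⟨Metric.ball 0 1, Metric.isOpen_ball⟩

/-- Lebesgue measure on the unit disk. -/
def diskMeasure : Measure ℂ := volume.restrict (Metric.ball 0 1)

/-- The measure `dx dθ` of the unit circle bundle `S𝔻 = 𝔻 × 𝕊¹`. -/
def bundleMeasure : Measure (ℂ × Angles) := diskMeasure.prod volume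

/-- The space `L²(S𝔻)` of complex-valued functions. -/
abbrev L2SD : Type := Lp ℂ 2 bundleMeasure

/-- The measure `dβ dα` of the influx boundary `∂₊S𝔻 = 𝕊¹ × (-π/2, π/2)` in fan-beam
coordinates. -/
def influxMeasure : Measure (Angles × ℝ) :=
  (volume : Measure Angles).prod (volume.restrict (Set.Ioo (-(π / 2)) (π / 2)))

/-! ### The X-ray transform -/

/-- The X-ray transform in fan-beam coordinates,
`If(β, α) = ∫₀^{2 cos α} f(e^{iβ} + t e^{i(β+π+α)}, β+π+α) dt`. -/
def xray (f : ℂ × Angles → ℂ) (p : Angles × ℝ) : ℂ :=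
  ∫ t in (0 : ℝ)..(2 * Real.cos p.2),
    f (expI 1 p.1 + (t : ℂ) * expI 1 (p.1 + ((π + p.2 : ℝ) : Angles)),
      p.1 + ((π + p.2 : ℝ) : Angles))

/-! ### Tensors as functions on the circle bundle -/

/-- The function `(x, θ) ↦ u(x) e^{ikθ}` on `S𝔻`. -/
def harmonic (k : ℤ) (u : ℂ → ℂ) (p : ℂ × Angles) : ℂ := u p.1 * expI k p.2

/-- The `m`-tensors in `L²(S𝔻)`: the functions `∑ f_k(x) e^{ikθ}`, where `k` runs through
`m, m - 2, …, -m` and the `f_k` are in `L²(𝔻)`. -/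
def tensors (m : ℕ) : Set L2SD :=
  {f | ∃ a : ℤ → ℂ → ℂ, (∀ k, MemLp (a k) 2 diskMeasure) ∧
    f =ᵐ[bundleMeasure] fun p =>
      ∑ j ∈ Finset.range (m + 1), harmonic ((m : ℤ) - 2 * j) (a ((m : ℤ) - 2 * j)) p}

/-! ### Weak derivatives on the disk -/

/-- `w` is the weak directional derivative of `u` on the disk, in the direction `v`. -/
def HasWeakDeriv (v : ℂ) (u w : ℂ → ℂ) : Prop :=
  ∀ φ : 𝓓(disk, ℂ),
    ∫ z, u z * fderiv ℝ φ z v ∂diskMeasure = -∫ z, w z * φ z ∂diskMeasure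

/-- `∂ = (∂_x - i ∂_y) / 2`. -/
def dz (φ : ℂ → ℂ) (z : ℂ) : ℂ := (fderiv ℝ φ z 1 - Complex.I * fderiv ℝ φ z Complex.I) / 2

/-- `∂̄ = (∂_x + i ∂_y) / 2`. -/
def dzbar (φ : ℂ → ℂ) (z : ℂ) : ℂ := (fderiv ℝ φ z 1 + Complex.I * fderiv ℝ φ z Complex.I) / 2

/-- `∂u = 0` on the disk in the sense of distributions. -/
def WeakDzZero (u : ℂ → ℂ) : Prop :=
  ∀ φ : 𝓓(disk, ℂ), ∫ z, u z * dz φ z ∂diskMeasure = 0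

/-- `∂̄u = 0` on the disk in the sense of distributions. -/
def WeakDzbarZero (u : ℂ → ℂ) : Prop :=
  ∀ φ : 𝓓(disk, ℂ), ∫ z, u z * dzbar φ z ∂diskMeasure = 0

/-- `ker^k η₊`: the functions `u(x) e^{ikθ}` with `u ∈ L²(𝔻)` and `∂u = 0`. -/
def kerEtaPlus (k : ℤ) : Set L2SD :=
  {h | ∃ u : ℂ → ℂ, MemLp u 2 diskMeasure ∧ WeakDzZero u ∧ h =ᵐ[bundleMeasure] harmonic k u}

/-- `ker^k η₋`: the functions `u(x) e^{ikθ}` with `u ∈ L²(𝔻)` and `∂̄u = 0`. -/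
def kerEtaMinus (k : ℤ) : Set L2SD :=
  {h | ∃ u : ℂ → ℂ, MemLp u 2 diskMeasure ∧ WeakDzbarZero u ∧ h =ᵐ[bundleMeasure] harmonic k u}

/-! ### Sobolev functions on the disk -/

/-- `u ∈ H¹(𝔻)`, with weak partial derivatives `∂_x u = ux` and `∂_y u = uy`. -/
structure IsH1With (u ux uy : ℂ → ℂ) : Prop where
  memLp : MemLp u 2 diskMeasure
  memLp_x : MemLp ux 2 diskMeasure
  memLp_y : MemLp uy 2 diskMeasure
  weak_x : HasWeakDeriv 1 u ux
  weak_y : HasWeakDeriv Complex.I u uy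

/-- `T ∈ L²(𝕊¹)` is the boundary trace of the `H¹(𝔻)` function `u` with weak partial derivatives
`ux`, `uy`: there are functions smooth up to the boundary which converge to `u` in `H¹(𝔻)` and
whose boundary values converge to `T` in `L²(𝕊¹)`. -/
def HasTrace (u ux uy : ℂ → ℂ) (T : Angles → ℂ) : Prop :=
  MemLp T 2 volume ∧
  ∃ φ : ℕ → ℂ → ℂ, (∀ n, ContDiff ℝ ∞ (φ n)) ∧
    Tendsto (fun n => eLpNorm (fun z => φ n z - u z) 2 diskMeasure) atTop (𝓝 0) ∧
    Tendsto (fun n => eLpNorm (fun z => fderiv ℝ (φ n) z 1 - ux z) 2 diskMeasure) atTop (𝓝 0) ∧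
    Tendsto (fun n => eLpNorm (fun z => fderiv ℝ (φ n) z Complex.I - uy z) 2 diskMeasure)
      atTop (𝓝 0) ∧
    Tendsto (fun n => eLpNorm (fun β => φ n (expI 1 β) - T β) 2 (volume : Measure Angles))
      atTop (𝓝 0)

/-- `u ∈ Ḣ¹(𝔻)`, that is, `u ∈ H¹(𝔻)` and the boundary trace of `u` has integral zero; `ux` and
`uy` are the weak partial derivatives of `u`. -/
def IsH1DotWith (u ux uy : ℂ → ℂ) : Prop :=
  IsH1With u ux uy ∧ ∃ T : Angles → ℂ, HasTrace u ux uy T ∧ ∫ β, T β = 0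

/-- The functions `X_⊥ u = sin θ ∂_x u - cos θ ∂_y u` on `S𝔻`, for `u ∈ Ḣ¹(𝔻)`. -/
def xPerpRange : Set L2SD :=
  {h | ∃ u ux uy : ℂ → ℂ, IsH1DotWith u ux uy ∧
    h =ᵐ[bundleMeasure] fun p => ((expI 1 p.2).im : ℂ) * ux p.1 - ((expI 1 p.2).re : ℂ) * uy p.1}

/-! ### The reduced form of a tensor -/

/-- `g = g₀ + ∑_{j=1}^n (g_{2j} e^{2ijθ} + g_{-2j} e^{-2ijθ})` with `g₀ ∈ L²(𝔻)`,
`g_{2j} e^{2ijθ} ∈ ker^{2j} η₋` and `g_{-2j} e^{-2ijθ} ∈ ker^{-2j} η₊`. -/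
def IsReducedEven (n : ℕ) (g : L2SD) : Prop :=
  ∃ (g₀ : ℂ → ℂ) (G₀ : L2SD) (h₁ h₂ : ℕ → L2SD),
    MemLp g₀ 2 diskMeasure ∧ G₀ =ᵐ[bundleMeasure] harmonic 0 g₀ ∧
    (∀ j ∈ Finset.Icc 1 n, h₁ j ∈ kerEtaMinus (2 * (j : ℤ))) ∧
    (∀ j ∈ Finset.Icc 1 n, h₂ j ∈ kerEtaPlus (-(2 * (j : ℤ)))) ∧
    g = G₀ + ∑ j ∈ Finset.Icc 1 n, (h₁ j + h₂ j)

/-- `g = X_⊥ g₀ + ∑_{j=1}^n (g_{2j+1} e^{i(2j+1)θ} + g_{-(2j+1)} e^{-i(2j+1)θ})` with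
`g₀ ∈ Ḣ¹(𝔻)`, `g_{2j+1} e^{i(2j+1)θ} ∈ ker^{2j+1} η₋` and
`g_{-(2j+1)} e^{-i(2j+1)θ} ∈ ker^{-(2j+1)} η₊`. -/
def IsReducedOdd (n : ℕ) (g : L2SD) : Prop :=
  ∃ (G₀ : L2SD) (h₁ h₂ : ℕ → L2SD),
    G₀ ∈ xPerpRange ∧
    (∀ j ∈ Finset.Icc 1 n, h₁ j ∈ kerEtaMinus (2 * (j : ℤ) + 1)) ∧
    (∀ j ∈ Finset.Icc 1 n, h₂ j ∈ kerEtaPlus (-(2 * (j : ℤ) + 1))) ∧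
    g = G₀ + ∑ j ∈ Finset.Icc 1 n, (h₁ j + h₂ j)

/-- `g` is an `m`-tensor with the same X-ray transform as `f`, and `g` is of the reduced form:
`IsReducedEven n` if `m = 2n`, and `IsReducedOdd n` if `m = 2n + 1`. -/
structure IsDecomposition (m : ℕ) (f g : L2SD) : Prop where
  mem_tensors : g ∈ tensors m
  xray_eq : xray f =ᵐ[influxMeasure] xray g
  even_form : ∀ n : ℕ, m = 2 * n → IsReducedEven n g
  odd_form : ∀ n : ℕ, m = 2 * n + 1 → IsReducedOdd n g

end DiskTensor

end

noncomputable section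

namespace DiskTensor

/-! The X-ray transform is encoded by moments. The functions `(x e^{-iθ} - conj x e^{iθ})^k e^{ilθ}`
are constant along geodesics, where they equal `(2i sin α)^k e^{il(β+π+α)}`. By Santaló's formula
(`map_ray`) the integral of `f` against such a weight is the integral of `If` against the same
function of the geodesic, with density `cos α`. By Stone–Weierstrass in the variables `(β+π+α, sin
α)` these numbers determine `If`. Hence `If = Ig` exactly when `f - g` lies in `momentKer`, a closed
subspace of L² (`xray_ae_eq_iff_sub_mem`). On a component `u(x)e^{ijθ}` the weights only see the
disk moments `∫ u z^a conj z^b` (`moment_emb`).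

Existence, with the bound. For a test function `φ`, `X(φ e^{ikθ}) = e^{i(k+1)θ}∂φ + e^{i(k-1)θ}∂̄φ`
lies in `momentKer`. Since `‖∂φ‖ = ‖∂̄φ‖`, projecting the top component on the closure of the `∂φ`
leaves a holomorphic remainder and moves the rest two frequencies down without increasing the norm;
the bottom component is treated in the same way with `∂` and `∂̄` exchanged
(`exists_weakDzbarZero_reduction`, `exists_weakDzZero_reduction`). Iteration ends at frequency 0,
where nothing is to be done, or at frequencies ±1. There the tensor is projected on the closure of
the functions `X_⊥φ`, with `φ` smooth and of mean zero on the circle. A trace inequality and a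
Poincaré inequality put that closure inside `X_⊥ Ḣ¹`, and pairing with monomials puts its orthogonal
complement among the `±1` components inside `momentKer` (`exists_perp_reduction`).

Uniqueness. Let the difference of two reduced tensors have zero moments. The weights of extreme
frequency isolate the outermost components and give `∫ u conj z^K = 0` at the top. Testing `∂̄u = 0`
against `(1-|z|²) z^a conj z^b` gives a recurrence that carries this to all moments of `u`, so `u =
0`, and the argument continues inwards. At frequency 0 all disk moments vanish directly. At ±1 the
equation `∂̄A + ∂B = 0`, satisfied by the components of `X_⊥ g₀`, combines with the vanishing
moments to give the same recurrences for `A` and `B` separately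
(`eq_zero_of_weakDivZero_of_mem_momentKer`). -/

/-! ### Stone–Weierstrass and systems of moments that determine a function -/

open ContinuousMap in
/-- An integrable function on a compact set that is orthogonal to a module over a separating algebra
of continuous functions vanishes. -/
theorem ae_eq_zero_of_forall_integral_mul_eq_zero {X ι : Type*} [PseudoMetricSpace X]
    [SecondCountableTopology X]
    [MeasurableSpace X] [BorelSpace X] {μ : Measure X} {K : Set X} (hK : IsCompact K)
    (hμK : ∀ᵐ x ∂μ, x ∈ K) {h : X → ℂ} (hh : Integrable h μ) (s : Set C(X, ℝ))
    (hs : (Algebra.adjoin ℝ s).SeparatesPoints) (m : ι → C(X, ℂ))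
    (h1 : (1 : C(X, ℂ)) ∈ Submodule.span ℂ (Set.range m))
    (hm : ∀ g ∈ s, ∀ i, ((⟨fun x => (g x : ℂ), by fun_prop⟩ : C(X, ℂ)) * m i) ∈
      Submodule.span ℂ (Set.range m))
    (h0 : ∀ i, ∫ x, h x * m i x ∂μ = 0) : h =ᵐ[μ] 0 := by
  have hint : ∀ q : C(X, ℂ), Integrable (fun x => h x * q x) μ := by
    intro q
    obtain ⟨C, hC⟩ := hK.exists_bound_of_continuousOn q.continuous.continuousOn
    refine hh.mul_bdd (c := C) q.continuous.aestronglyMeasurable ?_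
    filter_upwards [hμK] with x hx using hC x hx
  have hspan : ∀ q ∈ Submodule.span ℂ (Set.range m), ∫ x, h x * q x ∂μ = 0 := by
    intro q hq
    induction hq using Submodule.span_induction with
    | mem x hx => obtain ⟨i, rfl⟩ := hx; exact h0 i
    | zero => simp
    | add x y _ _ hx hy =>
      simp only [ContinuousMap.add_apply, mul_add]
      rw [integral_add (hint x) (hint y), hx, hy, add_zero]
    | smul a x _ hx =>
      simp only [ContinuousMap.smul_apply, smul_eq_mul, mul_left_comm _ a]
      rw [integral_const_mul, hx, mul_zero]
  -- The span of `m` is stable under the algebra generated by `s`. As it contains `1`, it contains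
  -- the algebra itself, on which `h` therefore integrates to zero.
  have hA : ∀ a ∈ Algebra.adjoin ℝ s, ∀ q ∈ Submodule.span ℂ (Set.range m),
      ((⟨fun x => (a x : ℂ), by fun_prop⟩ : C(X, ℂ)) * q) ∈ Submodule.span ℂ (Set.range m) := by
    intro a ha
    induction ha using Algebra.adjoin_induction with
    | mem g hg =>
      intro q hq
      induction hq using Submodule.span_induction with
      | mem x hx => obtain ⟨i, rfl⟩ := hx; exact hm g hg i
      | zero => simp
      | add x y _ _ hx hy => rw [mul_add]; exact Submodule.add_mem _ hx hy
      | smul a x _ hx => rw [mul_smul_comm]; exact Submodule.smul_mem _ _ hx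
    | algebraMap r =>
      intro q hq
      convert! Submodule.smul_mem _ (r : ℂ) hq using 1
    | add a b _ _ ha hb =>
      intro q hq
      convert! Submodule.add_mem _ (ha q hq) (hb q hq) using 1
      ext x; simp [add_mul]
    | mul a b _ _ ha hb =>
      intro q hq
      convert! ha _ (hb q hq) using 1
      ext x; simp [mul_assoc]
  have hzero : ∀ a ∈ Algebra.adjoin ℝ s, ∫ x, h x * (a x : ℂ) ∂μ = 0 := by
    intro a ha
    have := hspan _ (hA a ha 1 h1)
    simpa using this
  have hcont : ∀ f : C(X, ℝ), ∫ x, h x * (f x : ℂ) ∂μ = 0 := by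
    intro f
    by_contra hne
    have hpos : 0 < ‖∫ x, h x * (f x : ℂ) ∂μ‖ := norm_pos_iff.mpr hne
    set I := ∫ x, ‖h x‖ ∂μ with hI
    have hI0 : 0 ≤ I := integral_nonneg fun _ => norm_nonneg _
    -- With this choice `I * ε` is smaller than the integral to be excluded; `I + 1` covers the case
    -- `I = 0`.
    set ε := ‖∫ x, h x * (f x : ℂ) ∂μ‖ / (2 * (I + 1)) with hε
    have hε0 : 0 < ε := by positivity
    obtain ⟨g, hg, hgf⟩ := exists_mem_subalgebra_near_continuous_of_isCompact_of_separatesPoints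
      hs f hK hε0
    let fc : C(X, ℂ) := ⟨fun x => (f x : ℂ), by fun_prop⟩
    let gc : C(X, ℂ) := ⟨fun x => (g x : ℂ), by fun_prop⟩
    have e : ∫ x, h x * (f x : ℂ) ∂μ = ∫ x, (h x * fc x - h x * gc x) ∂μ := by
      rw [integral_sub (hint fc) (hint gc)]
      simp [fc, gc, hzero g hg]
    have b : ‖∫ x, (h x * fc x - h x * gc x) ∂μ‖ ≤ ∫ x, ‖h x‖ * ε ∂μ := by
      refine norm_integral_le_of_norm_le (hh.norm.mul_const _) ?_
      filter_upwards [hμK] with x hx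
      rw [← mul_sub, norm_mul]
      refine mul_le_mul_of_nonneg_left ?_ (norm_nonneg _)
      have := (hgf x hx).le
      rw [norm_sub_rev] at this
      simpa [fc, gc, ← Complex.ofReal_sub] using this
    rw [← e, integral_mul_const, ← hI] at b
    have : I * ε < ‖∫ x, h x * (f x : ℂ) ∂μ‖ := by
      rw [hε, mul_div_assoc', div_lt_iff₀ (by positivity)]
      nlinarith
    linarith
  -- The indicator of a closed set is the pointwise limit of continuous thickened indicators bounded
  -- by 1, so dominated convergence passes from continuous functions to closed sets.
  refine ae_eq_zero_of_forall_setIntegral_isClosed_eq_zero hh fun F hF => ?_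
  have hδ0 : ∀ n : ℕ, (0 : ℝ) < 1 / ((n : ℝ) + 1) := fun n => by positivity
  have hlim := thickenedIndicator_tendsto_indicator_closure hδ0
    tendsto_one_div_add_atTop_nhds_zero_nat F
  rw [hF.closure_eq, tendsto_pi_nhds] at hlim
  have : Tendsto (fun n : ℕ => ∫ x, h x * (((thickenedIndicator (hδ0 n) F x : NNReal) : ℝ) : ℂ) ∂μ)
      atTop (𝓝 (∫ x, F.indicator h x ∂μ)) := by
    refine tendsto_integral_of_dominated_convergence (fun x => ‖h x‖) (fun n => ?_) hh.norm
      (fun n => ?_) ?_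
    · exact hh.aestronglyMeasurable.mul (Continuous.aestronglyMeasurable
        (Complex.continuous_ofReal.comp (NNReal.continuous_coe.comp
          (thickenedIndicator (hδ0 n) F).continuous)))
    · refine Eventually.of_forall fun x => ?_
      rw [norm_mul]
      refine mul_le_of_le_one_right (norm_nonneg _) ?_
      simpa using thickenedIndicator_le_one (hδ0 n) F x
    · refine Eventually.of_forall fun x => ?_
      have h2 : Tendsto (fun n : ℕ => h x * (((thickenedIndicator (hδ0 n) F x : NNReal) : ℝ) : ℂ))
          atTop (𝓝 (h x * (((F.indicator (fun _ => (1 : NNReal)) x : NNReal) : ℝ) : ℂ))) :=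
        ((Complex.continuous_ofReal.comp NNReal.continuous_coe).continuousAt.tendsto.comp
          (hlim x)).const_mul _
      convert! h2 using 2
      by_cases hx : x ∈ F <;> simp [hx]
  rw [← integral_indicator hF.measurableSet]
  refine tendsto_nhds_unique this ?_
  have hz : ∀ n : ℕ, ∫ x, h x * (((thickenedIndicator (hδ0 n) F x : NNReal) : ℝ) : ℂ) ∂μ = 0 :=
    fun n => hcont ⟨fun x => ((thickenedIndicator (hδ0 n) F x : NNReal) : ℝ),
      NNReal.continuous_coe.comp (thickenedIndicator (hδ0 n) F).continuous⟩
  simp only [hz]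
  exact tendsto_const_nhds

/-- The monomial `z ↦ z^a (conj z)^b`. -/
def mono (a b : ℕ) (z : ℂ) : ℂ := z ^ a * (starRingEnd ℂ z) ^ b

theorem continuous_mono (a b : ℕ) : Continuous (mono a b) := by unfold mono; fun_prop

theorem contDiff_mono (a b : ℕ) {n : WithTop ℕ∞} : ContDiff ℝ n (mono a b) := by
  unfold mono
  exact (contDiff_id.pow a).mul (Complex.conjCLE.contDiff.pow b)

instance isFiniteMeasure_diskMeasure : IsFiniteMeasure diskMeasure :=
  ⟨by simp [diskMeasure]⟩

theorem ae_mem_closedBall : ∀ᵐ z ∂diskMeasure, z ∈ Metric.closedBall (0 : ℂ) 1 := by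
  filter_upwards [ae_restrict_mem (μ := volume) Metric.isOpen_ball.measurableSet] with z hz
  exact Metric.ball_subset_closedBall hz

/-- Polynomials in `z` and `conj z` determine an integrable function on the disk. -/
theorem ae_eq_zero_of_integral_mono {h : ℂ → ℂ} (hh : Integrable h diskMeasure)
    (h0 : ∀ a b, ∫ z, h z * mono a b z ∂diskMeasure = 0) : h =ᵐ[diskMeasure] 0 := by
  let m : ℕ × ℕ → C(ℂ, ℂ) := fun p => ⟨mono p.1 p.2, continuous_mono _ _⟩
  let re : C(ℂ, ℝ) := ⟨Complex.re, Complex.continuous_re⟩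
  let im : C(ℂ, ℝ) := ⟨Complex.im, Complex.continuous_im⟩
  have hmem : ∀ a b, m (a, b) ∈ Submodule.span ℂ (Set.range m) := fun a b =>
    Submodule.subset_span ⟨_, rfl⟩
  refine ae_eq_zero_of_forall_integral_mul_eq_zero (isCompact_closedBall (0 : ℂ) 1)
    ae_mem_closedBall hh {re, im} ?_ m ?_ ?_ fun i => h0 i.1 i.2
  · intro x y hxy
    by_cases hre : x.re = y.re
    · refine ⟨im, ⟨im, Algebra.subset_adjoin (by simp), rfl⟩, fun him => hxy (Complex.ext hre him)⟩
    · exact ⟨re, ⟨re, Algebra.subset_adjoin (by simp), rfl⟩, hre⟩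
  · convert! hmem 0 0
    ext z; simp [m, mono]
  · rintro g hg ⟨a, b⟩
    rcases hg with rfl | rfl
    · convert! Submodule.smul_mem _ (1 / 2 : ℂ) (Submodule.add_mem _ (hmem (a + 1) b)
        (hmem a (b + 1))) using 1
      ext z
      simp only [re, m, mono, ContinuousMap.mul_apply, ContinuousMap.coe_mk,
        ContinuousMap.smul_apply, ContinuousMap.add_apply, smul_eq_mul, Complex.re_eq_add_conj]
      ring
    · convert! Submodule.smul_mem _ (1 / (2 * Complex.I) : ℂ) (Submodule.sub_mem _
        (hmem (a + 1) b) (hmem a (b + 1))) using 1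
      ext z
      simp only [im, m, mono, ContinuousMap.mul_apply, ContinuousMap.coe_mk,
        ContinuousMap.smul_apply, ContinuousMap.sub_apply, smul_eq_mul, Complex.im_eq_sub_conj]
      ring

/-! ### Characters of the circle, chords of the disk and Santaló's formula -/

theorem continuous_expI (k : ℤ) : Continuous (expI k) := (fourier k).continuous

theorem expI_add_right (k : ℤ) (a b : Angles) : expI k (a + b) = expI k a * expI k b := by
  simp [expI, fourier_apply, smul_add, AddCircle.toCircle_add]

theorem expI_add_left (k l : ℤ) (a : Angles) : expI (k + l) a = expI k a * expI l a := fourier_add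

theorem expI_zero (a : Angles) : expI 0 a = 1 := fourier_zero

theorem conj_expI (k : ℤ) (a : Angles) : (starRingEnd ℂ) (expI k a) = expI (-k) a :=
  fourier_neg.symm

theorem norm_expI (k : ℤ) (a : Angles) : ‖expI k a‖ = 1 := Circle.norm_coe _

theorem expI_mul_neg (k : ℤ) (a : Angles) : expI k a * expI (-k) a = 1 := by
  rw [← expI_add_left, add_neg_cancel, expI_zero]

theorem expI_pow (k : ℤ) (n : ℕ) (a : Angles) : expI k a ^ n = expI (n * k) a := by
  induction n with
  | zero => simp [expI_zero]
  | succ n ih => rw [pow_succ, ih, ← expI_add_left]; congr 1; push_cast; ring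

theorem expI_one_coe (t : ℝ) : expI 1 (t : Angles) = Real.cos t + Real.sin t * Complex.I := by
  rw [expI_coe, Int.cast_one, mul_one, mul_comm, Complex.exp_mul_I]
  simp

/-- Rotations preserve Lebesgue measure on the disk. -/
theorem measurePreserving_rotate (θ : Angles) :
    MeasurePreserving (fun z : ℂ => expI 1 θ * z) diskMeasure diskMeasure := by
  have h := (rotation (AddCircle.toCircle θ)).measurePreserving
  have e : ⇑(rotation (AddCircle.toCircle θ)) = fun z : ℂ => expI 1 θ * z := by
    ext z; simp [expI]
  rw [e] at h
  have h2 := h.restrict_preimage (s := Metric.ball (0 : ℂ) 1) Metric.isOpen_ball.measurableSet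
  have : (fun z : ℂ => expI 1 θ * z) ⁻¹' Metric.ball (0 : ℂ) 1 = Metric.ball (0 : ℂ) 1 := by
    ext z; simp [norm_expI]
  rwa [this] at h2

/-- Lebesgue measure on the disk, sliced by the parallel chords `{t - e^{-iα} : 0 < t ≤ 2 cos α}`. -/
theorem lintegral_disk_eq_chords {G : ℂ → ENNReal} (hG : Measurable G) :
    ∫⁻ z, G z ∂diskMeasure = ∫⁻ α in Set.Ioo (-(π / 2)) (π / 2), ENNReal.ofReal (Real.cos α) *
      ∫⁻ t in Set.Ioc 0 (2 * Real.cos α), G ((t : ℂ) - expI (-1) (α : Angles)) := by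
  classical
  set H : ℂ → ENNReal := (Metric.ball (0 : ℂ) 1).indicator G with hH
  have hHm : Measurable H := hG.indicator Metric.isOpen_ball.measurableSet
  have e1 : ∫⁻ z, G z ∂diskMeasure = ∫⁻ y : ℝ, ∫⁻ x : ℝ, H (⟨x, y⟩ : ℂ) := by
    rw [diskMeasure, ← lintegral_indicator Metric.isOpen_ball.measurableSet,
      ← Complex.volume_preserving_equiv_real_prod.symm.lintegral_comp_emb
        Complex.measurableEquivRealProd.symm.measurableEmbedding, Measure.volume_eq_prod]
    exact lintegral_prod_symm' _ (hHm.comp Complex.measurableEquivRealProd.symm.measurable)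
  have hball : ∀ x y : ℝ, (⟨x, y⟩ : ℂ) ∈ Metric.ball (0 : ℂ) 1 ↔ x ^ 2 + y ^ 2 < 1 := by
    intro x y
    rw [mem_ball_zero_iff, ← sq_lt_one_iff₀ (norm_nonneg _), Complex.sq_norm, Complex.normSq_mk]
    ring_nf
  have e2 : ∫⁻ y : ℝ, ∫⁻ x : ℝ, H (⟨x, y⟩ : ℂ) =
      ∫⁻ y in Real.sin '' Set.Ioo (-(π / 2)) (π / 2), ∫⁻ x : ℝ, H (⟨x, y⟩ : ℂ) := by
    have him : Real.sin '' Set.Ioo (-(π / 2)) (π / 2) = Set.Ioo (-1) 1 :=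
      Real.sinPartialHomeomorph.image_source_eq_target
    rw [him, ← lintegral_indicator measurableSet_Ioo]
    refine lintegral_congr fun y => ?_
    by_cases hy : y ∈ Set.Ioo (-1 : ℝ) 1
    · simp [hy]
    · rw [Set.indicator_of_notMem hy]
      refine (lintegral_congr fun x => ?_).trans lintegral_zero
      refine Set.indicator_of_notMem (fun h => hy ?_) _
      rw [hball] at h
      rw [Set.mem_Ioo, ← abs_lt, ← sq_lt_one_iff_abs_lt_one]
      nlinarith
  -- The substitution is `y = sin α`, `x = t - cos α`; its Jacobian `cos α` is the density of
  -- `chordMeasure`.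
  rw [e1, e2, lintegral_image_eq_lintegral_abs_deriv_mul measurableSet_Ioo
    (fun x _ => (Real.hasDerivAt_sin x).hasDerivWithinAt)
    (fun x hx y hy h => Real.injOn_sin (Set.Ioo_subset_Icc_self hx) (Set.Ioo_subset_Icc_self hy) h)]
  refine setLIntegral_congr_fun measurableSet_Ioo fun α hα => ?_
  have hc := Real.cos_pos_of_mem_Ioo hα
  rw [abs_of_pos hc]
  congr 1
  rw [← lintegral_sub_right_eq_self _ (Real.cos α), ← restrict_Ioo_eq_restrict_Ioc,
    ← lintegral_indicator measurableSet_Ioo]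
  refine lintegral_congr fun t => ?_
  have hz : (⟨t - Real.cos α, Real.sin α⟩ : ℂ) = (t : ℂ) - expI (-1) (α : Angles) := by
    rw [← conj_expI, expI_one_coe]
    apply Complex.ext <;> simp [-Complex.ofReal_cos, -Complex.ofReal_sin]
  have hiff : (⟨t - Real.cos α, Real.sin α⟩ : ℂ) ∈ Metric.ball (0 : ℂ) 1 ↔
      t ∈ Set.Ioo 0 (2 * Real.cos α) := by
    rw [hball, Set.mem_Ioo]
    have := Real.sin_sq_add_cos_sq α
    constructor
    · intro h
      have h2 : t * (t - 2 * Real.cos α) < 0 := by nlinarith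
      constructor
      · by_contra h3; nlinarith
      · by_contra h3; nlinarith
    · rintro ⟨h1, h2⟩
      nlinarith
  rw [hH, Set.indicator_apply, Set.indicator_apply, ← hz]
  simp only [hiff]

/-- The point at time `t` of the geodesic with fan-beam coordinates `p`. -/
def ray (q : (Angles × ℝ) × ℝ) : ℂ × Angles :=
  (expI 1 q.1.1 + (q.2 : ℂ) * expI 1 (q.1.1 + ((π + q.1.2 : ℝ) : Angles)),
    q.1.1 + ((π + q.1.2 : ℝ) : Angles))

theorem continuous_coe_angle : Continuous (fun t : ℝ => (t : Angles)) := AddCircle.continuous_mk' _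

theorem continuous_ray : Continuous ray := by
  have h1 := continuous_expI 1
  have h2 := continuous_coe_angle
  unfold ray
  fun_prop

/-- The measure `cos α dβ dα` of the influx boundary. -/
def chordMeasure : Measure (Angles × ℝ) :=
  influxMeasure.withDensity fun p => ENNReal.ofReal (Real.cos p.2)

instance sFinite_influxMeasure : SFinite influxMeasure := by unfold influxMeasure; infer_instance
instance sFinite_chordMeasure : SFinite chordMeasure := by unfold chordMeasure; infer_instance
instance sFinite_diskMeasure : SFinite diskMeasure := inferInstance
instance isFiniteMeasure_bundleMeasure : IsFiniteMeasure bundleMeasure := by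
  unfold bundleMeasure; infer_instance

theorem expI_one_pi : expI 1 ((π : ℝ) : Angles) = -1 := by
  rw [expI_one_coe]; simp

/-- In the frame rotated to the direction of travel, every geodesic is a horizontal chord starting
at `-e^{-iα}`. This matches the slicing of the disk in `lintegral_disk_eq_chords`. -/
theorem ray_fst (β : Angles) (α t : ℝ) : (ray ((β, α), t)).1 =
    expI 1 (β + ((π + α : ℝ) : Angles)) * ((t : ℂ) - expI (-1) (α : Angles)) := by
  have h := expI_mul_neg 1 (α : Angles)
  simp only [ray, AddCircle.coe_add, expI_add_right, expI_one_pi]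
  linear_combination (-expI 1 β) * h

/-- The parameter domain of the geodesics of the disk. -/
def rayDomain : Set ((Angles × ℝ) × ℝ) := {q | 0 < q.2 ∧ q.2 ≤ 2 * Real.cos q.1.2}

theorem measurableSet_rayDomain : MeasurableSet rayDomain := by
  apply MeasurableSet.inter
  · exact measurableSet_lt measurable_const measurable_snd
  · exact measurableSet_le measurable_snd (by fun_prop)

/-- Santaló's formula. -/
theorem map_ray : Measure.map ray ((chordMeasure.prod volume).restrict rayDomain) =
    bundleMeasure := by
  refine Measure.ext_of_lintegral _ fun g hg => ?_
  rw [lintegral_map hg continuous_ray.measurable,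
    ← lintegral_indicator measurableSet_rayDomain]
  have hm : Measurable (rayDomain.indicator fun q => g (ray q)) :=
    (hg.comp continuous_ray.measurable).indicator measurableSet_rayDomain
  rw [lintegral_prod _ hm.aemeasurable, chordMeasure,
    lintegral_withDensity_eq_lintegral_mul _ (by fun_prop) hm.lintegral_prod_right',
    influxMeasure]
  have hm2 : Measurable (fun p : Angles × ℝ => ENNReal.ofReal (Real.cos p.2) *
      ∫⁻ t, rayDomain.indicator (fun q => g (ray q)) (p, t)) :=
    Measurable.mul (by fun_prop) hm.lintegral_prod_right'
  simp only [Pi.mul_apply]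
  rw [lintegral_prod_symm' _ hm2, bundleMeasure, lintegral_prod_symm' _ hg]
  set K : Angles → ℝ → ENNReal := fun θ α => ENNReal.ofReal (Real.cos α) *
    ∫⁻ t in Set.Ioc 0 (2 * Real.cos α), g (expI 1 θ * ((t : ℂ) - expI (-1) (α : Angles)), θ) with hK
  have hKm : Measurable (Function.uncurry K) := by
    refine Measurable.mul (by fun_prop) ?_
    have : Measurable (fun q : (Angles × ℝ) × ℝ => rayDomain.indicator (fun q =>
        g (expI 1 q.1.1 * ((q.2 : ℂ) - expI (-1) (q.1.2 : Angles)), q.1.1)) q) := by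
      refine Measurable.indicator (hg.comp ?_) measurableSet_rayDomain
      have h1 := continuous_expI 1
      have h2 := continuous_expI (-1)
      have h3 := continuous_coe_angle
      exact Continuous.measurable (by fun_prop)
    convert! this.lintegral_prod_right' (ν := (volume : Measure ℝ)) using 2 with p
    rw [← lintegral_indicator measurableSet_Ioc]
    rfl
  -- For a fixed direction `θ`, a rotation of the disk makes the chords of that direction
  -- horizontal.
  have hR : ∀ θ : Angles, ∫⁻ x, g (x, θ) ∂diskMeasure =
      ∫⁻ α in Set.Ioo (-(π / 2)) (π / 2), K θ α := by
    intro θ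
    refine ((measurePreserving_rotate θ).lintegral_comp (f := fun x => g (x, θ))
      (hg.comp measurable_prodMk_right)).symm.trans ?_
    exact lintegral_disk_eq_chords (G := fun z => g (expI 1 θ * z, θ)) (by fun_prop)
  simp only [hR]
  rw [lintegral_lintegral_swap hKm.aemeasurable]
  refine lintegral_congr fun α => ?_
  -- At fixed `α`, translating the direction by `π + α` passes to the fan-beam coordinate `β`.
  rw [← lintegral_add_right_eq_self (fun θ => K θ α) (((π + α : ℝ) : Angles))]
  refine lintegral_congr fun β => ?_
  simp only [hK]
  congr 1
  rw [← lintegral_indicator measurableSet_Ioc]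
  refine lintegral_congr fun t => ?_
  simp only [← ray_fst]
  rfl

theorem xray_eq_integral_indicator {f : ℂ × Angles → ℂ} {p : Angles × ℝ}
    (hp : 0 ≤ Real.cos p.2) : xray f p = ∫ t, rayDomain.indicator (fun q => f (ray q)) (p, t) := by
  rw [xray, intervalIntegral.integral_of_le (by positivity),
    ← integral_indicator measurableSet_Ioc]
  rfl

theorem ae_influx_mem : ∀ᵐ p ∂influxMeasure, p.2 ∈ Set.Ioo (-(π / 2)) (π / 2) := by
  rw [influxMeasure]
  have := ae_restrict_mem (μ := (volume : Measure ℝ)) (measurableSet_Ioo (a := -(π / 2)) (b := π / 2))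
  exact Measure.quasiMeasurePreserving_snd.ae this

/-- The density `cos α` is positive on the open interval of angles, so the two measures have the
same null sets. -/
theorem ae_chordMeasure_iff {P : Angles × ℝ → Prop} :
    (∀ᵐ p ∂chordMeasure, P p) ↔ ∀ᵐ p ∂influxMeasure, P p := by
  rw [chordMeasure, ae_withDensity_iff (by fun_prop)]
  constructor
  · intro h
    filter_upwards [h, ae_influx_mem] with p h1 h2
    exact h1 (by simpa using Real.cos_pos_of_mem_Ioo h2)
  · intro h
    filter_upwards [h] with p h1 _ using h1

/-- Santaló's formula and Fubini: `F` composed with `ray` is integrable over the parameter domain,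
and its inner integral in `t` is the X-ray transform. -/
theorem integrable_xray_and_integral {F : ℂ × Angles → ℂ} (hF : Integrable F bundleMeasure) :
    Integrable (xray F) chordMeasure ∧
      ∫ q, F q ∂bundleMeasure = ∫ p, xray F p ∂chordMeasure := by
  rw [← map_ray] at hF ⊢
  have hF2 := hF.comp_measurable continuous_ray.measurable
  have hF3 := (integrable_indicator_iff measurableSet_rayDomain).mpr hF2
  have hae : ∀ᵐ p ∂chordMeasure,
      ∫ t, rayDomain.indicator (F ∘ ray) (p, t) = xray F p := by
    rw [ae_chordMeasure_iff]
    filter_upwards [ae_influx_mem] with p hp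
    exact (xray_eq_integral_indicator (Real.cos_pos_of_mem_Ioo hp).le).symm
  refine ⟨hF3.integral_prod_left.congr hae, ?_⟩
  rw [integral_map continuous_ray.aemeasurable hF.aestronglyMeasurable,
    ← integral_indicator measurableSet_rayDomain, ← integral_congr_ae hae]
  exact integral_prod _ hF3

/-! ### Weights constant along geodesics, and the moments of the X-ray transform -/

/-- The function `(x, θ) ↦ (x e^{-iθ} - conj x e^{iθ})^k e^{ilθ}`, constant along geodesics. -/
def weight (k : ℕ) (l : ℤ) (q : ℂ × Angles) : ℂ :=
  (q.1 * expI (-1) q.2 - (starRingEnd ℂ) q.1 * expI 1 q.2) ^ k * expI l q.2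

theorem continuous_weight (k : ℕ) (l : ℤ) : Continuous (weight k l) := by
  have h1 := continuous_expI 1
  have h2 := continuous_expI (-1)
  have h3 := continuous_expI l
  unfold weight
  fun_prop

/-- Along a ray `x e^{-iθ} = t - e^{-iα}` by `ray_fst`. Subtracting the conjugate removes the real
parameter `t` and leaves `e^{iα} - e^{-iα} = 2i sin α`. -/
theorem weight_ray (k : ℕ) (l : ℤ) (p : Angles × ℝ) (t : ℝ) : weight k l (ray (p, t)) =
    (2 * Real.sin p.2 * Complex.I) ^ k * expI l (p.1 + ((π + p.2 : ℝ) : Angles)) := by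
  obtain ⟨β, α⟩ := p
  have e2 : (ray ((β, α), t)).2 = β + ((π + α : ℝ) : Angles) := rfl
  rw [weight, ray_fst, e2]
  congr 2
  have h := expI_mul_neg 1 (β + ((π + α : ℝ) : Angles))
  have h3 : expI 1 (α : Angles) - expI (-1) (α : Angles) = 2 * Real.sin α * Complex.I := by
    rw [← conj_expI, expI_one_coe]
    apply Complex.ext <;> simp; ring
  rw [map_mul, map_sub, conj_expI, conj_expI, Complex.conj_ofReal, neg_neg, ← h3]
  linear_combination (expI 1 (α : Angles) - expI (-1) (α : Angles)) * h

theorem xray_mul_weight (f : ℂ × Angles → ℂ) (k : ℕ) (l : ℤ) (p : Angles × ℝ) :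
    xray (fun q => f q * weight k l q) p = xray f p *
      ((2 * Real.sin p.2 * Complex.I) ^ k * expI l (p.1 + ((π + p.2 : ℝ) : Angles))) := by
  rw [xray, xray, ← intervalIntegral.integral_mul_const]
  congr 1
  ext t
  rw [← weight_ray k l p t]
  rfl

theorem ae_norm_fst_le : ∀ᵐ q ∂bundleMeasure, ‖q.1‖ ≤ 1 := by
  have := Measure.quasiMeasurePreserving_fst (μ := diskMeasure)
    (ν := (volume : Measure Angles)) |>.ae ae_mem_closedBall
  simpa [bundleMeasure] using this

theorem norm_weight_le (k : ℕ) (l : ℤ) {q : ℂ × Angles} (hq : ‖q.1‖ ≤ 1) :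
    ‖weight k l q‖ ≤ 2 ^ k := by
  rw [weight, norm_mul, norm_expI, mul_one, norm_pow]
  refine pow_le_pow_left₀ (norm_nonneg _) ?_ k
  refine (norm_sub_le _ _).trans ?_
  rw [norm_mul, norm_mul, norm_expI, norm_expI, RCLike.norm_conj]
  linarith

theorem integrable_mul_weight {f : ℂ × Angles → ℂ} (hf : Integrable f bundleMeasure) (k : ℕ)
    (l : ℤ) : Integrable (fun q => f q * weight k l q) bundleMeasure := by
  refine hf.mul_bdd (c := 2 ^ k) (continuous_weight k l).aestronglyMeasurable ?_
  filter_upwards [ae_norm_fst_le] with q hq using norm_weight_le k l hq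

/-- The moments of a function on the circle bundle. -/
def moment (k : ℕ) (l : ℤ) (f : ℂ × Angles → ℂ) : ℂ := ∫ q, f q * weight k l q ∂bundleMeasure

theorem moment_eq {f : ℂ × Angles → ℂ} (hf : Integrable f bundleMeasure) (k : ℕ) (l : ℤ) :
    moment k l f = ∫ p, xray f p *
      ((2 * Real.sin p.2 * Complex.I) ^ k * expI l (p.1 + ((π + p.2 : ℝ) : Angles)))
        ∂chordMeasure := by
  rw [moment, (integrable_xray_and_integral (integrable_mul_weight hf k l)).2]
  simp only [xray_mul_weight]

/-- The functions `(2i sin α)^k e^{ilθ}` of the geodesics determine an integrable function. -/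
theorem ae_eq_zero_of_integral_chord {h : Angles × ℝ → ℂ} (hh : Integrable h chordMeasure)
    (h0 : ∀ (k : ℕ) (l : ℤ), ∫ p, h p * ((2 * Real.sin p.2 * Complex.I) ^ k *
      expI l (p.1 + ((π + p.2 : ℝ) : Angles))) ∂chordMeasure = 0) : h =ᵐ[chordMeasure] 0 := by
  -- In the coordinates `(θ, s) = (β + π + α, sin α)` the weights become `(2is)^k e^{ilθ}` on the
  -- compact set `𝕊¹ × [-1, 1]`, where they span a module over a separating algebra. Since `|α| <
  -- π/2`, the inverse `Ψ` is given by `arcsin`.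
  let Φ : Angles × ℝ → Angles × ℝ := fun p => (p.1 + ((π + p.2 : ℝ) : Angles), Real.sin p.2)
  let Ψ : Angles × ℝ → Angles × ℝ := fun q =>
    (q.1 - ((π + Real.arcsin q.2 : ℝ) : Angles), Real.arcsin q.2)
  have hco := continuous_coe_angle
  have hΦ : Measurable Φ := Continuous.measurable (by fun_prop)
  have hΨ : Measurable Ψ := Continuous.measurable (by
    have := Real.continuous_arcsin
    fun_prop)
  have hΨΦ : ∀ᵐ p ∂chordMeasure, Ψ (Φ p) = p := by
    rw [ae_chordMeasure_iff]
    filter_upwards [ae_influx_mem] with p hp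
    simp [Φ, Ψ, Real.arcsin_sin hp.1.le hp.2.le]
  -- A strongly measurable representative is needed: composing `h` itself with `Ψ` need not be
  -- measurable.
  set h' := hh.1.mk h with hh'
  have hmk : h =ᵐ[chordMeasure] h' := hh.1.ae_eq_mk
  have hΨh : ∀ᵐ p ∂chordMeasure, h' (Ψ (Φ p)) = h p := by
    filter_upwards [hΨΦ, hmk] with p h1 h2
    rw [h1, h2]
  have hsm : StronglyMeasurable (h' ∘ Ψ) := hh.1.stronglyMeasurable_mk.comp_measurable hΨ
  have hint : Integrable (h' ∘ Ψ) (chordMeasure.map Φ) := by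
    rw [integrable_map_measure hsm.aestronglyMeasurable hΦ.aemeasurable]
    exact hh.congr (hΨh.mono fun p hp => hp.symm)
  let m : ℕ × ℤ → C(Angles × ℝ, ℂ) := fun i => ⟨fun p => (2 * p.2 * Complex.I) ^ i.1 *
      expI i.2 p.1, by have := continuous_expI i.2; fun_prop⟩
  have hmem : ∀ k l, m (k, l) ∈ Submodule.span ℂ (Set.range m) := fun k l =>
    Submodule.subset_span ⟨_, rfl⟩
  have hc1 := continuous_expI 1
  let s : C(Angles × ℝ, ℝ) := ⟨fun p => p.2, by fun_prop⟩
  let re : C(Angles × ℝ, ℝ) := ⟨fun p => (expI 1 p.1).re, by fun_prop⟩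
  let im : C(Angles × ℝ, ℝ) := ⟨fun p => (expI 1 p.1).im, by fun_prop⟩
  have key : h' ∘ Ψ =ᵐ[chordMeasure.map Φ] 0 := by
    refine ae_eq_zero_of_forall_integral_mul_eq_zero (K := Set.univ ×ˢ Set.Icc (-1) 1)
      (isCompact_univ.prod isCompact_Icc) ?_ hint {s, re, im} ?_ m ?_ ?_ ?_
    · refine (ae_map_iff hΦ.aemeasurable (MeasurableSet.univ.prod measurableSet_Icc)).mpr ?_
      exact Eventually.of_forall fun p => ⟨trivial, Real.sin_mem_Icc p.2⟩
    · intro x y hxy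
      by_cases h2 : x.2 = y.2
      · by_cases hre : (expI 1 x.1).re = (expI 1 y.1).re
        · refine ⟨im, ⟨im, Algebra.subset_adjoin (by simp), rfl⟩, fun him => hxy ?_⟩
          have : expI 1 x.1 = expI 1 y.1 := Complex.ext hre him
          refine Prod.ext ?_ h2
          simp only [expI, fourier_one] at this
          exact AddCircle.injective_toCircle Real.two_pi_pos.ne' (Subtype.ext this)
        · exact ⟨re, ⟨re, Algebra.subset_adjoin (by simp), rfl⟩, hre⟩
      · exact ⟨s, ⟨s, Algebra.subset_adjoin (by simp), rfl⟩, h2⟩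
    · convert! hmem 0 0
      ext z; simp [m, expI_zero]
    · rintro g hg ⟨k, l⟩
      rcases hg with rfl | rfl | rfl
      · convert! Submodule.smul_mem _ (1 / (2 * Complex.I) : ℂ) (hmem (k + 1) l) using 1
        ext z
        simp only [s, m, ContinuousMap.mul_apply, ContinuousMap.coe_mk, ContinuousMap.smul_apply,
          smul_eq_mul, pow_succ]
        field_simp
      · convert! Submodule.smul_mem _ (1 / 2 : ℂ) (Submodule.add_mem _ (hmem k (1 + l))
          (hmem k (-1 + l))) using 1
        ext z
        simp only [re, m, ContinuousMap.mul_apply, ContinuousMap.coe_mk,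
          ContinuousMap.smul_apply, ContinuousMap.add_apply, smul_eq_mul, Complex.re_eq_add_conj,
          expI_add_left _ l, conj_expI]
        ring
      · convert! Submodule.smul_mem _ (1 / (2 * Complex.I) : ℂ) (Submodule.sub_mem _
          (hmem k (1 + l)) (hmem k (-1 + l))) using 1
        ext z
        simp only [im, m, ContinuousMap.mul_apply, ContinuousMap.coe_mk,
          ContinuousMap.smul_apply, ContinuousMap.sub_apply, smul_eq_mul, Complex.im_eq_sub_conj,
          expI_add_left _ l, conj_expI]
        ring
    · rintro ⟨k, l⟩
      refine (integral_map hΦ.aemeasurable (hsm.aestronglyMeasurable.mul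
        (m (k, l)).continuous.aestronglyMeasurable)).trans ?_
      rw [← h0 k l]
      refine integral_congr_ae ?_
      filter_upwards [hΨh] with p hp
      rw [← hp]
      rfl
  filter_upwards [ae_of_ae_map hΦ.aemeasurable key, hΨh] with p h1 h2
  rw [← h2]
  exact h1

/-- Every moment is an integral of the X-ray transform against a bounded function of the geodesic,
and these functions determine an integrable function on the influx boundary. -/
theorem xray_ae_eq_iff {f g : ℂ × Angles → ℂ} (hf : Integrable f bundleMeasure)
    (hg : Integrable g bundleMeasure) :
    xray f =ᵐ[influxMeasure] xray g ↔ ∀ k l, moment k l f = moment k l g := by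
  have hc : ∀ l : ℤ, Continuous fun p : Angles × ℝ => expI l (p.1 + ((π + p.2 : ℝ) : Angles)) :=
    fun l => (continuous_expI l).comp
      (continuous_fst.add (continuous_coe_angle.comp (continuous_const.add continuous_snd)))
  constructor
  · intro h k l
    rw [moment_eq hf, moment_eq hg]
    refine integral_congr_ae ?_
    filter_upwards [ae_chordMeasure_iff.mpr h] with p hp
    rw [hp]
  · intro h
    have h1 := (integrable_xray_and_integral hf).1
    have h2 := (integrable_xray_and_integral hg).1
    have hz : (fun p => xray f p - xray g p) =ᵐ[chordMeasure] 0 := by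
      refine ae_eq_zero_of_integral_chord (h1.sub h2) fun k l => ?_
      have hb : ∀ p : Angles × ℝ, ‖(2 * Real.sin p.2 * Complex.I : ℂ) ^ k *
          expI l (p.1 + ((π + p.2 : ℝ) : Angles))‖ ≤ 2 ^ k := by
        intro p
        rw [norm_mul, norm_expI, mul_one, norm_pow]
        refine pow_le_pow_left₀ (norm_nonneg _) ?_ k
        simpa [-Complex.ofReal_sin, abs_mul] using Real.abs_sin_le_one p.2
      have hm : AEStronglyMeasurable (fun p : Angles × ℝ => (2 * Real.sin p.2 * Complex.I : ℂ) ^ k *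
          expI l (p.1 + ((π + p.2 : ℝ) : Angles))) chordMeasure := by
        have := hc l
        exact Continuous.aestronglyMeasurable (by fun_prop)
      simp only [sub_mul]
      rw [integral_sub (h1.mul_bdd hm (Eventually.of_forall hb))
        (h2.mul_bdd hm (Eventually.of_forall hb)), ← moment_eq hf, ← moment_eq hg, h, sub_self]
    have := ae_chordMeasure_iff.mp hz
    filter_upwards [this] with p hp
    simpa [sub_eq_zero] using hp

/-! ### Fourier components in `L²(S𝔻)` and their moments -/

theorem integral_expI (k : ℤ) : ∫ θ : Angles, expI k θ = if k = 0 then (2 * π : ℂ) else 0 := by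
  split_ifs with hk
  · subst hk
    simp only [expI_zero, integral_const]
    rw [measureReal_def, AddCircle.measure_univ, ENNReal.toReal_ofReal Real.two_pi_pos.le]
    simp
  · refine integral_eq_zero_of_add_right_eq_neg (μ := (volume : Measure Angles))
      (fourier_add_half_inv_index hk Real.two_pi_pos)

/-- The space `L²(𝔻)`. -/
abbrev L2Disk : Type := Lp ℂ 2 diskMeasure

theorem memLp_harmonic (k : ℤ) {u : ℂ → ℂ} (hu : MemLp u 2 diskMeasure) :
    MemLp (harmonic k u) 2 bundleMeasure := by
  have hm : AEStronglyMeasurable (harmonic k u) bundleMeasure :=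
    hu.1.comp_fst.mul ((continuous_expI k).comp continuous_snd).aestronglyMeasurable
  rw [memLp_two_iff_integrable_sq_norm hm]
  have h := hu.integrable_norm_pow (by norm_num)
  have h2 := h.mul_prod (integrable_const (1 : ℝ) (μ := (volume : Measure Angles)))
  refine h2.congr (Eventually.of_forall fun q => ?_)
  simp [harmonic, norm_expI]

theorem integral_harmonic_mul (k : ℤ) (u v : ℂ → ℂ) :
    ∫ q, harmonic k (fun z => u z * v z) q ∂bundleMeasure =
      (∫ z, u z * v z ∂diskMeasure) * if k = 0 then (2 * π : ℂ) else 0 := by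
  rw [← integral_expI, bundleMeasure]
  exact integral_prod_mul (fun z => u z * v z) (expI k)

theorem toLp_harmonic_congr (k : ℤ) {u v : ℂ → ℂ} (h : u =ᵐ[diskMeasure] v) :
    harmonic k u =ᵐ[bundleMeasure] harmonic k v := by
  have := (Measure.quasiMeasurePreserving_fst (μ := diskMeasure)
    (ν := (volume : Measure Angles))).ae_eq_comp h
  filter_upwards [this] with q hq
  simp only [harmonic]
  rw [show u q.1 = v q.1 from hq]

/-- The element `u(x) e^{ikθ}` of `L²(S𝔻)`. -/
def embFun (k : ℤ) (u : L2Disk) : L2SD := (memLp_harmonic k (Lp.memLp u)).toLp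

theorem coe_embFun (k : ℤ) (u : L2Disk) : embFun k u =ᵐ[bundleMeasure] harmonic k u :=
  MemLp.coeFn_toLp _

theorem inner_embFun (k l : ℤ) (u v : L2Disk) :
    inner ℂ (embFun k u) (embFun l v) = if k = l then 2 * π * inner ℂ u v else 0 := by
  rw [L2.inner_def, L2.inner_def]
  have : ∫ q, inner ℂ (embFun k u q) (embFun l v q) ∂bundleMeasure =
      ∫ q, harmonic (l - k) (fun z => v z * (starRingEnd ℂ) (u z)) q ∂bundleMeasure := by
    refine integral_congr_ae ?_
    filter_upwards [coe_embFun k u, coe_embFun l v] with q h1 h2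
    rw [h1, h2]
    simp only [harmonic, RCLike.inner_apply, map_mul, conj_expI, sub_eq_add_neg, expI_add_left]
    ring
  rw [this, integral_harmonic_mul]
  simp only [RCLike.inner_apply, sub_eq_zero, eq_comm (a := l)]
  split_ifs <;> ring

/-- The linear map `u ↦ u(x) e^{ikθ}`. -/
def embLM (k : ℤ) : L2Disk →ₗ[ℂ] L2SD where
  toFun := embFun k
  map_add' u v := by
    refine Lp.ext ?_
    refine (coe_embFun _ _).trans ?_
    refine (toLp_harmonic_congr k (Lp.coeFn_add u v)).trans ?_
    filter_upwards [coe_embFun k u, coe_embFun k v, Lp.coeFn_add (embFun k u) (embFun k v)]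
      with q h1 h2 h3
    rw [h3, Pi.add_apply, h1, h2]
    simp [harmonic, add_mul]
  map_smul' c u := by
    refine Lp.ext ?_
    refine (coe_embFun _ _).trans ?_
    refine (toLp_harmonic_congr k (Lp.coeFn_smul c u)).trans ?_
    filter_upwards [coe_embFun k u, Lp.coeFn_smul c (embFun k u)] with q h1 h3
    rw [RingHom.id_apply, h3, Pi.smul_apply, h1]
    simp [harmonic, mul_assoc]

theorem norm_embFun (k : ℤ) (u : L2Disk) : ‖embFun k u‖ = √(2 * π) * ‖u‖ := by
  have h := inner_embFun k k u u
  rw [if_pos rfl, inner_self_eq_norm_sq_to_K, inner_self_eq_norm_sq_to_K] at h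
  have h2 : ‖embFun k u‖ ^ 2 = 2 * π * ‖u‖ ^ 2 := by
    apply Complex.ofReal_injective
    push_cast
    exact h
  rw [← Real.sqrt_sq (norm_nonneg (embFun k u)), h2, Real.sqrt_mul (by positivity),
    Real.sqrt_sq (norm_nonneg u)]

/-- The bounded linear map `u ↦ u(x) e^{ikθ}` from `L²(𝔻)` to `L²(S𝔻)`. -/
def emb (k : ℤ) : L2Disk →L[ℂ] L2SD :=
  (embLM k).mkContinuous (√(2 * π)) fun u => (norm_embFun k u).le

theorem coe_emb (k : ℤ) (u : L2Disk) : emb k u =ᵐ[bundleMeasure] harmonic k u := coe_embFun k u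

theorem inner_emb (k l : ℤ) (u v : L2Disk) :
    inner ℂ (emb k u) (emb l v) = if k = l then 2 * π * inner ℂ u v else 0 := inner_embFun k l u v

theorem norm_emb (k : ℤ) (u : L2Disk) : ‖emb k u‖ = √(2 * π) * ‖u‖ := norm_embFun k u

theorem emb_eq_iff (k : ℤ) (u : ℂ → ℂ) (hu : MemLp u 2 diskMeasure) (h : L2SD) :
    h = emb k hu.toLp ↔ h =ᵐ[bundleMeasure] harmonic k u := by
  have h1 : emb k hu.toLp =ᵐ[bundleMeasure] harmonic k u :=
    (coe_emb k _).trans (toLp_harmonic_congr k hu.coeFn_toLp)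
  constructor
  · rintro rfl
    exact h1
  · intro h2
    exact Lp.ext (h2.trans h1.symm)

theorem memLp_weight (k : ℕ) (l : ℤ) :
    MemLp (fun q => (starRingEnd ℂ) (weight k l q)) 2 bundleMeasure := by
  refine MemLp.of_bound (Complex.continuous_conj.comp (continuous_weight k l)).aestronglyMeasurable
    (2 ^ k) ?_
  filter_upwards [ae_norm_fst_le] with q hq
  rw [RCLike.norm_conj]
  exact norm_weight_le k l hq

/-- The conjugate weight function, as an element of `L²(S𝔻)`. -/
def weightLp (k : ℕ) (l : ℤ) : L2SD := (memLp_weight k l).toLp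

theorem inner_weightLp (k : ℕ) (l : ℤ) (f : L2SD) :
    inner ℂ (weightLp k l) f = moment k l f := by
  rw [L2.inner_def, moment]
  refine integral_congr_ae ?_
  filter_upwards [(memLp_weight k l).coeFn_toLp] with q hq
  rw [weightLp, hq]
  simp

/-- The space of functions all of whose moments vanish. -/
def momentKer : Submodule ℂ L2SD :=
  (Submodule.span ℂ (Set.range fun i : ℕ × ℤ => weightLp i.1 i.2))ᗮ

theorem mem_momentKer {f : L2SD} : f ∈ momentKer ↔ ∀ k l, moment k l f = 0 := by
  rw [momentKer, Submodule.mem_orthogonal]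
  constructor
  · intro h k l
    rw [← inner_weightLp]
    exact h _ (Submodule.subset_span ⟨(k, l), rfl⟩)
  · intro h u hu
    induction hu using Submodule.span_induction with
    | mem x hx => obtain ⟨i, rfl⟩ := hx; rw [inner_weightLp, h]
    | zero => simp
    | add x y _ _ hx hy => rw [inner_add_left, hx, hy, add_zero]
    | smul a x _ hx => rw [inner_smul_left, hx, mul_zero]

theorem isClosed_momentKer : IsClosed (momentKer : Set L2SD) := Submodule.isClosed_orthogonal _

theorem integrable_L2SD (f : L2SD) : Integrable f bundleMeasure :=
  (Lp.memLp f).integrable one_le_two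

theorem xray_ae_eq_iff_sub_mem {f g : L2SD} :
    xray f =ᵐ[influxMeasure] xray g ↔ f - g ∈ momentKer := by
  rw [xray_ae_eq_iff (integrable_L2SD f) (integrable_L2SD g), mem_momentKer]
  simp only [← inner_weightLp, inner_sub_right, sub_eq_zero]

/-- The moments `∫ u z^a (conj z)^b` of a function on the disk. -/
def diskMoment (a b : ℕ) (u : ℂ → ℂ) : ℂ := ∫ z, u z * mono a b z ∂diskMeasure

theorem norm_mono_le (a b : ℕ) {z : ℂ} (hz : z ∈ Metric.closedBall (0 : ℂ) 1) :
    ‖mono a b z‖ ≤ 1 := by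
  rw [mem_closedBall_zero_iff] at hz
  rw [mono, norm_mul, norm_pow, norm_pow, RCLike.norm_conj]
  exact mul_le_one₀ (pow_le_one₀ (norm_nonneg _) hz) (by positivity)
    (pow_le_one₀ (norm_nonneg _) hz)

theorem integrable_mul_mono {u : ℂ → ℂ} (hu : Integrable u diskMeasure) (a b : ℕ) :
    Integrable (fun z => u z * mono a b z) diskMeasure :=
  hu.mul_bdd (continuous_mono a b).aestronglyMeasurable
    (ae_mem_closedBall.mono fun _ hz => norm_mono_le a b hz)

theorem integrable_L2Disk (u : L2Disk) : Integrable u diskMeasure :=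
  (Lp.memLp u).integrable one_le_two

/-- Binomial expansion of the weight: the term `z^a conj z^{k-a}` carries the frequency `l + j + k -
2a`, and integration over `θ` keeps it only when this is zero. At most one term of the sum survives.
-/
theorem moment_emb (k : ℕ) (l j : ℤ) (u : L2Disk) :
    moment k l (emb j u) = 2 * π * ∑ a ∈ Finset.range (k + 1),
      if l + j = 2 * a - k then (k.choose a : ℂ) * (-1) ^ (k - a) * diskMoment a (k - a) u
      else 0 := by
  have hpt : ∀ q : ℂ × Angles, harmonic j u q * weight k l q = ∑ a ∈ Finset.range (k + 1),
      (k.choose a : ℂ) * (-1) ^ (k - a) *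
        harmonic (l + j + k - 2 * a) (fun z => u z * mono a (k - a) z) q := by
    intro q
    rw [weight, sub_eq_add_neg, add_pow, Finset.sum_mul, Finset.mul_sum]
    refine Finset.sum_congr rfl fun a ha => ?_
    have hak : a ≤ k := Nat.lt_succ_iff.mp (Finset.mem_range.mp ha)
    have he : expI (l + j + k - 2 * a) q.2 =
        expI 1 q.2 ^ (k - a) * expI (-1) q.2 ^ a * expI l q.2 * expI j q.2 := by
      rw [expI_pow, expI_pow, ← expI_add_left, ← expI_add_left, ← expI_add_left]
      congr 1
      push_cast [hak]
      ring
    simp only [harmonic, mono]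
    rw [he, mul_pow, neg_pow, mul_pow]
    ring
  have hint : ∀ a : ℕ, Integrable (harmonic (l + j + k - 2 * a) fun z => u z * mono a (k - a) z)
      bundleMeasure := fun a =>
    (integrable_mul_mono (integrable_L2Disk u) a (k - a)).mul_prod
      (Integrable.of_bound (continuous_expI _).aestronglyMeasurable 1
        (Eventually.of_forall fun q => (norm_expI _ _).le))
  rw [moment]
  calc ∫ q, emb j u q * weight k l q ∂bundleMeasure
      = ∫ q, ∑ a ∈ Finset.range (k + 1), (k.choose a : ℂ) * (-1) ^ (k - a) *
        harmonic (l + j + k - 2 * a) (fun z => u z * mono a (k - a) z) q ∂bundleMeasure := by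
        refine integral_congr_ae ?_
        filter_upwards [coe_emb j u] with q hq
        rw [hq, hpt]
    _ = _ := by
        rw [integral_finsetSum _ fun a _ => (hint a).const_mul _, Finset.mul_sum]
        refine Finset.sum_congr rfl fun a _ => ?_
        rw [integral_const_mul, integral_harmonic_mul, ← diskMoment]
        have : l + j + k - 2 * a = 0 ↔ l + j = 2 * a - k := by omega
        simp only [this]
        split_ifs <;> ring

/-! ### Wirtinger derivatives of smooth functions and of monomials -/

theorem memLp_of_continuous {g : ℂ → ℂ} (hg : Continuous g) : MemLp g 2 diskMeasure := by
  obtain ⟨C, hC⟩ := (isCompact_closedBall (0 : ℂ) 1).exists_bound_of_continuousOn hg.continuousOn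
  exact MemLp.of_bound hg.aestronglyMeasurable C (ae_mem_closedBall.mono hC)

theorem integrable_mul_continuous {u g : ℂ → ℂ} (hu : Integrable u diskMeasure)
    (hg : Continuous g) : Integrable (fun z => u z * g z) diskMeasure := by
  obtain ⟨C, hC⟩ := (isCompact_closedBall (0 : ℂ) 1).exists_bound_of_continuousOn hg.continuousOn
  exact hu.mul_bdd hg.aestronglyMeasurable (ae_mem_closedBall.mono hC)

theorem fderiv_eq_dz (φ : ℂ → ℂ) (z v : ℂ) :
    fderiv ℝ φ z v = dz φ z * v + dzbar φ z * (starRingEnd ℂ) v := by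
  have h : fderiv ℝ φ z v = v.re * fderiv ℝ φ z 1 + v.im * fderiv ℝ φ z Complex.I := by
    have : v = v.re • (1 : ℂ) + v.im • Complex.I := by
      simp [Complex.real_smul]
    conv_lhs => rw [this]
    rw [map_add, map_smul, map_smul, Complex.real_smul, Complex.real_smul]
  rw [h, dz, dzbar]
  have h1 : v = v.re + v.im * Complex.I := (Complex.re_add_im v).symm
  have h2 : (starRingEnd ℂ) v = v.re - v.im * Complex.I := by
    apply Complex.ext <;> simp
  rw [h2]
  nth_rw 3 [h1]
  linear_combination (v.im * fderiv ℝ φ z Complex.I) * Complex.I_sq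

theorem continuous_fderiv_apply_of_contDiff {φ : ℂ → ℂ} (h : ContDiff ℝ ∞ φ) (v : ℂ) :
    Continuous fun z => fderiv ℝ φ z v :=
  (h.continuous_fderiv (by simp)).clm_apply continuous_const

theorem continuous_dz {φ : ℂ → ℂ} (h : ContDiff ℝ ∞ φ) : Continuous (dz φ) := by
  have h1 := continuous_fderiv_apply_of_contDiff h 1
  have h2 := continuous_fderiv_apply_of_contDiff h Complex.I
  unfold dz
  fun_prop

theorem continuous_dzbar {φ : ℂ → ℂ} (h : ContDiff ℝ ∞ φ) : Continuous (dzbar φ) := by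
  have h1 := continuous_fderiv_apply_of_contDiff h 1
  have h2 := continuous_fderiv_apply_of_contDiff h Complex.I
  unfold dzbar
  fun_prop

theorem norm_dz_le (φ : ℂ → ℂ) (z : ℂ) : ‖dz φ z‖ ≤ ‖fderiv ℝ φ z‖ := by
  have h1 := (fderiv ℝ φ z).le_opNorm 1
  have h2 := (fderiv ℝ φ z).le_opNorm Complex.I
  rw [norm_one, mul_one] at h1
  rw [Complex.norm_I, mul_one] at h2
  rw [dz, norm_div, Complex.norm_ofNat]
  have := norm_sub_le (fderiv ℝ φ z 1) (Complex.I * fderiv ℝ φ z Complex.I)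
  rw [norm_mul, Complex.norm_I, one_mul] at this
  linarith

theorem norm_dzbar_le (φ : ℂ → ℂ) (z : ℂ) : ‖dzbar φ z‖ ≤ ‖fderiv ℝ φ z‖ := by
  have h1 := (fderiv ℝ φ z).le_opNorm 1
  have h2 := (fderiv ℝ φ z).le_opNorm Complex.I
  rw [norm_one, mul_one] at h1
  rw [Complex.norm_I, mul_one] at h2
  rw [dzbar, norm_div, Complex.norm_ofNat]
  have := norm_add_le (fderiv ℝ φ z 1) (Complex.I * fderiv ℝ φ z Complex.I)
  rw [norm_mul, Complex.norm_I, one_mul] at this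
  linarith

theorem hasFDerivAt_mono (a b : ℕ) (z v : ℂ) :
    fderiv ℝ (mono a b) z v = a * mono (a - 1) b z * v + b * mono a (b - 1) z *
      (starRingEnd ℂ) v := by
  have h1 : HasFDerivAt (fun z : ℂ => z ^ a) ((a * z ^ (a - 1)) •
      (ContinuousLinearMap.id ℝ ℂ)) z := by
    convert! (hasFDerivAt_id (𝕜 := ℝ) z).pow a using 1
    ext
    simp
  have h2 : HasFDerivAt (fun z : ℂ => (starRingEnd ℂ z) ^ b) ((b * (starRingEnd ℂ z) ^ (b - 1)) •
      (Complex.conjCLE : ℂ →L[ℝ] ℂ)) z := by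
    convert! (Complex.conjCLE.hasFDerivAt (x := z)).pow b using 1
    ext
    simp
  have h3 : HasFDerivAt (mono a b) _ z := h1.mul h2
  rw [h3.fderiv]
  simp [mono]
  ring

theorem dz_mono (a b : ℕ) (z : ℂ) : dz (mono a b) z = a * mono (a - 1) b z := by
  rw [dz, hasFDerivAt_mono, hasFDerivAt_mono]
  simp
  linear_combination (-(a * mono (a - 1) b z) / 2 + b * mono a (b - 1) z / 2) * Complex.I_sq

theorem dzbar_mono (a b : ℕ) (z : ℂ) : dzbar (mono a b) z = b * mono a (b - 1) z := by
  rw [dzbar, hasFDerivAt_mono, hasFDerivAt_mono]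
  simp
  linear_combination (a * mono (a - 1) b z / 2 - b * mono a (b - 1) z / 2) * Complex.I_sq

/-! ### Cut-off functions, and moment recurrences from weak equations -/

theorem contDiff_test (φ : 𝓓(disk, ℂ)) : ContDiff ℝ ∞ φ := φ.contDiff

/-- A smooth compactly supported function with support in the disk, as a test function. -/
def mkTest (φ : ℂ → ℂ) (h1 : ContDiff ℝ ∞ φ) (h2 : HasCompactSupport φ)
    (h3 : tsupport φ ⊆ Metric.ball 0 1) : 𝓓(disk, ℂ) := ⟨φ, h1, h2, h3⟩

theorem exists_bound_deriv_smoothTransition :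
    ∃ M, 0 ≤ M ∧ ∀ x, ‖deriv Real.smoothTransition x‖ ≤ M ∧
      (deriv Real.smoothTransition x ≠ 0 → x ≤ 1) := by
  have hc : Continuous (deriv Real.smoothTransition) :=
    (Real.smoothTransition.contDiff (n := 1)).continuous_deriv le_rfl
  obtain ⟨M, hM⟩ := (isCompact_Icc (a := (0 : ℝ)) (b := 1)).exists_bound_of_continuousOn
    hc.continuousOn
  have h0 : ∀ x, x < 0 → deriv Real.smoothTransition x = 0 := by
    intro x hx
    have : Real.smoothTransition =ᶠ[𝓝 x] fun _ => 0 := by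
      filter_upwards [eventually_lt_nhds hx] with y hy
      exact Real.smoothTransition.zero_of_nonpos hy.le
    rw [this.deriv_eq, deriv_const]
  have h1 : ∀ x, 1 < x → deriv Real.smoothTransition x = 0 := by
    intro x hx
    have : Real.smoothTransition =ᶠ[𝓝 x] fun _ => 1 := by
      filter_upwards [eventually_gt_nhds hx] with y hy
      exact Real.smoothTransition.one_of_one_le hy.le
    rw [this.deriv_eq, deriv_const]
  have hM0 : 0 ≤ M := (norm_nonneg _).trans (hM 0 (by simp))
  refine ⟨M, hM0, fun x => ⟨?_, fun hne => ?_⟩⟩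
  · rcases lt_or_ge x 0 with h | h
    · simpa [h0 x h]
    · rcases lt_or_ge 1 x with h' | h'
      · simpa [h1 x h']
      · exact hM x ⟨h, h'⟩
  · by_contra! h
    exact hne (h1 x h)

/-- A cut-off function, equal to `1` where `2 ≤ n (1 - ‖z‖²)` and to `0` where
`n (1 - ‖z‖²) ≤ 1`. -/
def cutoff (n : ℕ) (z : ℂ) : ℝ := Real.smoothTransition (n * (1 - ‖z‖ ^ 2) - 1)

theorem contDiff_cutoff (n : ℕ) : ContDiff ℝ ∞ (cutoff n) := by
  have : ContDiff ℝ ∞ fun z : ℂ => ‖z‖ ^ 2 := contDiff_norm_sq ℝ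
  exact Real.smoothTransition.contDiff.comp
    ((contDiff_const.mul (contDiff_const.sub this)).sub contDiff_const)

/-- The gradient of the cut-off has size of order `n`, but it vanishes unless `n (1 - ‖z‖²) ≤ 2`.
Thus a factor `1 - ‖z‖²` makes the bound uniform in `n`. -/
theorem norm_fderiv_cutoff_mul_le : ∃ M, 0 ≤ M ∧ ∀ (n : ℕ) (z : ℂ), ‖z‖ ≤ 1 →
    ‖fderiv ℝ (cutoff n) z‖ * (1 - ‖z‖ ^ 2) ≤ M := by
  obtain ⟨M, hM0, hM⟩ := exists_bound_deriv_smoothTransition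
  refine ⟨4 * M, by positivity, fun n z hz => ?_⟩
  set D : ℂ →L[ℝ] ℝ := 2 • innerSL ℝ z with hD
  set x : ℝ := n * (1 - ‖z‖ ^ 2) - 1 with hx
  have hS : HasDerivAt Real.smoothTransition (deriv Real.smoothTransition x) x :=
    ((Real.smoothTransition.contDiff (n := 1)).differentiable (by simp) x).hasDerivAt
  have hN : HasFDerivAt (fun z : ℂ => (n : ℝ) * (1 - ‖z‖ ^ 2) - 1)
      ((n : ℝ) • -D) z :=
    (((hasStrictFDerivAt_norm_sq z).hasFDerivAt.const_sub 1).const_mul (n : ℝ)).sub_const 1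
  have hF : fderiv ℝ (cutoff n) z = deriv Real.smoothTransition x • ((n : ℝ) •
      -D) := (hS.comp_hasFDerivAt z hN).fderiv
  have ht : 0 ≤ 1 - ‖z‖ ^ 2 := by nlinarith [norm_nonneg z]
  by_cases hne : deriv Real.smoothTransition x = 0
  · rw [hF, hne]; simpa using by positivity
  · have hx1 := (hM x).2 hne
    have h2 : (n : ℝ) * (1 - ‖z‖ ^ 2) ≤ 2 := by linarith
    have hnorm : ‖D‖ ≤ 2 := by
      refine (norm_nsmul_le (n := 2) (a := innerSL ℝ z)).trans ?_
      rw [innerSL_apply_norm]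
      push_cast
      linarith
    rw [hF, norm_smul, norm_smul, norm_neg, Real.norm_natCast]
    calc ‖deriv Real.smoothTransition x‖ * (n * ‖D‖) * (1 - ‖z‖ ^ 2)
        = ‖deriv Real.smoothTransition x‖ * ‖D‖ *
          (n * (1 - ‖z‖ ^ 2)) := by ring
      _ ≤ M * 2 * 2 := by
        gcongr
        exact (hM x).1
      _ = 4 * M := by ring

/-- A first-order weak equation can be tested against functions `(1 - ‖z‖²) P(z)` with `P` smooth
on the plane. -/
theorem integral_dz_add_dzbar_eq_zero {A B : ℂ → ℂ} (hA : Integrable A diskMeasure)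
    (hB : Integrable B diskMeasure)
    (h : ∀ φ : 𝓓(disk, ℂ), ∫ z, (A z * dz φ z + B z * dzbar φ z) ∂diskMeasure = 0)
    {P : ℂ → ℂ} (hP : ContDiff ℝ ∞ P) :
    ∫ z, (A z * dz (fun z => (1 - ‖z‖ ^ 2) • P z) z +
      B z * dzbar (fun z => (1 - ‖z‖ ^ 2) • P z) z) ∂diskMeasure = 0 := by
  set ψ : ℂ → ℂ := fun z => (1 - ‖z‖ ^ 2) • P z with hψ
  have hψc : ContDiff ℝ ∞ ψ := (contDiff_const.sub (contDiff_norm_sq ℝ)).smul hP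
  let φ : ℕ → ℂ → ℂ := fun n z => cutoff n z • ψ z
  have hφc : ∀ n, ContDiff ℝ ∞ (φ n) := fun n => (contDiff_cutoff n).smul hψc
  have hcl : ∀ n : ℕ, IsClosed {z : ℂ | 1 ≤ (n : ℝ) * (1 - ‖z‖ ^ 2)} := fun n =>
    isClosed_le continuous_const (by fun_prop)
  have hts : ∀ n, tsupport (φ n) ⊆ {z : ℂ | 1 ≤ (n : ℝ) * (1 - ‖z‖ ^ 2)} := by
    intro n
    refine closure_minimal (fun z hz => ?_) (hcl n)
    by_contra hlt
    rw [Set.mem_ofPred_eq, not_le] at hlt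
    refine hz ?_
    simp only [φ, cutoff]
    rw [Real.smoothTransition.zero_of_nonpos (by linarith), zero_smul]
  have hball : ∀ n, tsupport (φ n) ⊆ Metric.ball 0 1 := by
    intro n z hz
    have := hts n hz
    rw [Set.mem_ofPred_eq] at this
    rw [mem_ball_zero_iff]
    by_contra hge
    rw [not_lt] at hge
    have : (n : ℝ) * (1 - ‖z‖ ^ 2) ≤ 0 :=
      mul_nonpos_of_nonneg_of_nonpos (by positivity) (by nlinarith)
    linarith
  have hcomp : ∀ n, HasCompactSupport (φ n) := fun n =>
    (isCompact_closedBall (0 : ℂ) 1).of_isClosed_subset (isClosed_tsupport _)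
      ((hball n).trans Metric.ball_subset_closedBall)
  obtain ⟨M, hM0, hM⟩ := norm_fderiv_cutoff_mul_le
  obtain ⟨C1, hC1⟩ := (isCompact_closedBall (0 : ℂ) 1).exists_bound_of_continuousOn
    (hψc.continuous_fderiv (by simp)).continuousOn
  obtain ⟨C2, hC2⟩ := (isCompact_closedBall (0 : ℂ) 1).exists_bound_of_continuousOn
    hP.continuous.continuousOn
  have hC20 : 0 ≤ C2 := (norm_nonneg _).trans (hC2 0 (by simp))
  -- The vanishing of `ψ` on the circle compensates the growth of the gradient of the cut-off. This
  -- uniform bound is the domination for the limit below.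
  have hbd : ∀ n, ∀ z ∈ Metric.closedBall (0 : ℂ) 1, ‖fderiv ℝ (φ n) z‖ ≤ C1 + M * C2 := by
    intro n z hz
    have h1 : fderiv ℝ (φ n) z = cutoff n z • fderiv ℝ ψ z +
        (fderiv ℝ (cutoff n) z).smulRight (ψ z) :=
      fderiv_fun_smul ((contDiff_cutoff n).differentiable (by simp) z)
        (hψc.differentiable (by simp) z)
    have hz1 := mem_closedBall_zero_iff.mp hz
    have ht : 0 ≤ 1 - ‖z‖ ^ 2 := by nlinarith [norm_nonneg z]
    rw [h1]
    refine (norm_add_le _ _).trans (add_le_add ?_ ?_)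
    · rw [norm_smul]
      refine (mul_le_of_le_one_left (norm_nonneg _) ?_).trans (hC1 z hz)
      rw [Real.norm_eq_abs, cutoff, abs_of_nonneg (Real.smoothTransition.nonneg _)]
      exact Real.smoothTransition.le_one _
    · rw [ContinuousLinearMap.norm_smulRight_apply, hψ]
      simp only
      rw [norm_smul, Real.norm_eq_abs, abs_of_nonneg ht, ← mul_assoc]
      exact mul_le_mul (hM n z hz1) (hC2 z hz) (norm_nonneg _) hM0
  have hlim : Tendsto (fun n => ∫ z, (A z * dz (φ n) z + B z * dzbar (φ n) z) ∂diskMeasure) atTop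
      (𝓝 (∫ z, (A z * dz ψ z + B z * dzbar ψ z) ∂diskMeasure)) := by
    refine tendsto_integral_of_dominated_convergence
      (fun z => ‖A z‖ * (C1 + M * C2) + ‖B z‖ * (C1 + M * C2)) (fun n => ?_)
      ((hA.norm.mul_const _).add (hB.norm.mul_const _)) (fun n => ?_) ?_
    · exact ((integrable_mul_continuous hA (continuous_dz (hφc n))).add
        (integrable_mul_continuous hB (continuous_dzbar (hφc n)))).1
    · filter_upwards [ae_mem_closedBall] with z hz
      refine (norm_add_le _ _).trans ?_
      rw [norm_mul, norm_mul]
      exact add_le_add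
        (mul_le_mul_of_nonneg_left ((norm_dz_le _ _).trans (hbd n z hz)) (norm_nonneg _))
        (mul_le_mul_of_nonneg_left ((norm_dzbar_le _ _).trans (hbd n z hz)) (norm_nonneg _))
    · filter_upwards [ae_restrict_mem (μ := volume) Metric.isOpen_ball.measurableSet] with z hz
      refine tendsto_const_nhds.congr' ?_
      have hz1 : ‖z‖ < 1 := mem_ball_zero_iff.mp hz
      have ht : 0 < 1 - ‖z‖ ^ 2 := by nlinarith [norm_nonneg z]
      obtain ⟨N, hN⟩ := exists_nat_gt (2 / (1 - ‖z‖ ^ 2))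
      filter_upwards [eventually_ge_atTop N] with n hn
      have hlt : 2 < (n : ℝ) * (1 - ‖z‖ ^ 2) := by
        rw [div_lt_iff₀ ht] at hN
        have : (N : ℝ) ≤ n := by exact_mod_cast hn
        nlinarith
      have hev : ψ =ᶠ[𝓝 z] φ n := by
        have hopen : IsOpen {z : ℂ | 2 < (n : ℝ) * (1 - ‖z‖ ^ 2)} :=
          isOpen_lt continuous_const (by fun_prop)
        filter_upwards [hopen.mem_nhds hlt] with w hw
        have hw : 2 < (n : ℝ) * (1 - ‖w‖ ^ 2) := hw
        simp only [φ, cutoff]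
        rw [Real.smoothTransition.one_of_one_le (by linarith), one_smul]
      simp only [dz, dzbar, hev.fderiv_eq]
  have hz : ∀ n, ∫ z, (A z * dz (φ n) z + B z * dzbar (φ n) z) ∂diskMeasure = 0 := fun n =>
    h (mkTest (φ n) (hφc n) (hcomp n) (hball n))
  simp only [hz] at hlim
  exact tendsto_nhds_unique hlim tendsto_const_nhds

theorem one_sub_norm_sq_smul_mono (a b : ℕ) :
    (fun z : ℂ => (1 - ‖z‖ ^ 2) • mono a b z) = fun z => mono a b z - mono (a + 1) (b + 1) z := by
  ext z
  have : ((‖z‖ ^ 2 : ℝ) : ℂ) = z * (starRingEnd ℂ) z := by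
    rw [Complex.mul_conj, Complex.normSq_eq_norm_sq]
  rw [Complex.real_smul, Complex.ofReal_sub, this, mono, mono]
  push_cast
  ring

/-- The test function is `(1 - ‖z‖²) z^a conj z^b`, a difference of two monomials. The truncated
exponents `a - 1` and `b - 1` are harmless, because their coefficients vanish at `a = 0` and `b =
0`. -/
theorem diskMoment_relation {A B : ℂ → ℂ} (hA : Integrable A diskMeasure)
    (hB : Integrable B diskMeasure)
    (h : ∀ φ : 𝓓(disk, ℂ), ∫ z, (A z * dz φ z + B z * dzbar φ z) ∂diskMeasure = 0) (a b : ℕ) :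
    a * diskMoment (a - 1) b A - (a + 1) * diskMoment a (b + 1) A +
      (b * diskMoment a (b - 1) B - (b + 1) * diskMoment (a + 1) b B) = 0 := by
  have hd : ∀ a b (z : ℂ), DifferentiableAt ℝ (mono a b) z := fun a b z =>
    (contDiff_mono a b (n := 1)).differentiable (by simp) z
  have h1 := integral_dz_add_dzbar_eq_zero hA hB h (contDiff_mono a b)
  rw [one_sub_norm_sq_smul_mono] at h1
  have e1 : ∀ z, dz (fun z => mono a b z - mono (a + 1) (b + 1) z) z =
      a * mono (a - 1) b z - (a + 1) * mono a (b + 1) z := by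
    intro z
    have e := dz_mono (a + 1) (b + 1) z
    rw [← dz_mono]
    push_cast [add_tsub_cancel_right] at e
    rw [← e]
    simp only [dz, fderiv_fun_sub (hd _ _ _) (hd _ _ _), sub_apply]
    ring
  have e2 : ∀ z, dzbar (fun z => mono a b z - mono (a + 1) (b + 1) z) z =
      b * mono a (b - 1) z - (b + 1) * mono (a + 1) b z := by
    intro z
    have e := dzbar_mono (a + 1) (b + 1) z
    rw [← dzbar_mono]
    push_cast [add_tsub_cancel_right] at e
    rw [← e]
    simp only [dzbar, fderiv_fun_sub (hd _ _ _) (hd _ _ _), sub_apply]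
    ring
  simp only [e1, e2] at h1
  have i1 := fun a b => integrable_mul_mono hA a b
  have i2 := fun a b => integrable_mul_mono hB a b
  rw [← h1]
  have : ∀ z, A z * (a * mono (a - 1) b z - (a + 1) * mono a (b + 1) z) +
      B z * (b * mono a (b - 1) z - (b + 1) * mono (a + 1) b z) =
      (a * (A z * mono (a - 1) b z) - (a + 1) * (A z * mono a (b + 1) z)) +
      (b * (B z * mono a (b - 1) z) - (b + 1) * (B z * mono (a + 1) b z)) := by
    intro z; ring
  simp only [this]
  rw [integral_add, integral_sub, integral_sub, integral_const_mul, integral_const_mul,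
    integral_const_mul, integral_const_mul]
  · rfl
  · exact (i2 _ _).const_mul _
  · exact (i2 _ _).const_mul _
  · exact (i1 _ _).const_mul _
  · exact (i1 _ _).const_mul _
  · exact ((i1 _ _).const_mul _).sub ((i1 _ _).const_mul _)
  · exact ((i2 _ _).const_mul _).sub ((i2 _ _).const_mul _)

/-- The recurrence is the one that `∂̄B = 0` implies. It expresses the moments with `z^{a+1}`
through those with `z^a`, so the moments against powers of `conj z` alone decide everything. -/
theorem ae_eq_zero_of_antiholomorphic_moments {B : ℂ → ℂ} (hB : Integrable B diskMeasure)
    (h : ∀ a b : ℕ, (b : ℂ) * diskMoment a (b - 1) B = (b + 1) * diskMoment (a + 1) b B)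
    (h0 : ∀ b, diskMoment 0 b B = 0) : B =ᵐ[diskMeasure] 0 := by
  refine ae_eq_zero_of_integral_mono hB fun a => ?_
  induction a with
  | zero => exact h0
  | succ a ih =>
    intro b
    have h1 := h a b
    rw [show diskMoment a (b - 1) B = 0 from ih _, mul_zero, eq_comm, mul_eq_zero] at h1
    exact h1.resolve_left (by exact_mod_cast b.succ_ne_zero)

/-- The mirror image, with the recurrence of `∂A = 0` and induction on the power of `conj z`. -/
theorem ae_eq_zero_of_holomorphic_moments {A : ℂ → ℂ} (hA : Integrable A diskMeasure)
    (h : ∀ a b : ℕ, (a : ℂ) * diskMoment (a - 1) b A = (a + 1) * diskMoment a (b + 1) A)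
    (h0 : ∀ a, diskMoment a 0 A = 0) : A =ᵐ[diskMeasure] 0 := by
  refine ae_eq_zero_of_integral_mono hA fun a b => ?_
  induction b generalizing a with
  | zero => exact h0 a
  | succ b ih =>
    have h1 := h a b
    rw [show diskMoment (a - 1) b A = 0 from ih _, mul_zero, eq_comm, mul_eq_zero] at h1
    exact h1.resolve_left (by exact_mod_cast a.succ_ne_zero)

theorem ae_eq_zero_of_weakDzbarZero {u : ℂ → ℂ} (hu : Integrable u diskMeasure)
    (h : WeakDzbarZero u) (h0 : ∀ b, diskMoment 0 b u = 0) : u =ᵐ[diskMeasure] 0 := by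
  refine ae_eq_zero_of_antiholomorphic_moments hu (fun a b => ?_) h0
  have := diskMoment_relation (A := 0) (integrable_zero _ _ _) hu (by simpa [WeakDzbarZero] using h) a b
  simp only [diskMoment, Pi.zero_apply, zero_mul, integral_zero, mul_zero, sub_zero,
    zero_add] at this ⊢
  exact sub_eq_zero.mp this

theorem ae_eq_zero_of_weakDzZero {u : ℂ → ℂ} (hu : Integrable u diskMeasure)
    (h : WeakDzZero u) (h0 : ∀ a, diskMoment a 0 u = 0) : u =ᵐ[diskMeasure] 0 := by
  refine ae_eq_zero_of_holomorphic_moments hu (fun a b => ?_) h0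
  have := diskMoment_relation (B := 0) hu (integrable_zero _ _ _) (by simpa [WeakDzZero] using h) a b
  simp only [diskMoment, Pi.zero_apply, zero_mul, integral_zero, mul_zero, sub_zero,
    add_zero] at this ⊢
  exact sub_eq_zero.mp this

/-! ### Integration by parts, and orthogonal decomposition along `∂` and `∂̄` -/

theorem hasCompactSupport_test (φ : 𝓓(disk, ℂ)) : HasCompactSupport φ := φ.hasCompactSupport

theorem tsupport_test_subset (φ : 𝓓(disk, ℂ)) : tsupport φ ⊆ Metric.ball (0 : ℂ) 1 :=
  φ.tsupport_subset

theorem integral_disk_eq_integral {φ : 𝓓(disk, ℂ)} {g : ℂ → ℂ}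
    (hg : ∀ z, z ∉ tsupport φ → g z = 0) : ∫ z, g z ∂diskMeasure = ∫ z, g z := by
  rw [diskMeasure]
  exact setIntegral_eq_integral_of_forall_compl_eq_zero fun z hz =>
    hg z fun h => hz (tsupport_test_subset φ h)

theorem fderiv_eq_zero_of_notMem_tsupport {φ : ℂ → ℂ} {z : ℂ} (hz : z ∉ tsupport φ) :
    fderiv ℝ φ z = 0 :=
  image_eq_zero_of_notMem_tsupport fun h => hz (tsupport_fderiv_subset ℝ h)

/-- Integration by parts against a test function. -/
theorem integral_fderiv_test_mul (φ : 𝓓(disk, ℂ)) {g : ℂ → ℂ} (hg : ContDiff ℝ ∞ g) (v : ℂ) :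
    ∫ z, fderiv ℝ φ z v * g z ∂diskMeasure = -∫ z, φ z * fderiv ℝ g z v ∂diskMeasure := by
  have hφ := contDiff_test φ
  have hc := hasCompactSupport_test φ
  rw [integral_disk_eq_integral (φ := φ), integral_disk_eq_integral (φ := φ), eq_comm,
    neg_eq_iff_eq_neg]
  · refine integral_mul_fderiv_eq_neg_fderiv_mul_of_integrable ?_ ?_ ?_ ?_ ?_
    · refine Continuous.integrable_of_hasCompactSupport ?_ ?_
      · exact (continuous_fderiv_apply_of_contDiff hφ v).mul hg.continuous
      · exact (hc.fderiv_apply ℝ v).mul_right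
    · refine Continuous.integrable_of_hasCompactSupport ?_ hc.mul_right
      exact hφ.continuous.mul (continuous_fderiv_apply_of_contDiff hg v)
    · exact Continuous.integrable_of_hasCompactSupport (hφ.continuous.mul hg.continuous)
        hc.mul_right
    · exact fun z _ => hφ.differentiable (by simp) z
    · exact fun z _ => hg.differentiable (by simp) z
  · intro z hz
    rw [image_eq_zero_of_notMem_tsupport hz, zero_mul]
  · intro z hz
    rw [fderiv_eq_zero_of_notMem_tsupport hz]
    simp

theorem contDiff_fderiv_apply {φ : ℂ → ℂ} (h : ContDiff ℝ ∞ φ) (v : ℂ) :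
    ContDiff ℝ ∞ fun z => fderiv ℝ φ z v :=
  (h.fderiv_right (by simp)).clm_apply contDiff_const

theorem fderiv_fderiv_comm {φ : ℂ → ℂ} (h : ContDiff ℝ ∞ φ) (z v w : ℂ) :
    fderiv ℝ (fun z => fderiv ℝ φ z v) z w = fderiv ℝ (fun z => fderiv ℝ φ z w) z v := by
  have hd : DifferentiableAt ℝ (fderiv ℝ φ) z :=
    (h.fderiv_right (m := ∞) (by simp)).differentiable (by simp) z
  rw [fderiv_clm_apply hd (differentiableAt_const v), fderiv_clm_apply hd (differentiableAt_const w)]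
  have := (h.contDiffAt (x := z)).isSymmSndFDerivAt
    (by rw [minSmoothness_of_isRCLikeNormedField]; exact WithTop.coe_le_coe.mpr (le_top : (2 : ℕ∞) ≤ ⊤))
  simpa using this w v

theorem contDiff_conj_comp {φ : ℂ → ℂ} (h : ContDiff ℝ ∞ φ) :
    ContDiff ℝ ∞ fun z => (starRingEnd ℂ) (φ z) :=
  Complex.conjCLE.contDiff.comp h

theorem fderiv_conj_comp {φ : ℂ → ℂ} (h : ContDiff ℝ ∞ φ) (z v : ℂ) :
    fderiv ℝ (fun z => (starRingEnd ℂ) (φ z)) z v = (starRingEnd ℂ) (fderiv ℝ φ z v) := by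
  have h1 : HasFDerivAt (fun z => (starRingEnd ℂ) (φ z))
      ((Complex.conjCLE : ℂ →L[ℝ] ℂ).comp (fderiv ℝ φ z)) z :=
    (Complex.conjCLE.hasFDerivAt (x := φ z)).comp z (h.differentiable (by simp) z).hasFDerivAt
  rw [h1.fderiv]
  rfl

theorem dz_conj_comp {φ : ℂ → ℂ} (h : ContDiff ℝ ∞ φ) (z : ℂ) :
    dz (fun z => (starRingEnd ℂ) (φ z)) z = (starRingEnd ℂ) (dzbar φ z) := by
  simp [dz, dzbar, fderiv_conj_comp h, sub_eq_add_neg, map_ofNat]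

theorem dzbar_conj_comp {φ : ℂ → ℂ} (h : ContDiff ℝ ∞ φ) (z : ℂ) :
    dzbar (fun z => (starRingEnd ℂ) (φ z)) z = (starRingEnd ℂ) (dz φ z) := by
  simp [dz, dzbar, fderiv_conj_comp h, map_ofNat]

/-- The complex conjugate of a test function. -/
def conjTest (φ : 𝓓(disk, ℂ)) : 𝓓(disk, ℂ) :=
  mkTest (fun z => (starRingEnd ℂ) (φ z)) (contDiff_conj_comp (contDiff_test φ))
    ((hasCompactSupport_test φ).comp_left (map_zero _))
    ((tsupport_comp_subset (map_zero _) _).trans (tsupport_test_subset φ))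

theorem coe_conjTest (φ : 𝓓(disk, ℂ)) : ⇑(conjTest φ) = fun z => (starRingEnd ℂ) (φ z) := rfl

/-- The difference `|∂φ|² - |∂̄φ|²` is a multiple of `∂_xφ ∂_yψ - ∂_yφ ∂_xψ` with `ψ` the conjugate
of `φ`. Two integrations by parts and the symmetry of second derivatives show that this has integral
zero. -/
theorem integral_norm_sq_dz_eq (φ : 𝓓(disk, ℂ)) :
    ∫ z, dz φ z * (starRingEnd ℂ) (dz φ z) ∂diskMeasure =
      ∫ z, dzbar φ z * (starRingEnd ℂ) (dzbar φ z) ∂diskMeasure := by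
  have hφ := contDiff_test φ
  have hψ := contDiff_conj_comp hφ
  set ψ : ℂ → ℂ := fun z => (starRingEnd ℂ) (φ z) with hψdef
  have h1 := integral_fderiv_test_mul φ (contDiff_fderiv_apply hψ Complex.I) 1
  have h2 := integral_fderiv_test_mul φ (contDiff_fderiv_apply hψ 1) Complex.I
  simp only [fderiv_fderiv_comm hψ _ Complex.I 1] at h1
  rw [← h2] at h1
  have i0 : ∀ {f : ℂ → ℂ}, Continuous f → Integrable f diskMeasure := fun hf =>
    (memLp_of_continuous hf).integrable one_le_two
  have c1 := continuous_fderiv_apply_of_contDiff hφ 1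
  have c2 := continuous_fderiv_apply_of_contDiff hφ Complex.I
  have d1 := continuous_fderiv_apply_of_contDiff hψ 1
  have d2 := continuous_fderiv_apply_of_contDiff hψ Complex.I
  have e : ∀ z, dz φ z * (starRingEnd ℂ) (dz φ z) = dzbar φ z * (starRingEnd ℂ) (dzbar φ z) +
      (Complex.I / 2) * (fderiv ℝ φ z 1 * fderiv ℝ ψ z Complex.I -
        fderiv ℝ φ z Complex.I * fderiv ℝ ψ z 1) := by
    intro z
    rw [hψdef, fderiv_conj_comp hφ, fderiv_conj_comp hφ]
    simp only [dz, dzbar, map_div₀, map_sub, map_add, map_mul, Complex.conj_I, map_ofNat]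
    ring
  simp only [e]
  rw [integral_add, integral_const_mul, integral_sub, h1]
  · simp
  · exact i0 (c1.mul d2)
  · exact i0 (c2.mul d1)
  · have := continuous_dzbar hφ
    exact i0 (by fun_prop)
  · exact i0 (by fun_prop)

/-- `∂φ` as an element of `L²(𝔻)`. -/
def dzLp : 𝓓(disk, ℂ) →ₗ[ℂ] L2Disk where
  toFun φ := (memLp_of_continuous (continuous_dz (contDiff_test φ))).toLp
  map_add' φ ψ := by
    rw [← MemLp.toLp_add]
    congr 1
    ext z
    simp only [dz, Pi.add_apply]
    rw [show ⇑(φ + ψ) = fun z => φ z + ψ z from rfl, fderiv_fun_add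
      ((contDiff_test φ).differentiable (by simp) z) ((contDiff_test ψ).differentiable (by simp) z)]
    simp only [add_apply]
    ring
  map_smul' c φ := by
    rw [RingHom.id_apply, ← MemLp.toLp_const_smul]
    congr 1
    ext z
    simp only [dz, Pi.smul_apply]
    rw [show ⇑(c • φ) = fun z => c • φ z from rfl, fderiv_fun_const_smul
      ((contDiff_test φ).differentiable (by simp) z)]
    simp only [smul_apply, smul_eq_mul]
    ring

/-- `∂̄φ` as an element of `L²(𝔻)`. -/
def dzbarLp : 𝓓(disk, ℂ) →ₗ[ℂ] L2Disk where
  toFun φ := (memLp_of_continuous (continuous_dzbar (contDiff_test φ))).toLp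
  map_add' φ ψ := by
    rw [← MemLp.toLp_add]
    congr 1
    ext z
    simp only [dzbar, Pi.add_apply]
    rw [show ⇑(φ + ψ) = fun z => φ z + ψ z from rfl, fderiv_fun_add
      ((contDiff_test φ).differentiable (by simp) z) ((contDiff_test ψ).differentiable (by simp) z)]
    simp only [add_apply]
    ring
  map_smul' c φ := by
    rw [RingHom.id_apply, ← MemLp.toLp_const_smul]
    congr 1
    ext z
    simp only [dzbar, Pi.smul_apply]
    rw [show ⇑(c • φ) = fun z => c • φ z from rfl, fderiv_fun_const_smul
      ((contDiff_test φ).differentiable (by simp) z)]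
    simp only [smul_apply, smul_eq_mul]
    ring

theorem coe_dzLp (φ : 𝓓(disk, ℂ)) : dzLp φ =ᵐ[diskMeasure] dz φ :=
  (memLp_of_continuous (continuous_dz (contDiff_test φ))).coeFn_toLp

theorem coe_dzbarLp (φ : 𝓓(disk, ℂ)) : dzbarLp φ =ᵐ[diskMeasure] dzbar φ :=
  (memLp_of_continuous (continuous_dzbar (contDiff_test φ))).coeFn_toLp

theorem norm_dzLp_eq (φ : 𝓓(disk, ℂ)) : ‖dzLp φ‖ = ‖dzbarLp φ‖ := by
  have h : inner ℂ (dzLp φ) (dzLp φ) = inner ℂ (dzbarLp φ) (dzbarLp φ) := by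
    rw [L2.inner_def, L2.inner_def]
    refine Eq.trans ?_ ((integral_norm_sq_dz_eq φ).trans ?_)
    · refine integral_congr_ae ?_
      filter_upwards [coe_dzLp φ] with z hz
      rw [hz, RCLike.inner_apply]
    · refine integral_congr_ae ?_
      filter_upwards [coe_dzbarLp φ] with z hz
      rw [hz, RCLike.inner_apply]
  rw [inner_self_eq_norm_sq_to_K, inner_self_eq_norm_sq_to_K] at h
  have h2 : ‖dzLp φ‖ ^ 2 = ‖dzbarLp φ‖ ^ 2 := by exact_mod_cast h
  exact (sq_eq_sq₀ (norm_nonneg _) (norm_nonneg _)).mp h2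

/-- Orthogonal decomposition along the closure of the range of an operator `D₁`, where a second
operator `D₂` has the same norms. -/
theorem exists_decomposition_of_norm_eq {T H : Type*} [AddCommGroup T] [Module ℂ T]
    [NormedAddCommGroup H] [InnerProductSpace ℂ H] [CompleteSpace H] (D₁ D₂ : T →ₗ[ℂ] H)
    (hD : ∀ φ, ‖D₁ φ‖ = ‖D₂ φ‖) (a : H) :
    ∃ v w h : H, a = v + h ∧ (v, w) ∈ closure (Set.range fun φ => (D₁ φ, D₂ φ)) ∧
      (∀ φ, inner ℂ (D₁ φ) h = 0) ∧ ‖w‖ ≤ ‖a‖ ∧ ‖h‖ ≤ ‖a‖ := by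
  let V : Submodule ℂ H := (LinearMap.range D₁).topologicalClosure
  have : CompleteSpace V := (Submodule.isClosed_topologicalClosure _).completeSpace_coe
  obtain ⟨v, hv, h, hh, hvh⟩ := V.exists_add_mem_mem_orthogonal a
  have hv' : v ∈ closure (Set.range D₁) := hv
  obtain ⟨x, hx, hlim⟩ := mem_closure_iff_seq_limit.mp hv'
  choose φ hφ using hx
  have hlim1 : Tendsto (fun n => D₁ (φ n)) atTop (𝓝 v) := by simpa only [hφ] using hlim
  -- Since `D₁` and `D₂` have equal norms on differences, convergence of `D₁ φₙ` forces convergence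
  -- of `D₂ φₙ`.
  have hc2 : CauchySeq fun n => D₂ (φ n) := by
    rw [Metric.cauchySeq_iff]
    intro ε hε
    obtain ⟨N, hN⟩ := Metric.cauchySeq_iff.mp hlim1.cauchySeq ε hε
    refine ⟨N, fun m hm n hn => ?_⟩
    have := hN m hm n hn
    rwa [dist_eq_norm, ← map_sub, hD, map_sub, ← dist_eq_norm] at this
  obtain ⟨w, hw⟩ := cauchySeq_tendsto_of_complete hc2
  have hnorm : ‖w‖ = ‖v‖ :=
    tendsto_nhds_unique hw.norm (by simpa only [← hD] using hlim1.norm)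
  have hpy : ‖a‖ * ‖a‖ = ‖v‖ * ‖v‖ + ‖h‖ * ‖h‖ := by
    rw [hvh]
    exact norm_add_sq_eq_norm_sq_add_norm_sq_of_inner_eq_zero _ _ (hh v hv)
  refine ⟨v, w, h, hvh, mem_closure_of_tendsto (hlim1.prodMk_nhds hw)
    (Eventually.of_forall fun n => ⟨φ n, rfl⟩), fun φ => hh _ (subset_closure ⟨φ, rfl⟩), ?_, ?_⟩
  · rw [hnorm]
    nlinarith [norm_nonneg a, norm_nonneg v, norm_nonneg h]
  · nlinarith [norm_nonneg a, norm_nonneg v, norm_nonneg h]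

/-- The inner product conjugates its first argument, and conjugation exchanges `∂` and `∂̄`.
Orthogonality to all `∂φ` is therefore the weak equation for `∂̄`. -/
theorem weakDzbarZero_of_inner {h : L2Disk} (hh : ∀ φ, inner ℂ (dzLp φ) h = 0) :
    WeakDzbarZero h := by
  intro φ
  rw [← hh (conjTest φ), L2.inner_def]
  refine integral_congr_ae ?_
  filter_upwards [coe_dzLp (conjTest φ)] with z hz
  rw [hz, RCLike.inner_apply, coe_conjTest, dz_conj_comp (contDiff_test φ), Complex.conj_conj]

theorem weakDzZero_of_inner {h : L2Disk} (hh : ∀ φ, inner ℂ (dzbarLp φ) h = 0) :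
    WeakDzZero h := by
  intro φ
  rw [← hh (conjTest φ), L2.inner_def]
  refine integral_congr_ae ?_
  filter_upwards [coe_dzbarLp (conjTest φ)] with z hz
  rw [hz, RCLike.inner_apply, coe_conjTest, dzbar_conj_comp (contDiff_test φ), Complex.conj_conj]

/-! ### Geodesic derivatives, and removal of the extreme components -/

/-- `X(φ e^{ikθ})` has vanishing moments, for a test function `φ`. -/
theorem geodesic_derivative_mem_momentKer (k : ℤ) (φ : 𝓓(disk, ℂ)) :
    emb (k + 1) (dzLp φ) + emb (k - 1) (dzbarLp φ) ∈ momentKer := by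
  rw [mem_momentKer]
  intro K l
  have hφ := contDiff_test φ
  -- For fixed `θ`, `X` differentiates in the direction `e^{iθ}`, and the weight is a power of a
  -- real-linear form that kills this direction. Integration by parts in `x` then gives zero.
  let L : Angles → ℂ →L[ℝ] ℂ := fun θ => expI (-1) θ • ContinuousLinearMap.id ℝ ℂ -
    expI 1 θ • (Complex.conjCLE : ℂ →L[ℝ] ℂ)
  have hL : ∀ θ z, L θ z = z * expI (-1) θ - (starRingEnd ℂ) z * expI 1 θ := by
    intro θ z
    simp [L, mul_comm]
  have hL0 : ∀ θ, L θ (expI 1 θ) = 0 := by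
    intro θ
    rw [hL, conj_expI]
    ring
  have hae : (fun q => (emb (k + 1) (dzLp φ) + emb (k - 1) (dzbarLp φ) : L2SD) q * weight K l q)
      =ᵐ[bundleMeasure] fun q => expI (l + k) q.2 *
        (fderiv ℝ φ q.1 (expI 1 q.2) * (L q.2 q.1) ^ K) := by
    filter_upwards [Lp.coeFn_add (emb (k + 1) (dzLp φ)) (emb (k - 1) (dzbarLp φ)),
      (coe_emb (k + 1) (dzLp φ)).trans (toLp_harmonic_congr _ (coe_dzLp φ)),
      (coe_emb (k - 1) (dzbarLp φ)).trans (toLp_harmonic_congr _ (coe_dzbarLp φ))] with q h1 h2 h3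
    rw [h1, Pi.add_apply, h2, h3, fderiv_eq_dz, conj_expI, hL]
    simp only [harmonic, weight, sub_eq_add_neg, expI_add_left]
    ring
  rw [moment, integral_congr_ae hae, bundleMeasure, integral_prod_symm]
  · refine (integral_congr_ae (Eventually.of_forall fun θ => ?_)).trans (integral_zero _ _)
    have hg : ContDiff ℝ ∞ fun z => (L θ z) ^ K := (L θ).contDiff.pow K
    simp only
    rw [integral_const_mul, integral_fderiv_test_mul φ hg]
    have : ∀ z, fderiv ℝ (fun z => (L θ z) ^ K) z (expI 1 θ) = 0 := by
      intro z
      rw [((L θ).hasFDerivAt.pow K).fderiv]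
      simp [hL0]
    simp [this]
  · exact (integrable_mul_weight (integrable_L2SD _) K l).congr hae

theorem emb_add_emb_mem_momentKer (k : ℤ) {v w : L2Disk}
    (h : (v, w) ∈ closure (Set.range fun φ => (dzLp φ, dzbarLp φ))) :
    emb (k + 1) v + emb (k - 1) w ∈ momentKer := by
  have hc : Continuous fun p : L2Disk × L2Disk => emb (k + 1) p.1 + emb (k - 1) p.2 :=
    ((emb (k + 1)).continuous.comp continuous_fst).add
      ((emb (k - 1)).continuous.comp continuous_snd)
  have hm : Set.MapsTo (fun p : L2Disk × L2Disk => emb (k + 1) p.1 + emb (k - 1) p.2)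
      (Set.range fun φ => (dzLp φ, dzbarLp φ)) momentKer := by
    rintro _ ⟨φ, rfl⟩
    exact geodesic_derivative_mem_momentKer k φ
  have := map_mem_closure hc h hm
  rwa [isClosed_momentKer.closure_eq] at this

/-- Write `a = v + h` with `v` a limit of `∂φₙ` and `h` orthogonal to all `∂φ`. If `w` is the limit
of `∂̄φₙ`, then `v e^{ikθ} + w e^{i(k-2)θ}` is invisible to the moments. The non-holomorphic part is
thus traded for `-w` two frequencies lower. -/
theorem exists_weakDzbarZero_reduction (k : ℤ) (a : L2Disk) : ∃ h w : L2Disk, WeakDzbarZero h ∧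
    emb k a - (emb k h + emb (k - 2) w) ∈ momentKer ∧ ‖h‖ ≤ ‖a‖ ∧ ‖w‖ ≤ ‖a‖ := by
  obtain ⟨v, w, h, hav, hvw, hh, hw, hha⟩ :=
    exists_decomposition_of_norm_eq dzLp dzbarLp norm_dzLp_eq a
  refine ⟨h, -w, weakDzbarZero_of_inner hh, ?_, hha, by rwa [norm_neg]⟩
  have := emb_add_emb_mem_momentKer (k - 1) hvw
  rw [show k - 1 + 1 = k by ring, show k - 1 - 1 = k - 2 by ring] at this
  convert! this using 1
  rw [hav, map_add, map_neg]
  abel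

theorem exists_weakDzZero_reduction (k : ℤ) (a : L2Disk) : ∃ h w : L2Disk, WeakDzZero h ∧
    emb k a - (emb k h + emb (k + 2) w) ∈ momentKer ∧ ‖h‖ ≤ ‖a‖ ∧ ‖w‖ ≤ ‖a‖ := by
  obtain ⟨v, w, h, hav, hvw, hh, hw, hha⟩ :=
    exists_decomposition_of_norm_eq dzbarLp dzLp (fun φ => (norm_dzLp_eq φ).symm) a
  refine ⟨h, -w, weakDzZero_of_inner hh, ?_, hha, by rwa [norm_neg]⟩
  have hwv : (w, v) ∈ closure (Set.range fun φ => (dzLp φ, dzbarLp φ)) :=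
    map_mem_closure (f := Prod.swap) continuous_swap hvw (by rintro _ ⟨φ, rfl⟩; exact ⟨φ, rfl⟩)
  have := emb_add_emb_mem_momentKer (k + 1) hwv
  rw [show k + 1 + 1 = k + 2 by ring, show k + 1 - 1 = k by ring] at this
  convert! this using 1
  rw [hav, map_add, map_neg]
  abel

/-! ### Trace and Poincaré inequalities on the disk -/

/-- The divergence theorem on the disk for the field `N(z) z`. -/
theorem integral_disk_radial {N : ℂ → ℝ} (hN : ContDiff ℝ ∞ N) :
    ∫ z, (2 * N z + fderiv ℝ N z z) ∂diskMeasure = ∫ β : Angles, N (expI 1 β) := by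
  set f : ℂ → ℝ := fun z => 2 * N z + fderiv ℝ N z z with hf
  have hfc : Continuous f := by
    have h1 := (hN.continuous_fderiv (by simp)).clm_apply continuous_id
    have h2 := hN.continuous
    simp only [id] at h1
    fun_prop
  set g : ℝ × ℝ → ℝ := fun p => p.1 * f (p.1 * (Real.cos p.2 + Real.sin p.2 * Complex.I)) with hg
  have hgc : Continuous g := by fun_prop
  have e1 : ∫ z, f z ∂diskMeasure =
      ∫ p in Set.Ioo (0 : ℝ) 1 ×ˢ Set.Ioo (-π) π, g p := by
    rw [diskMeasure, ← integral_indicator Metric.isOpen_ball.measurableSet,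
      ← Complex.integral_comp_polarCoord_symm]
    rw [show polarCoord.target = Set.Ioi (0 : ℝ) ×ˢ Set.Ioo (-π) π from rfl]
    rw [setIntegral_eq_of_subset_of_forall_sdiff_eq_zero (s := Set.Ioo (0 : ℝ) 1 ×ˢ Set.Ioo (-π) π)
      (measurableSet_Ioi.prod measurableSet_Ioo)
      (Set.prod_mono (fun x hx => hx.1) subset_rfl)]
    · refine setIntegral_congr_fun (measurableSet_Ioo.prod measurableSet_Ioo) fun p hp => ?_
      simp only [smul_eq_mul]
      rw [Set.indicator_of_mem, Complex.polarCoord_symm_apply]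
      rw [mem_ball_zero_iff, Complex.norm_polarCoord_symm, abs_of_pos hp.1.1]
      exact hp.1.2
    · rintro p ⟨hp1, hp2⟩
      rw [Set.indicator_of_notMem, smul_zero]
      rw [mem_ball_zero_iff, Complex.norm_polarCoord_symm, abs_of_pos hp1.1]
      exact fun h => hp2 ⟨⟨hp1.1, h⟩, hp1.2⟩
  have hint : IntegrableOn g (Set.Ioo (0 : ℝ) 1 ×ˢ Set.Ioo (-π) π) (volume.prod volume) :=
    ((hgc.continuousOn (s := Set.Icc (0 : ℝ) 1 ×ˢ Set.Icc (-π) π)).integrableOn_compact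
      (isCompact_Icc.prod isCompact_Icc)).mono_set
      (Set.prod_mono Set.Ioo_subset_Icc_self Set.Ioo_subset_Icc_self)
  have e2 : ∀ t : ℝ, ∫ r in Set.Ioo (0 : ℝ) 1, g (r, t) = N (expI 1 (t : Angles)) := by
    intro t
    rw [← integral_Ioc_eq_integral_Ioo, ← intervalIntegral.integral_of_le zero_le_one]
    set w : ℂ := Real.cos t + Real.sin t * Complex.I with hw
    -- With the Jacobian `r` of polar coordinates, the integrand is an exact radial derivative.
    have hd : ∀ r : ℝ, HasDerivAt (fun r : ℝ => r ^ 2 * N (r * w)) (g (r, t)) r := by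
      intro r
      have h1 : HasDerivAt (fun r : ℝ => (r : ℂ) * w) w r := by
        simpa using (Complex.ofRealCLM.hasDerivAt (x := r)).mul_const w
      have h2 : HasDerivAt (fun r : ℝ => N (r * w)) (fderiv ℝ N (r * w) w) r :=
        ((hN.differentiable (by simp) _).hasFDerivAt).comp_hasDerivAt r h1
      convert! (hasDerivAt_pow 2 r).mul h2 using 1
      simp only [hg, hf]
      rw [← hw, ← Complex.real_smul, map_smul]
      simp
      ring
    rw [intervalIntegral.integral_eq_sub_of_hasDerivAt (fun r _ => hd r)
      ((hgc.comp (by fun_prop : Continuous fun r : ℝ => (r, t))).intervalIntegrable _ _)]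
    rw [expI_one_coe, ← hw]
    simp
  rw [e1, Measure.volume_eq_prod, ← setIntegral_prod_swap]
  rw [setIntegral_prod]
  · simp only [Prod.swap_prod_mk, e2]
    rw [← integral_Ioc_eq_integral_Ioo, ← AddCircle.integral_preimage (2 * π) (-π)]
    congr 2
    ring_nf
  · exact hint.swap

/-- The square of the Euclidean norm of the gradient. -/
def gradSq (φ : ℂ → ℂ) (z : ℂ) : ℝ := ‖fderiv ℝ φ z 1‖ ^ 2 + ‖fderiv ℝ φ z Complex.I‖ ^ 2

theorem gradSq_nonneg (φ : ℂ → ℂ) (z : ℂ) : 0 ≤ gradSq φ z := by unfold gradSq; positivity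

theorem continuous_gradSq {φ : ℂ → ℂ} (h : ContDiff ℝ ∞ φ) : Continuous (gradSq φ) := by
  have h1 := continuous_fderiv_apply_of_contDiff h 1
  have h2 := continuous_fderiv_apply_of_contDiff h Complex.I
  unfold gradSq
  fun_prop

theorem norm_fderiv_apply_sq_le (φ : ℂ → ℂ) (z v : ℂ) :
    ‖fderiv ℝ φ z v‖ ^ 2 ≤ gradSq φ z * ‖v‖ ^ 2 := by
  have h : fderiv ℝ φ z v = v.re • fderiv ℝ φ z 1 + v.im • fderiv ℝ φ z Complex.I := by
    have : v = v.re • (1 : ℂ) + v.im • Complex.I := by simp [Complex.real_smul]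
    conv_lhs => rw [this]
    rw [map_add, map_smul, map_smul]
  have h2 : ‖fderiv ℝ φ z v‖ ≤ |v.re| * ‖fderiv ℝ φ z 1‖ + |v.im| * ‖fderiv ℝ φ z Complex.I‖ := by
    rw [h]
    refine (norm_add_le _ _).trans ?_
    rw [norm_smul, norm_smul, Real.norm_eq_abs, Real.norm_eq_abs]
  have h3 : ‖v‖ ^ 2 = |v.re| ^ 2 + |v.im| ^ 2 := by
    rw [Complex.sq_norm, Complex.normSq_apply, sq_abs, sq_abs]; ring
  rw [h3, gradSq]
  set x := ‖fderiv ℝ φ z 1‖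
  set y := ‖fderiv ℝ φ z Complex.I‖
  calc ‖fderiv ℝ φ z v‖ ^ 2 ≤ (|v.re| * x + |v.im| * y) ^ 2 :=
        pow_le_pow_left₀ (norm_nonneg _) h2 2
    _ ≤ _ := by nlinarith [sq_nonneg (|v.re| * y - |v.im| * x)]

theorem integrable_disk_of_continuous {E : Type*} [NormedAddCommGroup E] {g : ℂ → E}
    (hg : Continuous g) : Integrable g diskMeasure :=
  ((hg.continuousOn (s := Metric.closedBall (0 : ℂ) 1)).integrableOn_compact
    (isCompact_closedBall _ _)).mono_set Metric.ball_subset_closedBall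

theorem integrable_angles_of_continuous {E : Type*} [NormedAddCommGroup E] {g : Angles → E}
    (hg : Continuous g) : Integrable g (volume : Measure Angles) :=
  integrableOn_univ.mp ((hg.continuousOn (s := Set.univ)).integrableOn_compact isCompact_univ)

theorem abs_fderiv_norm_sq_le {ψ : ℂ → ℂ} (hψ : ContDiff ℝ ∞ ψ) {z : ℂ} (hz : ‖z‖ ≤ 1) :
    |fderiv ℝ (fun z => ‖ψ z‖ ^ 2) z z| ≤ ‖ψ z‖ ^ 2 + gradSq ψ z := by
  have hd := ((hψ.differentiable (by simp) z).hasFDerivAt).norm_sq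
  have h1 := norm_fderiv_apply_sq_le ψ z z
  have h2 : ‖fderiv ℝ ψ z z‖ ^ 2 ≤ gradSq ψ z :=
    h1.trans (mul_le_of_le_one_right (gradSq_nonneg _ _) (pow_le_one₀ (norm_nonneg _) hz))
  rw [hd.fderiv]
  have h3 := abs_real_inner_le_norm (ψ z) (fderiv ℝ ψ z z)
  have h4 : |((2 : ℕ) • (innerSL ℝ (ψ z)).comp (fderiv ℝ ψ z) : ℂ →L[ℝ] ℝ) z| =
      2 * |inner ℝ (ψ z) (fderiv ℝ ψ z z)| := by
    change |(2 : ℕ) • (inner ℝ (ψ z) (fderiv ℝ ψ z z))| = _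
    rw [nsmul_eq_mul, abs_mul]
    norm_num
  rw [h4]
  nlinarith [sq_nonneg (‖ψ z‖ - ‖fderiv ℝ ψ z z‖)]

/-- The divergence theorem for `N = ‖ψ‖²`. The term `2N` and the bound `‖ψ‖² + |∇ψ|²` for the radial
derivative give the constant 3. -/
theorem integral_circle_norm_sq_le {ψ : ℂ → ℂ} (hψ : ContDiff ℝ ∞ ψ) :
    ∫ β : Angles, ‖ψ (expI 1 β)‖ ^ 2 ≤
      3 * ∫ z, ‖ψ z‖ ^ 2 ∂diskMeasure + ∫ z, gradSq ψ z ∂diskMeasure := by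
  have hN : ContDiff ℝ ∞ fun z => ‖ψ z‖ ^ 2 := hψ.norm_sq ℝ
  have i1 := integrable_disk_of_continuous hN.continuous
  have i2 := integrable_disk_of_continuous (continuous_gradSq hψ)
  rw [← integral_disk_radial hN, ← integral_const_mul, ← integral_add (i1.const_mul 3) i2]
  refine integral_mono_ae (integrable_disk_of_continuous ?_) ((i1.const_mul 3).add i2) ?_
  · have h1 := (hN.continuous_fderiv (by simp)).clm_apply continuous_id
    have h2 := hN.continuous
    simp only [id] at h1
    fun_prop
  · filter_upwards [ae_mem_closedBall] with z hz
    have := (le_abs_self _).trans (abs_fderiv_norm_sq_le hψ (mem_closedBall_zero_iff.mp hz))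
    linarith

/-- The same identity with the radial derivative bounded from below: of `2‖ψ‖²` one copy is lost and
one remains. -/
theorem integral_disk_norm_sq_le {ψ : ℂ → ℂ} (hψ : ContDiff ℝ ∞ ψ) :
    ∫ z, ‖ψ z‖ ^ 2 ∂diskMeasure ≤
      (∫ β : Angles, ‖ψ (expI 1 β)‖ ^ 2) + ∫ z, gradSq ψ z ∂diskMeasure := by
  have hN : ContDiff ℝ ∞ fun z => ‖ψ z‖ ^ 2 := hψ.norm_sq ℝ
  have i1 := integrable_disk_of_continuous hN.continuous
  have i2 := integrable_disk_of_continuous (continuous_gradSq hψ)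
  have i3 : Integrable (fun z => 2 * ‖ψ z‖ ^ 2 + fderiv ℝ (fun z => ‖ψ z‖ ^ 2) z z)
      diskMeasure := by
    refine integrable_disk_of_continuous ?_
    have h1 := (hN.continuous_fderiv (by simp)).clm_apply continuous_id
    have h2 := hN.continuous
    simp only [id] at h1
    fun_prop
  rw [← integral_disk_radial hN, ← integral_add i3 i2]
  refine integral_mono_ae i1 (i3.add i2) ?_
  filter_upwards [ae_mem_closedBall] with z hz
  have := (neg_le_abs _).trans (abs_fderiv_norm_sq_le hψ (mem_closedBall_zero_iff.mp hz))
  linarith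

theorem sq_integral_le {g : ℝ → ℝ} (hg : Continuous g) {L : ℝ} (hL : 0 < L) :
    (∫ s in (0 : ℝ)..L, g s) ^ 2 ≤ L * ∫ s in (0 : ℝ)..L, g s ^ 2 := by
  set A := ∫ s in (0 : ℝ)..L, g s with hA
  have h0 : 0 ≤ ∫ s in (0 : ℝ)..L, (g s - A / L) ^ 2 :=
    intervalIntegral.integral_nonneg hL.le fun _ _ => sq_nonneg _
  have e : ∫ s in (0 : ℝ)..L, (g s - A / L) ^ 2 = (∫ s in (0 : ℝ)..L, g s ^ 2) - A ^ 2 / L := by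
    have : ∀ s, (g s - A / L) ^ 2 = g s ^ 2 - (2 * (A / L)) * g s + (A / L) ^ 2 := by
      intro s; ring
    simp only [this]
    rw [intervalIntegral.integral_add, intervalIntegral.integral_sub,
      intervalIntegral.integral_const_mul, ← hA, intervalIntegral.integral_const]
    · simp only [sub_zero, smul_eq_mul]
      field_simp
      ring
    all_goals exact Continuous.intervalIntegrable (by fun_prop) _ _
  rw [e, sub_nonneg, div_le_iff₀ hL] at h0
  linarith

theorem integral_comp_rotate (θ : Angles) (g : ℂ → ℝ) :
    ∫ z, g (expI 1 θ * z) ∂diskMeasure = ∫ z, g z ∂diskMeasure := by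
  refine (measurePreserving_rotate θ).integral_comp ?_ g
  have : (fun z : ℂ => expI 1 θ * z) = rotation (AddCircle.toCircle θ) := by
    ext z; simp [expI]
  rw [this]
  exact (rotation (AddCircle.toCircle θ)).toHomeomorph.measurableEmbedding

theorem hasDerivAt_expI_mul (z : ℂ) (s : ℝ) :
    HasDerivAt (fun s : ℝ => expI 1 (s : Angles) * z) (expI 1 (s : Angles) * Complex.I * z) s := by
  have h : HasDerivAt (fun s : ℝ => Complex.exp (Complex.I * (1 : ℤ) * s))
      (Complex.exp (Complex.I * (1 : ℤ) * s) * Complex.I) s := by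
    have h1 : HasDerivAt (fun s : ℝ => Complex.I * (1 : ℤ) * s) Complex.I s := by
      simpa using (Complex.ofRealCLM.hasDerivAt (x := s)).const_mul Complex.I
    exact h1.cexp
  simp only [expI_coe]
  exact h.mul_const z

/-- The fundamental theorem of calculus along the circular arc, whose velocity has length at most 1,
followed by Cauchy–Schwarz on `[0, 2π]`. -/
theorem norm_rotate_sub_sq_le {φ : ℂ → ℂ} (hφ : ContDiff ℝ ∞ φ) {γ : ℝ} (h0 : 0 ≤ γ)
    (h1 : γ ≤ 2 * π) {z : ℂ} (hz : ‖z‖ ≤ 1) :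
    ‖φ (expI 1 (γ : Angles) * z) - φ z‖ ^ 2 ≤
      2 * π * ∫ s in (0 : ℝ)..(2 * π), gradSq φ (expI 1 (s : Angles) * z) := by
  have hc : Continuous fun s : ℝ => expI 1 (s : Angles) :=
    (continuous_expI 1).comp continuous_coe_angle
  set d : ℝ → ℂ := fun s => fderiv ℝ φ (expI 1 (s : Angles) * z) (expI 1 (s : Angles) * Complex.I * z)
    with hd
  have hdc : Continuous d :=
    ((hφ.continuous_fderiv (by simp)).comp (by fun_prop)).clm_apply (by fun_prop)
  have hder : ∀ s : ℝ, HasDerivAt (fun s : ℝ => φ (expI 1 (s : Angles) * z)) (d s) s := fun s =>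
    ((hφ.differentiable (by simp) _).hasFDerivAt).comp_hasDerivAt s (hasDerivAt_expI_mul z s)
  have hftc : φ (expI 1 (γ : Angles) * z) - φ z = ∫ s in (0 : ℝ)..γ, d s := by
    rw [intervalIntegral.integral_eq_sub_of_hasDerivAt (fun s _ => hder s)
      (hdc.intervalIntegrable _ _)]
    congr 2
    rw [expI_one_coe]
    simp
  have hle : ‖φ (expI 1 (γ : Angles) * z) - φ z‖ ≤ ∫ s in (0 : ℝ)..(2 * π), ‖d s‖ := by
    rw [hftc]
    refine (intervalIntegral.norm_integral_le_integral_norm h0).trans ?_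
    exact intervalIntegral.integral_mono_interval le_rfl h0 h1
      (Eventually.of_forall fun _ => norm_nonneg _) (hdc.norm.intervalIntegrable _ _)
  refine (pow_le_pow_left₀ (norm_nonneg _) hle 2).trans ?_
  refine (sq_integral_le hdc.norm Real.two_pi_pos).trans ?_
  refine mul_le_mul_of_nonneg_left ?_ Real.two_pi_pos.le
  refine intervalIntegral.integral_mono_on Real.two_pi_pos.le
    ((hdc.norm.pow 2).intervalIntegrable _ _)
    (((continuous_gradSq hφ).comp (by fun_prop)).intervalIntegrable _ _) fun s _ => ?_
  refine (norm_fderiv_apply_sq_le φ _ _).trans ?_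
  refine mul_le_of_le_one_right (gradSq_nonneg _ _) ?_
  rw [norm_mul, norm_mul, norm_expI, Complex.norm_I, one_mul, one_mul]
  exact pow_le_one₀ (norm_nonneg _) hz

theorem integral_rotate_sub_sq_le {φ : ℂ → ℂ} (hφ : ContDiff ℝ ∞ φ) {γ : ℝ} (h0 : 0 ≤ γ)
    (h1 : γ ≤ 2 * π) :
    ∫ z, ‖φ (expI 1 (γ : Angles) * z) - φ z‖ ^ 2 ∂diskMeasure ≤
      (2 * π) ^ 2 * ∫ z, gradSq φ z ∂diskMeasure := by
  have hc : Continuous fun s : ℝ => expI 1 (s : Angles) :=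
    (continuous_expI 1).comp continuous_coe_angle
  have hG := continuous_gradSq hφ
  have hK : Continuous fun q : ℂ × ℝ => gradSq φ (expI 1 (q.2 : Angles) * q.1) :=
    hG.comp ((hc.comp continuous_snd).mul continuous_fst)
  have hint : Integrable (fun q : ℂ × ℝ => gradSq φ (expI 1 (q.2 : Angles) * q.1))
      (diskMeasure.prod (volume.restrict (Set.Ioc 0 (2 * π)))) := by
    rw [diskMeasure, Measure.prod_restrict]
    exact ((hK.continuousOn (s := Metric.closedBall (0 : ℂ) 1 ×ˢ Set.Icc 0 (2 * π))
      ).integrableOn_compact ((isCompact_closedBall _ _).prod isCompact_Icc)).mono_set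
      (Set.prod_mono Metric.ball_subset_closedBall Set.Ioc_subset_Icc_self)
  have hφc := hφ.continuous
  have i2 : Integrable (fun z => 2 * π * ∫ s in (0 : ℝ)..(2 * π),
      gradSq φ (expI 1 (s : Angles) * z)) diskMeasure := by
    simp only [intervalIntegral.integral_of_le Real.two_pi_pos.le]
    exact hint.integral_prod_left.const_mul _
  refine (integral_mono_ae (integrable_disk_of_continuous (by fun_prop)) i2
    (ae_mem_closedBall.mono fun z hz =>
      norm_rotate_sub_sq_le hφ h0 h1 (mem_closedBall_zero_iff.mp hz))).trans ?_
  rw [integral_const_mul]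
  simp only [intervalIntegral.integral_of_le Real.two_pi_pos.le]
  rw [integral_integral_swap hint]
  simp only [integral_comp_rotate, integral_const]
  rw [measureReal_restrict_apply_univ, Real.volume_real_Ioc_of_le Real.two_pi_pos.le]
  simp only [sub_zero, smul_eq_mul]
  exact le_of_eq (by ring)

/-- The trace inequality applied to the difference of `φ` and its rotation. The L² part contributes
`3 (2π)²`, and the gradient of the difference contributes 8 by rotation invariance. -/
theorem integral_circle_rotate_sub_sq_le {φ : ℂ → ℂ} (hφ : ContDiff ℝ ∞ φ) (γ : Angles) :
    ∫ β : Angles, ‖φ (expI 1 (β + γ)) - φ (expI 1 β)‖ ^ 2 ≤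
      (12 * π ^ 2 + 8) * ∫ z, gradSq φ z ∂diskMeasure := by
  obtain ⟨s, hs, rfl⟩ : ∃ s : ℝ, s ∈ Set.Ico 0 (0 + 2 * π) ∧ (s : Angles) = γ :=
    ⟨_, (AddCircle.equivIco (2 * π) 0 γ).2, AddCircle.coe_equivIco⟩
  rw [zero_add] at hs
  set e := expI 1 (s : Angles) with he
  set ψ : ℂ → ℂ := fun z => φ (e * z) - φ z with hψ
  have hrot : ContDiff ℝ ∞ fun z => φ (e * z) := hφ.comp (contDiff_const.mul contDiff_id)
  have hψc : ContDiff ℝ ∞ ψ := hrot.sub hφ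
  have hG := continuous_gradSq hφ
  have h1 := integral_circle_norm_sq_le hψc
  have h2 := integral_rotate_sub_sq_le hφ hs.1 hs.2.le
  have hfd : ∀ z v, ‖v‖ = 1 → ‖fderiv ℝ ψ z v‖ ^ 2 ≤ 2 * gradSq φ (e * z) + 2 * gradSq φ z := by
    intro z v hv
    have hr : HasFDerivAt (fun z => φ (e * z))
        ((fderiv ℝ φ (e * z)).comp (e • ContinuousLinearMap.id ℝ ℂ)) z := by
      refine ((hφ.differentiable (by simp) (e * z)).hasFDerivAt).comp z ?_
      exact (hasFDerivAt_id z).const_mul e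
    have h3 : fderiv ℝ ψ z v = fderiv ℝ φ (e * z) (e * v) - fderiv ℝ φ z v := by
      rw [hψ, fderiv_fun_sub hr.differentiableAt (hφ.differentiable (by simp) z), hr.fderiv]
      simp
    have h4 := norm_fderiv_apply_sq_le φ (e * z) (e * v)
    have h5 := norm_fderiv_apply_sq_le φ z v
    rw [norm_mul, he, norm_expI, hv] at h4
    rw [hv] at h5
    have h6 := norm_sub_le (fderiv ℝ φ (e * z) (e * v)) (fderiv ℝ φ z v)
    rw [h3]
    refine (pow_le_pow_left₀ (norm_nonneg _) h6 2).trans ?_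
    nlinarith [sq_nonneg (‖fderiv ℝ φ (e * z) (e * v)‖ - ‖fderiv ℝ φ z v‖)]
  have i1 : Integrable (fun z => 4 * gradSq φ (e * z) + 4 * gradSq φ z) diskMeasure :=
    integrable_disk_of_continuous (by fun_prop)
  have h7 : ∫ z, gradSq ψ z ∂diskMeasure ≤ 8 * ∫ z, gradSq φ z ∂diskMeasure := by
    refine (integral_mono (integrable_disk_of_continuous (continuous_gradSq hψc)) i1
      fun z => ?_).trans ?_
    · have := hfd z 1 norm_one
      have := hfd z Complex.I Complex.norm_I
      simp only [gradSq] at *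
      linarith
    · rw [integral_add, integral_const_mul, integral_const_mul, integral_comp_rotate]
      · linarith
      · exact integrable_disk_of_continuous (by fun_prop)
      · exact integrable_disk_of_continuous (by fun_prop)
  have e2 : ∫ β : Angles, ‖φ (expI 1 (β + (s : Angles))) - φ (expI 1 β)‖ ^ 2 =
      ∫ β : Angles, ‖ψ (expI 1 β)‖ ^ 2 := by
    simp only [hψ, expI_add_right, he, mul_comm]
  rw [e2]
  linarith

/-- The trace inequality for functions of mean zero on the unit circle. -/
theorem integral_circle_norm_sq_le_of_mean_zero {φ : ℂ → ℂ} (hφ : ContDiff ℝ ∞ φ)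
    (h0 : ∫ β : Angles, φ (expI 1 β) = 0) :
    ∫ β : Angles, ‖φ (expI 1 β)‖ ^ 2 ≤
      (6 * π ^ 2 + 4) * ∫ z, gradSq φ z ∂diskMeasure := by
  set T : Angles → ℂ := fun β => φ (expI 1 β) with hT
  have hTc : Continuous T := hφ.continuous.comp (continuous_expI 1)
  set D := ∫ z, gradSq φ z ∂diskMeasure
  set S := ∫ β : Angles, ‖T β‖ ^ 2 with hS
  set J : Angles → ℝ := fun γ => ∫ β : Angles, (T (β + γ) * (starRingEnd ℂ) (T β)).re with hJ
  have hexp : ∀ γ : Angles, 2 * S - 2 * J γ ≤ (12 * π ^ 2 + 8) * D := by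
    intro γ
    refine le_of_eq_of_le ?_ (integral_circle_rotate_sub_sq_le hφ γ)
    have : ∀ β : Angles, ‖φ (expI 1 (β + γ)) - φ (expI 1 β)‖ ^ 2 =
        ‖T (β + γ)‖ ^ 2 + ‖T β‖ ^ 2 - 2 * (T (β + γ) * (starRingEnd ℂ) (T β)).re := by
      intro β
      rw [Complex.sq_norm, Complex.sq_norm, Complex.sq_norm, Complex.normSq_sub]
    simp only [this]
    rw [integral_sub, integral_add, integral_const_mul,
      integral_add_right_eq_self (fun β : Angles => ‖T β‖ ^ 2)]
    · ring
    all_goals exact integrable_angles_of_continuous (by fun_prop)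
  -- Averaged over all shifts `γ`, the correlation of `T` with its translates contains the factor `∫
  -- T = 0`. Averaging `hexp` therefore leaves only `2S`, whence half of the constant of the
  -- rotation estimate.
  have hJ0 : ∫ γ, J γ = 0 := by
    rw [hJ, integral_integral_swap]
    · refine (integral_congr_ae (Eventually.of_forall fun β => ?_)).trans (integral_zero _ _)
      have h1 : ∫ γ : Angles, T (β + γ) * (starRingEnd ℂ) (T β) = 0 := by
        rw [integral_mul_const, integral_add_left_eq_self, h0, zero_mul]
      have h2 := integral_re (𝕜 := ℂ) (f := fun γ : Angles => T (β + γ) * (starRingEnd ℂ) (T β))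
        (integrable_angles_of_continuous (by fun_prop))
      rw [h1] at h2
      simpa using h2
    · have hK : Continuous fun q : Angles × Angles =>
          (T (q.2 + q.1) * (starRingEnd ℂ) (T q.2)).re := by fun_prop
      exact integrableOn_univ.mp ((hK.continuousOn (s := Set.univ)).integrableOn_compact
        isCompact_univ)
  have hJi : Integrable J := by
    have hK : Continuous fun q : Angles × Angles =>
        (T (q.2 + q.1) * (starRingEnd ℂ) (T q.2)).re := by fun_prop
    have := integrableOn_univ.mp ((hK.continuousOn (s := Set.univ)).integrableOn_compact
        (μ := (volume : Measure Angles).prod volume) isCompact_univ)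
    exact this.integral_prod_left
  have hfin := integral_mono ((integrable_const (2 * S)).sub (hJi.const_mul 2))
    (integrable_const ((12 * π ^ 2 + 8) * D)) hexp
  have hsub : ∫ γ, ((fun _ : Angles => 2 * S) - fun γ => 2 * J γ) γ =
      (∫ _ : Angles, 2 * S) - ∫ γ, 2 * J γ :=
    integral_sub (integrable_const _) (hJi.const_mul 2)
  rw [hsub, integral_const_mul 2 J, hJ0, integral_const,
    integral_const, measureReal_def, AddCircle.measure_univ,
    ENNReal.toReal_ofReal Real.two_pi_pos.le, smul_eq_mul, smul_eq_mul, mul_zero, sub_zero] at hfin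
  have := le_of_mul_le_mul_left hfin Real.two_pi_pos
  linarith

/-! ### The operator `X_⊥` and the closure of its range -/

theorem norm_toLp_sq {X : Type*} [MeasurableSpace X] {μ : Measure X} {g : X → ℂ}
    (hg : MemLp g 2 μ) : ‖hg.toLp‖ ^ 2 = ∫ x, ‖g x‖ ^ 2 ∂μ := by
  have h : inner ℂ hg.toLp hg.toLp = ((∫ x, ‖g x‖ ^ 2 ∂μ : ℝ) : ℂ) := by
    rw [L2.inner_def, ← integral_complex_ofReal]
    refine integral_congr_ae ?_
    filter_upwards [hg.coeFn_toLp] with x hx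
    rw [hx, inner_self_eq_norm_sq_to_K]
    simp
  rw [inner_self_eq_norm_sq_to_K] at h
  apply Complex.ofReal_injective
  rw [← h]
  push_cast
  rfl

theorem tendsto_integral_mul_of_tendsto {X : Type*} [MeasurableSpace X] {μ : Measure X}
    {f : ℕ → Lp ℂ 2 μ} {f₀ : Lp ℂ 2 μ} (h : Tendsto f atTop (𝓝 f₀)) {c : X → ℂ}
    (hc : MemLp c 2 μ) :
    Tendsto (fun n => ∫ x, f n x * c x ∂μ) atTop (𝓝 (∫ x, f₀ x * c x ∂μ)) := by
  have hc' : MemLp (fun x => (starRingEnd ℂ) (c x)) 2 μ := hc.star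
  have e : ∀ g : Lp ℂ 2 μ, ∫ x, g x * c x ∂μ = inner ℂ hc'.toLp g := by
    intro g
    rw [L2.inner_def]
    refine integral_congr_ae ?_
    filter_upwards [hc'.coeFn_toLp] with x hx
    rw [hx, RCLike.inner_apply, Complex.conj_conj]
  simp only [e]
  exact (Filter.Tendsto.inner tendsto_const_nhds h)

/-- `X_⊥ u` in terms of the partial derivatives `a = ∂_x u` and `b = ∂_y u`. -/
def perp (a b : L2Disk) : L2SD :=
  emb 1 ((-(Complex.I / 2)) • (a - Complex.I • b)) + emb (-1) ((Complex.I / 2) • (a + Complex.I • b))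

theorem coe_perp (a b : L2Disk) : perp a b =ᵐ[bundleMeasure] fun p =>
    ((expI 1 p.2).im : ℂ) * a p.1 - ((expI 1 p.2).re : ℂ) * b p.1 := by
  have h1 : (((-(Complex.I / 2)) • (a - Complex.I • b) : L2Disk) : ℂ → ℂ) =ᵐ[diskMeasure]
      fun z => -(Complex.I / 2) * (a z - Complex.I * b z) := by
    filter_upwards [Lp.coeFn_smul (-(Complex.I / 2)) (a - Complex.I • b),
      Lp.coeFn_sub a (Complex.I • b), Lp.coeFn_smul Complex.I b] with z e1 e2 e3
    rw [e1, Pi.smul_apply, e2, Pi.sub_apply, e3, Pi.smul_apply, smul_eq_mul, smul_eq_mul]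
  have h2 : (((Complex.I / 2) • (a + Complex.I • b) : L2Disk) : ℂ → ℂ) =ᵐ[diskMeasure]
      fun z => (Complex.I / 2) * (a z + Complex.I * b z) := by
    filter_upwards [Lp.coeFn_smul (Complex.I / 2) (a + Complex.I • b),
      Lp.coeFn_add a (Complex.I • b), Lp.coeFn_smul Complex.I b] with z e1 e2 e3
    rw [e1, Pi.smul_apply, e2, Pi.add_apply, e3, Pi.smul_apply, smul_eq_mul, smul_eq_mul]
  filter_upwards [Lp.coeFn_add (emb 1 ((-(Complex.I / 2)) • (a - Complex.I • b)))
    (emb (-1) ((Complex.I / 2) • (a + Complex.I • b))),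
    (coe_emb 1 _).trans (toLp_harmonic_congr 1 h1),
    (coe_emb (-1) _).trans (toLp_harmonic_congr (-1) h2)] with p e1 e2 e3
  rw [perp, e1, Pi.add_apply, e2, e3, harmonic, harmonic, ← conj_expI, Complex.re_eq_add_conj,
    Complex.im_eq_sub_conj]
  have hI : (2 * Complex.I)⁻¹ = -(Complex.I / 2) := by
    rw [mul_inv, Complex.inv_I]; ring
  rw [div_eq_mul_inv _ (2 * Complex.I), hI]
  linear_combination (1 / 2 * b p.1 * (expI 1 p.2 + (starRingEnd ℂ) (expI 1 p.2))) * Complex.I_sq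

theorem norm_emb_one_add_emb_neg_one_sq (u v : L2Disk) :
    ‖emb 1 u + emb (-1) v‖ ^ 2 = 2 * π * (‖u‖ ^ 2 + ‖v‖ ^ 2) := by
  have h : inner ℂ (emb 1 u) (emb (-1) v) = 0 := by
    rw [inner_emb, if_neg (by norm_num)]
  rw [sq, norm_add_sq_eq_norm_sq_add_norm_sq_of_inner_eq_zero _ _ h, norm_emb, norm_emb]
  have := Real.mul_self_sqrt Real.two_pi_pos.le
  linear_combination (‖u‖ ^ 2 + ‖v‖ ^ 2) * this

/-- The frequencies 1 and -1 are orthogonal, and the parallelogram law combines `a - ib` and `a +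
ib`. So the norm of `X_⊥u` is the Dirichlet norm up to the factor `√π`. -/
theorem norm_perp_sq (a b : L2Disk) : ‖perp a b‖ ^ 2 = π * (‖a‖ ^ 2 + ‖b‖ ^ 2) := by
  rw [perp, norm_emb_one_add_emb_neg_one_sq, norm_smul, norm_smul]
  have h := parallelogram_law_with_norm ℂ a (Complex.I • b)
  rw [norm_smul Complex.I b, Complex.norm_I] at h
  rw [norm_neg, norm_div, Complex.norm_I, Complex.norm_ofNat]
  linear_combination (π / 2) * h

theorem tendsto_perp {a b : ℕ → L2Disk} {a₀ b₀ : L2Disk} (ha : Tendsto a atTop (𝓝 a₀))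
    (hb : Tendsto b atTop (𝓝 b₀)) :
    Tendsto (fun n => perp (a n) (b n)) atTop (𝓝 (perp a₀ b₀)) :=
  (((emb 1).continuous.tendsto _).comp ((ha.sub (hb.const_smul _)).const_smul _)).add
    (((emb (-1)).continuous.tendsto _).comp ((ha.add (hb.const_smul _)).const_smul _))

/-- Smooth functions on the plane with mean zero on the unit circle. -/
def meanZeroSmooth : Submodule ℂ (ℂ → ℂ) where
  carrier := {φ | ContDiff ℝ ∞ φ ∧ ∫ β : Angles, φ (expI 1 β) = 0}
  zero_mem' := ⟨contDiff_const, by simp⟩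
  add_mem' := by
    rintro φ ψ ⟨h1, h2⟩ ⟨h3, h4⟩
    refine ⟨h1.add h3, ?_⟩
    have c1 := h1.continuous
    have c3 := h3.continuous
    have c := continuous_expI 1
    simp only [Pi.add_apply]
    rw [integral_add (integrable_angles_of_continuous (by fun_prop))
      (integrable_angles_of_continuous (by fun_prop)), h2, h4, add_zero]
  smul_mem' := by
    rintro c φ ⟨h1, h2⟩
    refine ⟨contDiff_const.smul h1, ?_⟩
    simp only [Pi.smul_apply]
    rw [integral_smul, h2, smul_zero]

/-- The directional derivative as a map to `L²(𝔻)`. -/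
def derivLp (v : ℂ) : meanZeroSmooth →ₗ[ℂ] L2Disk where
  toFun φ := (memLp_of_continuous (continuous_fderiv_apply_of_contDiff φ.2.1 v)).toLp
  map_add' φ ψ := by
    rw [← MemLp.toLp_add]
    congr 1
    ext z
    simp only [Pi.add_apply]
    rw [show ((φ + ψ : meanZeroSmooth) : ℂ → ℂ) = fun z => (φ : ℂ → ℂ) z + (ψ : ℂ → ℂ) z from rfl,
      fderiv_fun_add (φ.2.1.differentiable (by simp) z) (ψ.2.1.differentiable (by simp) z)]
    simp only [add_apply]
  map_smul' c φ := by
    rw [RingHom.id_apply, ← MemLp.toLp_const_smul]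
    congr 1
    ext z
    simp only [Pi.smul_apply]
    rw [show ((c • φ : meanZeroSmooth) : ℂ → ℂ) = fun z => c • (φ : ℂ → ℂ) z from rfl,
      fderiv_fun_const_smul (φ.2.1.differentiable (by simp) z)]
    simp only [smul_apply]

/-- Restriction to the disk. -/
def valLp : meanZeroSmooth →ₗ[ℂ] L2Disk where
  toFun φ := (memLp_of_continuous φ.2.1.continuous).toLp
  map_add' φ ψ := by rw [← MemLp.toLp_add]; rfl
  map_smul' c φ := by rw [RingHom.id_apply, ← MemLp.toLp_const_smul]; rfl

theorem memLp_angles_of_continuous {g : Angles → ℂ} (hg : Continuous g) :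
    MemLp g 2 (volume : Measure Angles) := by
  obtain ⟨C, hC⟩ := (isCompact_univ (X := Angles)).exists_bound_of_continuousOn hg.continuousOn
  exact MemLp.of_bound hg.aestronglyMeasurable C (Eventually.of_forall fun x => hC x trivial)

/-- Restriction to the unit circle. -/
def traceLp : meanZeroSmooth →ₗ[ℂ] Lp ℂ 2 (volume : Measure Angles) where
  toFun φ := (memLp_angles_of_continuous (φ.2.1.continuous.comp (continuous_expI 1))).toLp
  map_add' φ ψ := by rw [← MemLp.toLp_add]; rfl
  map_smul' c φ := by rw [RingHom.id_apply, ← MemLp.toLp_const_smul]; rfl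

/-- The operator `X_⊥` on smooth functions. -/
def perpSmooth : meanZeroSmooth →ₗ[ℂ] L2SD where
  toFun φ := perp (derivLp 1 φ) (derivLp Complex.I φ)
  map_add' φ ψ := by
    simp only [perp, smul_sub, smul_add, map_sub, map_add]
    abel
  map_smul' c φ := by
    simp only [perp, smul_sub, smul_add, map_sub, map_add, map_smul, RingHom.id_apply,
      smul_comm _ c]

theorem integral_gradSq (φ : meanZeroSmooth) :
    ∫ z, gradSq φ z ∂diskMeasure = ‖derivLp 1 φ‖ ^ 2 + ‖derivLp Complex.I φ‖ ^ 2 := by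
  have c1 := continuous_fderiv_apply_of_contDiff φ.2.1 1
  have c2 := continuous_fderiv_apply_of_contDiff φ.2.1 Complex.I
  have e1 : ‖derivLp 1 φ‖ ^ 2 = _ := norm_toLp_sq (memLp_of_continuous c1)
  have e2 : ‖derivLp Complex.I φ‖ ^ 2 = _ := norm_toLp_sq (memLp_of_continuous c2)
  rw [e1, e2, ← integral_add]
  · rfl
  · exact integrable_disk_of_continuous (by fun_prop)
  · exact integrable_disk_of_continuous (by fun_prop)

theorem norm_perpSmooth_sq (φ : meanZeroSmooth) :
    ‖perpSmooth φ‖ ^ 2 = π * ∫ z, gradSq φ z ∂diskMeasure := by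
  rw [integral_gradSq]
  exact norm_perp_sq _ _

theorem integral_gradSq_le (φ : meanZeroSmooth) :
    ∫ z, gradSq φ z ∂diskMeasure ≤ ‖perpSmooth φ‖ ^ 2 := by
  rw [norm_perpSmooth_sq]
  have h0 : 0 ≤ ∫ z, gradSq φ z ∂diskMeasure := integral_nonneg (gradSq_nonneg _)
  nlinarith [Real.pi_gt_three]

theorem norm_derivLp_one_le (φ : meanZeroSmooth) : ‖derivLp 1 φ‖ ≤ ‖perpSmooth φ‖ := by
  have h := integral_gradSq_le φ
  rw [integral_gradSq] at h
  exact (sq_le_sq₀ (norm_nonneg _) (norm_nonneg _)).mp (by nlinarith)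

theorem norm_derivLp_I_le (φ : meanZeroSmooth) : ‖derivLp Complex.I φ‖ ≤ ‖perpSmooth φ‖ := by
  have h := integral_gradSq_le φ
  rw [integral_gradSq] at h
  exact (sq_le_sq₀ (norm_nonneg _) (norm_nonneg _)).mp (by nlinarith)

theorem norm_traceLp_sq_le (φ : meanZeroSmooth) :
    ‖traceLp φ‖ ^ 2 ≤ (6 * π ^ 2 + 4) * ∫ z, gradSq φ z ∂diskMeasure := by
  have e : ‖traceLp φ‖ ^ 2 = _ :=
    norm_toLp_sq (memLp_angles_of_continuous (φ.2.1.continuous.comp (continuous_expI 1)))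
  rw [e]
  exact integral_circle_norm_sq_le_of_mean_zero φ.2.1 φ.2.2

theorem norm_traceLp_le (φ : meanZeroSmooth) :
    ‖traceLp φ‖ ≤ √(6 * π ^ 2 + 5) * ‖perpSmooth φ‖ := by
  have h := norm_traceLp_sq_le φ
  have h2 := integral_gradSq_le φ
  refine (sq_le_sq₀ (norm_nonneg _) (by positivity)).mp ?_
  rw [mul_pow, Real.sq_sqrt (by positivity)]
  have h0 : 0 ≤ ∫ z, gradSq φ z ∂diskMeasure := integral_nonneg (gradSq_nonneg _)
  nlinarith [sq_nonneg π]

/-- A Poincaré inequality: the disk norm is bounded by the trace, of constant `6π² + 4` for mean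
zero, plus one further Dirichlet integral. -/
theorem norm_valLp_le (φ : meanZeroSmooth) :
    ‖valLp φ‖ ≤ √(6 * π ^ 2 + 5) * ‖perpSmooth φ‖ := by
  have h := norm_traceLp_sq_le φ
  have h2 := integral_gradSq_le φ
  have e : ‖valLp φ‖ ^ 2 = _ := norm_toLp_sq (memLp_of_continuous φ.2.1.continuous)
  have e2 : ‖traceLp φ‖ ^ 2 = _ :=
    norm_toLp_sq (memLp_angles_of_continuous (φ.2.1.continuous.comp (continuous_expI 1)))
  have h3 := integral_disk_norm_sq_le φ.2.1
  refine (sq_le_sq₀ (norm_nonneg _) (by positivity)).mp ?_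
  rw [mul_pow, Real.sq_sqrt (by positivity)]
  have h0 : 0 ≤ ∫ z, gradSq φ z ∂diskMeasure := integral_nonneg (gradSq_nonneg _)
  have h4 : ‖valLp φ‖ ^ 2 ≤ ‖traceLp φ‖ ^ 2 + ∫ z, gradSq φ z ∂diskMeasure := by
    rw [e, e2]
    exact h3
  nlinarith [sq_nonneg π]

/-- Serves to recover the limits of the values, the derivatives and the traces from the convergence
of `X_⊥φₙ` alone. -/
theorem exists_tendsto_of_norm_le {T E H : Type*} [AddCommGroup T] [Module ℂ T]
    [NormedAddCommGroup E] [NormedSpace ℂ E] [CompleteSpace E] [NormedAddCommGroup H]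
    [NormedSpace ℂ H] (L : T →ₗ[ℂ] E) (S : T →ₗ[ℂ] H) {C : ℝ}
    (hL : ∀ φ, ‖L φ‖ ≤ C * ‖S φ‖) {φ : ℕ → T} (hφ : CauchySeq fun n => S (φ n)) :
    ∃ y, Tendsto (fun n => L (φ n)) atTop (𝓝 y) := by
  refine cauchySeq_tendsto_of_complete ?_
  rw [Metric.cauchySeq_iff] at hφ ⊢
  intro ε hε
  obtain ⟨N, hN⟩ := hφ (ε / (|C| + 1)) (by positivity)
  refine ⟨N, fun m hm n hn => ?_⟩
  have h := hN m hm n hn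
  rw [dist_eq_norm, ← map_sub, lt_div_iff₀ (by positivity)] at h
  rw [dist_eq_norm, ← map_sub]
  refine (hL _).trans_lt (lt_of_le_of_lt ?_ h)
  rw [mul_comm]
  exact mul_le_mul_of_nonneg_left ((le_abs_self C).trans (by linarith)) (norm_nonneg _)

theorem tendsto_eLpNorm_of_tendsto_toLp {X : Type*} [MeasurableSpace X] {μ : Measure X}
    {g : ℕ → X → ℂ} (hg : ∀ n, MemLp (g n) 2 μ) {f : Lp ℂ 2 μ}
    (h : Tendsto (fun n => (hg n).toLp) atTop (𝓝 f)) :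
    Tendsto (fun n => eLpNorm (fun x => g n x - f x) 2 μ) atTop (𝓝 0) := by
  rw [Lp.tendsto_Lp_iff_tendsto_eLpNorm'] at h
  refine h.congr fun n => eLpNorm_congr_ae ?_
  filter_upwards [(hg n).coeFn_toLp] with x hx
  rw [Pi.sub_apply, hx]

theorem hasWeakDeriv_of_tendsto {φ : ℕ → meanZeroSmooth} {u w : L2Disk} {v : ℂ}
    (hu : Tendsto (fun n => valLp (φ n)) atTop (𝓝 u))
    (hw : Tendsto (fun n => derivLp v (φ n)) atTop (𝓝 w)) : HasWeakDeriv v u w := by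
  intro χ
  have hχ := contDiff_test χ
  have h1 := tendsto_integral_mul_of_tendsto hu
    (memLp_of_continuous (continuous_fderiv_apply_of_contDiff hχ v))
  have h2 := (tendsto_integral_mul_of_tendsto hw (memLp_of_continuous hχ.continuous)).neg
  refine tendsto_nhds_unique h1 (h2.congr fun n => ?_)
  have h3 := integral_fderiv_test_mul χ (φ n).2.1 v
  have e1 : ∫ z, valLp (φ n) z * fderiv ℝ χ z v ∂diskMeasure =
      ∫ z, fderiv ℝ χ z v * (φ n : ℂ → ℂ) z ∂diskMeasure := by
    refine integral_congr_ae ?_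
    filter_upwards [(memLp_of_continuous (φ n).2.1.continuous).coeFn_toLp] with z hz
    rw [mul_comm]
    congr 1
  have e2 : ∫ z, derivLp v (φ n) z * χ z ∂diskMeasure =
      ∫ z, χ z * fderiv ℝ (φ n : ℂ → ℂ) z v ∂diskMeasure := by
    refine integral_congr_ae ?_
    filter_upwards [(memLp_of_continuous
      (continuous_fderiv_apply_of_contDiff (φ n).2.1 v)).coeFn_toLp] with z hz
    rw [mul_comm]
    congr 1
  rw [e1, e2, h3]

/-- The closure of the range of `X_⊥` on smooth functions. -/
def perpClosure : Submodule ℂ L2SD := (LinearMap.range perpSmooth).topologicalClosure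

/-- Along a sequence with `X_⊥φₙ` convergent, the estimates above make `φₙ`, its gradient and its
trace converge. The limit is in `Ḣ¹`, because weak derivatives and the mean of the trace pass to L²
limits, and the `φₙ` themselves witness the trace. -/
theorem exists_perp_of_mem_perpClosure {h : L2SD} (hh : h ∈ perpClosure) :
    h ∈ xPerpRange ∧ ∃ a b, h = perp a b := by
  have hh' : h ∈ closure (Set.range perpSmooth) := hh
  obtain ⟨x, hx, hlim⟩ := mem_closure_iff_seq_limit.mp hh'
  choose φ hφ using hx
  have hlim1 : Tendsto (fun n => perpSmooth (φ n)) atTop (𝓝 h) := by simpa only [hφ] using hlim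
  obtain ⟨u, hu⟩ := exists_tendsto_of_norm_le valLp perpSmooth norm_valLp_le hlim1.cauchySeq
  obtain ⟨T, hT⟩ := exists_tendsto_of_norm_le traceLp perpSmooth norm_traceLp_le hlim1.cauchySeq
  obtain ⟨ux, hux⟩ := exists_tendsto_of_norm_le (derivLp 1) perpSmooth (C := 1)
    (fun φ => by simpa using norm_derivLp_one_le φ) hlim1.cauchySeq
  obtain ⟨uy, huy⟩ := exists_tendsto_of_norm_le (derivLp Complex.I) perpSmooth (C := 1)
    (fun φ => by simpa using norm_derivLp_I_le φ) hlim1.cauchySeq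
  have hperp : h = perp ux uy := tendsto_nhds_unique hlim1 (tendsto_perp hux huy)
  have hH1 : IsH1With u ux uy := ⟨Lp.memLp u, Lp.memLp ux, Lp.memLp uy,
    hasWeakDeriv_of_tendsto hu hux, hasWeakDeriv_of_tendsto hu huy⟩
  have hT0 : ∫ β, T β = 0 := by
    have h1 := tendsto_integral_mul_of_tendsto hT
      (memLp_angles_of_continuous (continuous_const (y := (1 : ℂ))))
    simp only [mul_one] at h1
    refine tendsto_nhds_unique h1 (tendsto_const_nhds.congr fun n => ?_)
    rw [← (φ n).2.2]
    exact (integral_congr_ae (memLp_angles_of_continuous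
      ((φ n).2.1.continuous.comp (continuous_expI 1))).coeFn_toLp).symm
  have htr : HasTrace u ux uy T := by
    refine ⟨Lp.memLp T, fun n => (φ n : ℂ → ℂ), fun n => (φ n).2.1, ?_, ?_, ?_, ?_⟩
    · exact tendsto_eLpNorm_of_tendsto_toLp (fun n => memLp_of_continuous (φ n).2.1.continuous) hu
    · exact tendsto_eLpNorm_of_tendsto_toLp (fun n => memLp_of_continuous
        (continuous_fderiv_apply_of_contDiff (φ n).2.1 1)) hux
    · exact tendsto_eLpNorm_of_tendsto_toLp (fun n => memLp_of_continuous
        (continuous_fderiv_apply_of_contDiff (φ n).2.1 Complex.I)) huy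
    · exact tendsto_eLpNorm_of_tendsto_toLp (fun n => memLp_angles_of_continuous
        ((φ n).2.1.continuous.comp (continuous_expI 1))) hT
  refine ⟨⟨u, ux, uy, ⟨hH1, T, htr, hT0⟩, ?_⟩, ux, uy, hperp⟩
  rw [hperp]
  exact coe_perp ux uy

/-! ### The components of frequency ±1 -/

theorem moment_add (k : ℕ) (l : ℤ) (f g : L2SD) :
    moment k l (f + g : L2SD) = moment k l f + moment k l g := by
  simp only [← inner_weightLp, inner_add_right]

theorem moment_sum {ι : Type*} (k : ℕ) (l : ℤ) (s : Finset ι) (f : ι → L2SD) :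
    moment k l (∑ i ∈ s, f i : L2SD) = ∑ i ∈ s, moment k l (f i) := by
  simp only [← inner_weightLp, inner_sum]

/-- The factor `K + 1` turns the binomials of order `K` into binomials of order `K + 1` times `K + 1
- a` or `a`. After a shift of the index for `B`, both components contribute to the same term. -/
theorem succ_mul_moment_emb_one (K : ℕ) (l : ℤ) (A B : L2Disk) :
    (K + 1 : ℂ) * moment K l (emb 1 A + emb (-1) B : L2SD) = 2 * π *
      ∑ a ∈ Finset.range (K + 2), if l + 1 = 2 * a - K then
        ((K + 1).choose a : ℂ) * (-1) ^ (K + 1 - a) * (a * diskMoment (a - 1) (K + 1 - a) B -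
          (K + 1 - a : ℕ) * diskMoment a (K + 1 - a - 1) A) else 0 := by
  have e1 : (K + 1 : ℂ) * ∑ a ∈ Finset.range (K + 1), (if l + 1 = 2 * a - K then
      (K.choose a : ℂ) * (-1) ^ (K - a) * diskMoment a (K - a) A else 0) =
      ∑ a ∈ Finset.range (K + 2), if l + 1 = 2 * a - K then
        ((K + 1).choose a : ℂ) * (-1) ^ (K + 1 - a) *
          (-((K + 1 - a : ℕ) * diskMoment a (K + 1 - a - 1) A)) else 0 := by
    rw [Finset.sum_range_succ _ (K + 1), Nat.sub_self, Finset.mul_sum]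
    simp only [Nat.cast_zero, zero_mul, neg_zero, mul_zero, ite_self, add_zero]
    refine Finset.sum_congr rfl fun a ha => ?_
    have hak : a ≤ K := Nat.lt_succ_iff.mp (Finset.mem_range.mp ha)
    have h1 : (K.choose a : ℂ) * (K + 1) = (K + 1).choose a * (K + 1 - a : ℕ) := by
      exact_mod_cast Nat.choose_mul_succ_eq K a
    have h2 : K + 1 - a = K - a + 1 := by omega
    rw [mul_ite, mul_zero]
    congr 1
    rw [h2] at h1 ⊢
    rw [add_tsub_cancel_right, pow_succ]
    linear_combination (-1) ^ (K - a) * diskMoment a (K - a) A * h1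
  have e2 : (K + 1 : ℂ) * ∑ a ∈ Finset.range (K + 1), (if l + -1 = 2 * a - K then
      (K.choose a : ℂ) * (-1) ^ (K - a) * diskMoment a (K - a) B else 0) =
      ∑ a ∈ Finset.range (K + 2), if l + 1 = 2 * a - K then
        ((K + 1).choose a : ℂ) * (-1) ^ (K + 1 - a) * (a * diskMoment (a - 1) (K + 1 - a) B)
          else 0 := by
    rw [Finset.sum_range_succ' _ (K + 1), Finset.mul_sum]
    simp only [Nat.cast_zero, zero_mul, mul_zero, ite_self, add_zero, add_tsub_cancel_right,
      Nat.add_sub_add_right]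
    refine Finset.sum_congr rfl fun a _ => ?_
    have h1 : ((K : ℂ) + 1) * K.choose a = (K + 1).choose (a + 1) * (a + 1 : ℕ) := by
      exact_mod_cast Nat.add_one_mul_choose_eq K a
    have h2 : l + 1 = 2 * ((a + 1 : ℕ) : ℤ) - K ↔ l + -1 = 2 * a - K := by push_cast; omega
    rw [mul_ite, mul_zero]
    simp only [h2]
    congr 1
    linear_combination (-1) ^ (K - a) * diskMoment a (K - a) B * h1
  rw [moment_add, moment_emb, moment_emb, mul_add, mul_left_comm, e1, mul_left_comm _ _ (∑ _ ∈ _, _),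
    e2, ← mul_add, ← Finset.sum_add_distrib]
  congr 1
  refine Finset.sum_congr rfl fun a _ => ?_
  split_ifs <;> ring

theorem emb_one_add_emb_neg_one_mem_momentKer_iff (A B : L2Disk) :
    emb 1 A + emb (-1) B ∈ momentKer ↔
      ∀ a b : ℕ, (b : ℂ) * diskMoment a (b - 1) A = a * diskMoment (a - 1) b B := by
  rw [mem_momentKer]
  constructor
  · intro h a b
    rcases Nat.eq_zero_or_pos (a + b) with h0 | h0
    · obtain ⟨rfl, rfl⟩ : a = 0 ∧ b = 0 := by omega
      simp
    obtain ⟨K, hK⟩ : ∃ K, a + b = K + 1 := ⟨a + b - 1, by omega⟩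
    -- This frequency selects exactly the term of index `a`.
    have h1 := succ_mul_moment_emb_one K (2 * a - K - 1) A B
    rw [h, mul_zero, Finset.sum_eq_single a, if_pos (by ring)] at h1
    · have hb : K + 1 - a = b := by omega
      rw [hb] at h1
      have hc : ((K + 1).choose a : ℂ) ≠ 0 := by
        exact_mod_cast (Nat.choose_pos (by omega)).ne'
      have hp : (2 * π : ℂ) ≠ 0 := by exact_mod_cast Real.two_pi_pos.ne'
      have h2 : ((-1 : ℂ)) ^ b ≠ 0 := pow_ne_zero _ (by norm_num)
      have h3 := (mul_eq_zero.mp h1.symm).resolve_left hp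
      have h4 := (mul_eq_zero.mp h3).resolve_left (mul_ne_zero hc h2)
      exact (sub_eq_zero.mp h4).symm
    · intro a' _ hne
      rw [if_neg]
      omega
    · intro hn
      rw [Finset.mem_range] at hn
      omega
  · intro h K l
    have h1 := succ_mul_moment_emb_one K l A B
    rw [Finset.sum_eq_zero, mul_zero, mul_eq_zero] at h1
    · exact h1.resolve_left (by exact_mod_cast K.succ_ne_zero)
    · intro a _
      rw [h, sub_self, mul_zero, ite_self]

theorem conj_mono (a b : ℕ) (z : ℂ) : (starRingEnd ℂ) (mono a b z) = mono b a z := by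
  simp [mono, mul_comm]

/-- A monomial normalized to have mean zero on the circle. -/
theorem exists_meanZeroSmooth_mono (a b : ℕ) : ∃ φ : meanZeroSmooth,
    ∃ c : ℂ, (φ : ℂ → ℂ) = fun z => mono a b z - c := by
  set M := ∫ β : Angles, mono a b (expI 1 β) with hM
  have hp : (2 * π : ℂ) ≠ 0 := by exact_mod_cast Real.two_pi_pos.ne'
  refine ⟨⟨fun z => mono a b z - M / (2 * π), (contDiff_mono a b).sub contDiff_const, ?_⟩, _, rfl⟩
  change ∫ β : Angles, (mono a b (expI 1 β) - M / (2 * π)) = 0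
  have hi : Integrable (fun β : Angles => mono a b (expI 1 β)) volume :=
    integrable_angles_of_continuous ((continuous_mono a b).comp (continuous_expI 1))
  rw [integral_sub hi (integrable_const _), ← hM]
  have h1 := integral_expI 0
  simp only [expI_zero, if_pos] at h1
  have h2 : ∫ _ : Angles, M / (2 * π) = (M / (2 * π)) * ∫ _ : Angles, (1 : ℂ) := by
    rw [← integral_const_mul]; simp
  rw [h2, h1, div_mul_cancel₀ _ hp, sub_self]

theorem inner_smul_derivLp (φ : meanZeroSmooth) (A : L2Disk) :
    inner ℂ ((-(Complex.I / 2)) • (derivLp 1 φ - Complex.I • derivLp Complex.I φ)) A =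
      Complex.I * ∫ z, A z * (starRingEnd ℂ) (dz φ z) ∂diskMeasure := by
  rw [← integral_const_mul, L2.inner_def]
  refine integral_congr_ae ?_
  filter_upwards [Lp.coeFn_smul (-(Complex.I / 2)) (derivLp 1 φ - Complex.I • derivLp Complex.I φ),
    Lp.coeFn_sub (derivLp 1 φ) (Complex.I • derivLp Complex.I φ),
    Lp.coeFn_smul Complex.I (derivLp Complex.I φ),
    (memLp_of_continuous (continuous_fderiv_apply_of_contDiff φ.2.1 1)).coeFn_toLp,
    (memLp_of_continuous (continuous_fderiv_apply_of_contDiff φ.2.1 Complex.I)).coeFn_toLp]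
    with z e1 e2 e3 e4 e5
  have e4' : derivLp 1 φ z = fderiv ℝ φ z 1 := e4
  have e5' : derivLp Complex.I φ z = fderiv ℝ φ z Complex.I := e5
  rw [e1, Pi.smul_apply, e2, Pi.sub_apply, e3, Pi.smul_apply, e4', e5', RCLike.inner_apply]
  simp [dz, map_ofNat]
  ring

theorem inner_smul_derivLp' (φ : meanZeroSmooth) (B : L2Disk) :
    inner ℂ ((Complex.I / 2) • (derivLp 1 φ + Complex.I • derivLp Complex.I φ)) B =
      -(Complex.I * ∫ z, B z * (starRingEnd ℂ) (dzbar φ z) ∂diskMeasure) := by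
  rw [← integral_const_mul, ← integral_neg, L2.inner_def]
  refine integral_congr_ae ?_
  filter_upwards [Lp.coeFn_smul (Complex.I / 2) (derivLp 1 φ + Complex.I • derivLp Complex.I φ),
    Lp.coeFn_add (derivLp 1 φ) (Complex.I • derivLp Complex.I φ),
    Lp.coeFn_smul Complex.I (derivLp Complex.I φ),
    (memLp_of_continuous (continuous_fderiv_apply_of_contDiff φ.2.1 1)).coeFn_toLp,
    (memLp_of_continuous (continuous_fderiv_apply_of_contDiff φ.2.1 Complex.I)).coeFn_toLp]
    with z e1 e2 e3 e4 e5
  have e4' : derivLp 1 φ z = fderiv ℝ φ z 1 := e4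
  have e5' : derivLp Complex.I φ z = fderiv ℝ φ z Complex.I := e5
  rw [e1, Pi.smul_apply, e2, Pi.add_apply, e3, Pi.smul_apply, e4', e5', RCLike.inner_apply]
  simp [dzbar, map_ofNat]
  ring

/-- Orthogonality to `X_⊥` of `z^b conj z^a`, made mean zero by a constant that `X_⊥` annihilates,
is the relation of index `(a, b)` in the criterion for `momentKer`. -/
theorem mem_momentKer_of_orthogonal_perpSmooth {A B : L2Disk}
    (h : ∀ φ, inner ℂ (perpSmooth φ) (emb 1 A + emb (-1) B) = 0) :
    emb 1 A + emb (-1) B ∈ momentKer := by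
  rw [emb_one_add_emb_neg_one_mem_momentKer_iff]
  intro a b
  obtain ⟨φ, c, hφ⟩ := exists_meanZeroSmooth_mono b a
  have h1 := h φ
  have e0 : perpSmooth φ = perp (derivLp 1 φ) (derivLp Complex.I φ) := rfl
  rw [e0, perp, inner_add_left, inner_add_right, inner_add_right, inner_emb, inner_emb, inner_emb,
    inner_emb, if_pos rfl, if_neg (by norm_num), if_neg (by norm_num), if_pos rfl,
    inner_smul_derivLp, inner_smul_derivLp'] at h1
  have hdz : ∀ z, (starRingEnd ℂ) (dz φ z) = b * mono a (b - 1) z := by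
    intro z
    rw [hφ]
    have := dz_mono b a z
    simp only [dz, fderiv_sub_const] at this ⊢
    rw [this, map_mul, conj_mono, map_natCast]
  have hdzbar : ∀ z, (starRingEnd ℂ) (dzbar φ z) = a * mono (a - 1) b z := by
    intro z
    rw [hφ]
    have := dzbar_mono b a z
    simp only [dzbar, fderiv_sub_const] at this ⊢
    rw [this, map_mul, conj_mono, map_natCast]
  simp only [hdz, hdzbar, mul_left_comm _ (_ : ℂ) (mono _ _ _)] at h1
  rw [integral_const_mul, integral_const_mul] at h1
  have hp : (2 * π * Complex.I : ℂ) ≠ 0 :=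
    mul_ne_zero (by exact_mod_cast Real.two_pi_pos.ne') Complex.I_ne_zero
  refine sub_eq_zero.mp ((mul_eq_zero.mp (?_ : 2 * π * Complex.I * _ = 0)).resolve_left hp)
  rw [← h1, diskMoment, diskMoment]
  ring

/-- Orthogonal projection on `perpClosure`. The remainder again has only the frequencies ±1, so its
orthogonality to every `X_⊥φ` puts it in `momentKer`; the norm bound is Pythagoras. -/
theorem exists_perp_reduction (A B : L2Disk) : ∃ a b : L2Disk, perp a b ∈ xPerpRange ∧
    emb 1 A + emb (-1) B - perp a b ∈ momentKer ∧ ‖perp a b‖ ≤ ‖emb 1 A + emb (-1) B‖ := by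
  have : CompleteSpace perpClosure := (Submodule.isClosed_topologicalClosure _).completeSpace_coe
  obtain ⟨v, hv, h, hh, hvh⟩ := perpClosure.exists_add_mem_mem_orthogonal (emb 1 A + emb (-1) B)
  obtain ⟨hr, a, b, rfl⟩ := exists_perp_of_mem_perpClosure hv
  refine ⟨a, b, hr, ?_, ?_⟩
  · have e : h = emb 1 (A - (-(Complex.I / 2)) • (a - Complex.I • b)) +
        emb (-1) (B - (Complex.I / 2) • (a + Complex.I • b)) := by
      rw [map_sub, map_sub, ← sub_eq_iff_eq_add'.mpr hvh, perp]
      abel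
    rw [hvh, add_sub_cancel_left, e]
    refine mem_momentKer_of_orthogonal_perpSmooth fun φ => ?_
    rw [← e]
    exact hh _ (subset_closure ⟨φ, rfl⟩)
  · have hpy : ‖emb 1 A + emb (-1) B‖ * ‖emb 1 A + emb (-1) B‖ =
        ‖perp a b‖ * ‖perp a b‖ + ‖h‖ * ‖h‖ := by
      rw [hvh]
      exact norm_add_sq_eq_norm_sq_add_norm_sq_of_inner_eq_zero _ _ (hh _ hv)
    nlinarith [norm_nonneg (emb 1 A + emb (-1) B), norm_nonneg (perp a b), norm_nonneg h]

theorem inner_dzLp_conjTest (φ : 𝓓(disk, ℂ)) (u : L2Disk) :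
    inner ℂ (dzLp (conjTest φ)) u = ∫ z, u z * dzbar φ z ∂diskMeasure := by
  rw [L2.inner_def]
  refine integral_congr_ae ?_
  filter_upwards [coe_dzLp (conjTest φ)] with z hz
  rw [hz, RCLike.inner_apply, coe_conjTest, dz_conj_comp (contDiff_test φ), Complex.conj_conj]

theorem inner_dzbarLp_conjTest (φ : 𝓓(disk, ℂ)) (u : L2Disk) :
    inner ℂ (dzbarLp (conjTest φ)) u = ∫ z, u z * dz φ z ∂diskMeasure := by
  rw [L2.inner_def]
  refine integral_congr_ae ?_
  filter_upwards [coe_dzbarLp (conjTest φ)] with z hz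
  rw [hz, RCLike.inner_apply, coe_conjTest, dzbar_conj_comp (contDiff_test φ), Complex.conj_conj]

theorem conjTest_conjTest (φ : 𝓓(disk, ℂ)) : conjTest (conjTest φ) = φ := by
  ext z
  simp [coe_conjTest]

/-- The partial derivative of a test function, as a test function. -/
def derivTest (v : ℂ) (φ : 𝓓(disk, ℂ)) : 𝓓(disk, ℂ) :=
  mkTest (fun z => fderiv ℝ φ z v) (contDiff_fderiv_apply (contDiff_test φ) v)
    ((hasCompactSupport_test φ).fderiv_apply ℝ v)
    ((tsupport_fderiv_apply_subset ℝ v).trans (tsupport_test_subset φ))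

/-- The components are `A = -i∂u` and `B = i∂̄u`, and `∂̄A + ∂B = 0` because mixed derivatives
commute. Weakly, this comes from testing `∂_x u` against `∂_yχ` and `∂_y u` against `∂_xχ`. -/
theorem exists_perp_of_mem_xPerpRange {h : L2SD} (hh : h ∈ xPerpRange) : ∃ A B : L2Disk,
    h = emb 1 A + emb (-1) B ∧ ∀ φ, inner ℂ (dzLp φ) A + inner ℂ (dzbarLp φ) B = 0 := by
  obtain ⟨u, ux, uy, ⟨hH, -⟩, hae⟩ := hh
  set a : L2Disk := hH.memLp_x.toLp with ha
  set b : L2Disk := hH.memLp_y.toLp with hb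
  have ea : a =ᵐ[diskMeasure] ux := hH.memLp_x.coeFn_toLp
  have eb : b =ᵐ[diskMeasure] uy := hH.memLp_y.coeFn_toLp
  refine ⟨(-(Complex.I / 2)) • (a - Complex.I • b), (Complex.I / 2) • (a + Complex.I • b), ?_, ?_⟩
  · refine Lp.ext (hae.trans ?_)
    have q : Measure.QuasiMeasurePreserving Prod.fst bundleMeasure diskMeasure :=
      Measure.quasiMeasurePreserving_fst
    filter_upwards [coe_perp a b, q.ae ea, q.ae eb] with p e1 e2 e3
    rw [perp] at e1
    rw [e1, e2, e3]
  · intro φ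
    rw [← conjTest_conjTest φ, inner_dzLp_conjTest, inner_dzbarLp_conjTest]
    set χ := conjTest φ
    have hχ := contDiff_test χ
    have w1 := hH.weak_x (derivTest Complex.I χ)
    have w2 := hH.weak_y (derivTest 1 χ)
    have ex : ∀ v, ⇑(derivTest v χ) = fun z => fderiv ℝ χ z v := fun v => rfl
    rw [ex] at w1 w2
    simp only [fderiv_fderiv_comm hχ _ Complex.I 1] at w1
    rw [w1, neg_inj] at w2
    have c1 := continuous_fderiv_apply_of_contDiff hχ 1
    have c2 := continuous_fderiv_apply_of_contDiff hχ Complex.I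
    have i1 := hH.memLp_x.integrable one_le_two
    have i2 := hH.memLp_y.integrable one_le_two
    rw [← integral_add (integrable_mul_continuous (integrable_L2Disk _) (continuous_dzbar hχ))
      (integrable_mul_continuous (integrable_L2Disk _) (continuous_dz hχ))]
    have : ∀ᵐ z ∂diskMeasure, ((-(Complex.I / 2)) • (a - Complex.I • b) : L2Disk) z * dzbar χ z +
        ((Complex.I / 2) • (a + Complex.I • b) : L2Disk) z * dz χ z =
        (1 / 2) * (ux z * fderiv ℝ χ z Complex.I - uy z * fderiv ℝ χ z 1) := by
      filter_upwards [Lp.coeFn_smul (-(Complex.I / 2)) (a - Complex.I • b),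
        Lp.coeFn_sub a (Complex.I • b), Lp.coeFn_smul Complex.I b,
        Lp.coeFn_smul (Complex.I / 2) (a + Complex.I • b),
        Lp.coeFn_add a (Complex.I • b), ea, eb] with z e1 e2 e3 e4 e5 e6 e7
      rw [e1, e4, Pi.smul_apply, Pi.smul_apply, e2, e5, Pi.sub_apply, Pi.add_apply, e3,
        Pi.smul_apply, e6, e7]
      simp only [smul_eq_mul, dz, dzbar]
      linear_combination (-(1 / 2) * ux z * fderiv ℝ χ z Complex.I +
        1 / 2 * uy z * fderiv ℝ χ z 1) * Complex.I_sq
    rw [integral_congr_ae this, integral_const_mul, integral_sub (integrable_mul_continuous i1 c2)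
      (integrable_mul_continuous i2 c1), w2, sub_self, mul_zero]

/-! ### Tensors and their harmonic components -/

/-- The `m`-tensor with harmonic components `u m, u (m - 2), …, u (-m)`. -/
def tensorLM (m : ℕ) : (ℤ → L2Disk) →ₗ[ℂ] L2SD :=
  ∑ j ∈ Finset.range (m + 1),
    (emb ((m : ℤ) - 2 * j)).toLinearMap ∘ₗ LinearMap.proj ((m : ℤ) - 2 * j)

theorem tensorLM_apply (m : ℕ) (u : ℤ → L2Disk) :
    tensorLM m u = ∑ j ∈ Finset.range (m + 1), emb ((m : ℤ) - 2 * j) (u ((m : ℤ) - 2 * j)) := by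
  simp [tensorLM, LinearMap.sum_apply]

theorem coe_tensorLM (m : ℕ) (u : ℤ → L2Disk) : tensorLM m u =ᵐ[bundleMeasure] fun p =>
    ∑ j ∈ Finset.range (m + 1), harmonic ((m : ℤ) - 2 * j) (u ((m : ℤ) - 2 * j)) p := by
  rw [tensorLM_apply]
  refine (Lp.coeFn_finsetSum _ _).trans ?_
  have h : ∀ᵐ p ∂bundleMeasure, ∀ k : ℤ, emb k (u k) p = harmonic k (u k) p :=
    ae_all_iff.mpr fun k => coe_emb k (u k)
  filter_upwards [h] with p hp
  rw [Finset.sum_apply]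
  exact Finset.sum_congr rfl fun j _ => hp _

theorem mem_tensors_iff {m : ℕ} {f : L2SD} : f ∈ tensors m ↔ f ∈ (tensorLM m).range := by
  constructor
  · rintro ⟨a, ha, hf⟩
    refine ⟨fun k => (ha k).toLp, Lp.ext ?_⟩
    refine (coe_tensorLM m _).trans (EventuallyEq.trans ?_ hf.symm)
    have h : ∀ᵐ p ∂bundleMeasure, ∀ k : ℤ,
        harmonic k ((ha k).toLp : L2Disk) p = harmonic k (a k) p :=
      ae_all_iff.mpr fun k => toLp_harmonic_congr k (ha k).coeFn_toLp
    filter_upwards [h] with p hp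
    exact Finset.sum_congr rfl fun j _ => hp _
  · rintro ⟨u, rfl⟩
    exact ⟨fun k => u k, fun k => Lp.memLp _, coe_tensorLM m u⟩

theorem emb_mem_range_tensorLM {m i : ℕ} (hi : i ≤ m) (a : L2Disk) :
    emb ((m : ℤ) - 2 * i) a ∈ (tensorLM m).range := by
  refine ⟨Pi.single ((m : ℤ) - 2 * i) a, ?_⟩
  rw [tensorLM_apply, Finset.sum_eq_single i, Pi.single_eq_same]
  · intro j _ hj
    rw [Pi.single_eq_of_ne (by omega), map_zero]
  · intro h
    exact absurd (Finset.mem_range.mpr (by omega)) h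

theorem tensorLM_add_two (m : ℕ) (u : ℤ → L2Disk) : tensorLM (m + 2) u =
    tensorLM m u + (emb (m + 2) (u (m + 2)) + emb (-(m + 2)) (u (-(m + 2)))) := by
  have e1 : ((m + 2 : ℕ) : ℤ) - 2 * (0 : ℕ) = m + 2 := by push_cast; ring
  have e2 : ((m + 2 : ℕ) : ℤ) - 2 * (m + 2 : ℕ) = -(m + 2) := by push_cast; ring
  have e3 : ∀ j : ℕ, ((m + 2 : ℕ) : ℤ) - 2 * (j + 1 : ℕ) = m - 2 * j := fun j => by
    push_cast; ring
  rw [tensorLM_apply, tensorLM_apply, Finset.sum_range_succ, Finset.sum_range_succ', e1, e2]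
  simp only [e3]
  abel

/-- Distinct frequencies are orthogonal, so pairing the tensor with one component returns the
squared norm of that component; Cauchy–Schwarz concludes. -/
theorem norm_emb_le_norm_tensorLM {m i : ℕ} (hi : i ≤ m) (u : ℤ → L2Disk) :
    ‖emb ((m : ℤ) - 2 * i) (u ((m : ℤ) - 2 * i))‖ ≤ ‖tensorLM m u‖ := by
  set v := emb ((m : ℤ) - 2 * i) (u ((m : ℤ) - 2 * i)) with hv
  have h : inner ℂ v (tensorLM m u) = inner ℂ v v := by
    rw [tensorLM_apply, inner_sum, Finset.sum_eq_single i]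
    · intro j _ hj
      rw [hv, inner_emb, if_neg (by omega)]
    · intro h
      exact absurd (Finset.mem_range.mpr (by omega)) h
  have h1 := norm_inner_le_norm (𝕜 := ℂ) v (tensorLM m u)
  rw [h, inner_self_eq_norm_sq_to_K, norm_pow, RCLike.norm_ofReal, abs_norm, sq] at h1
  rcases (norm_nonneg v).eq_or_lt with h0 | h0
  · rw [← h0]
    exact norm_nonneg _
  · exact le_of_mul_le_mul_left h1 h0

/-! ### Components determined by the X-ray transform -/

/-- The weight frequency is the extreme one that the component `m - 2i` meets only at `a = 0`. Lower
components would need a negative `a`, and higher ones vanish by hypothesis. -/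
theorem diskMoment_zero_left_eq_zero {m i : ℕ} {u : ℤ → L2Disk} (h : tensorLM m u ∈ momentKer)
    (hi : i ≤ m) (h0 : ∀ j < i, u ((m : ℤ) - 2 * j) = 0) (K : ℕ) :
    diskMoment 0 K (u ((m : ℤ) - 2 * i)) = 0 := by
  have h1 := mem_momentKer.mp h K (-K - (m - 2 * i))
  rw [tensorLM_apply, moment_sum, Finset.sum_eq_single i, moment_emb, Finset.sum_eq_single 0,
    if_pos (by push_cast; ring)] at h1
  · simpa [Real.pi_ne_zero] using h1
  · intro a _ ha
    rw [if_neg (by omega)]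
  · simp
  · intro j _ hj
    rcases lt_or_gt_of_ne hj with hj | hj
    · rw [h0 j hj, map_zero, ← inner_weightLp, inner_zero_right]
    · rw [moment_emb, Finset.sum_eq_zero, mul_zero]
      intro a _
      rw [if_neg (by omega)]
  · intro h
    exact absurd (Finset.mem_range.mpr (by omega)) h

/-- The opposite extreme: the component `m - 2i` is met only at `a = K`, and higher components would
need `a > K`. -/
theorem diskMoment_zero_right_eq_zero {m i : ℕ} {u : ℤ → L2Disk} (h : tensorLM m u ∈ momentKer)
    (hi : i ≤ m) (h0 : ∀ j, i < j → j ≤ m → u ((m : ℤ) - 2 * j) = 0) (K : ℕ) :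
    diskMoment K 0 (u ((m : ℤ) - 2 * i)) = 0 := by
  have h1 := mem_momentKer.mp h K (K - (m - 2 * i))
  rw [tensorLM_apply, moment_sum, Finset.sum_eq_single i, moment_emb, Finset.sum_eq_single K,
    if_pos (by ring)] at h1
  · simpa [Real.pi_ne_zero] using h1
  · intro a _ ha
    rw [if_neg (by omega)]
  · simp
  · intro j hjm hj
    rw [Finset.mem_range] at hjm
    rcases lt_or_gt_of_ne hj with hj | hj
    · rw [moment_emb, Finset.sum_eq_zero, mul_zero]
      intro a ha
      rw [Finset.mem_range] at ha
      rw [if_neg (by omega)]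
    · rw [h0 j hj (by omega), map_zero, ← inner_weightLp, inner_zero_right]
  · intro h
    exact absurd (Finset.mem_range.mpr (by omega)) h

theorem eq_zero_of_emb_zero_mem_momentKer {u : L2Disk} (h : emb 0 u ∈ momentKer) : u = 0 := by
  rw [Lp.eq_zero_iff_ae_eq_zero]
  refine ae_eq_zero_of_integral_mono (integrable_L2Disk u) fun a b => ?_
  have h1 := mem_momentKer.mp h (a + b) (2 * a - (a + b : ℕ))
  rw [moment_emb, Finset.sum_eq_single a, if_pos (by ring), add_tsub_cancel_left] at h1
  · have hc : ((a + b).choose a : ℂ) ≠ 0 := by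
      exact_mod_cast (Nat.choose_pos (Nat.le_add_right a b)).ne'
    simpa [Real.pi_ne_zero, hc, diskMoment] using h1
  · intro a' _ ha
    rw [if_neg (by omega)]
  · intro h
    exact absurd (Finset.mem_range.mpr (by omega)) h

/-- The equation `∂̄A + ∂B = 0`, in terms of pairings with test functions. -/
def WeakDivZero (A B : L2Disk) : Prop :=
  ∀ φ, inner ℂ (dzLp φ) A + inner ℂ (dzbarLp φ) B = 0

/-- The divergence equation and the vanishing moments each relate the moments of `A` to those of
`B`. Half their sum and half their difference decouple into the recurrences of `∂̄A = 0` and `∂B =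
0`; the index pairs with a zero entry supply the initial values. -/
theorem eq_zero_of_weakDivZero_of_mem_momentKer {A B : L2Disk} (hAB : WeakDivZero A B)
    (h : emb 1 A + emb (-1) B ∈ momentKer) : A = 0 ∧ B = 0 := by
  have hA := integrable_L2Disk A
  have hB := integrable_L2Disk B
  rw [emb_one_add_emb_neg_one_mem_momentKer_iff] at h
  have h1 := diskMoment_relation hB hA fun φ => by
    have := hAB (conjTest φ)
    rw [inner_dzLp_conjTest, inner_dzbarLp_conjTest, add_comm] at this
    rwa [integral_add (integrable_mul_continuous hB (continuous_dz (contDiff_test φ)))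
      (integrable_mul_continuous hA (continuous_dzbar (contDiff_test φ)))]
  have h2 : ∀ a b : ℕ, (b : ℂ) * diskMoment a (b - 1) A = (b + 1) * diskMoment (a + 1) b A ∧
      (a : ℂ) * diskMoment (a - 1) b B = (a + 1) * diskMoment a (b + 1) B := by
    intro a b
    have r1 := h1 a b
    have r2 := h a b
    have r3 := h (a + 1) (b + 1)
    simp only [add_tsub_cancel_right] at r3
    push_cast at r3
    constructor
    · linear_combination (1 / 2) * r1 + (1 / 2) * r2 - (1 / 2) * r3
    · linear_combination (1 / 2) * r1 - (1 / 2) * r2 + (1 / 2) * r3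
  constructor
  · rw [Lp.eq_zero_iff_ae_eq_zero]
    refine ae_eq_zero_of_antiholomorphic_moments hA (fun a b => (h2 a b).1) fun b => ?_
    have h3 := h 0 (b + 1)
    rw [Nat.cast_zero, zero_mul, add_tsub_cancel_right] at h3
    exact (mul_eq_zero.mp h3).resolve_left (by exact_mod_cast b.succ_ne_zero)
  · rw [Lp.eq_zero_iff_ae_eq_zero]
    refine ae_eq_zero_of_holomorphic_moments hB (fun a b => (h2 a b).2) fun a => ?_
    have h3 := h (a + 1) 0
    rw [Nat.cast_zero, zero_mul, add_tsub_cancel_right] at h3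
    exact (mul_eq_zero.mp h3.symm).resolve_left (by exact_mod_cast a.succ_ne_zero)

/-! ### Uniqueness of the reduced form -/

theorem inner_dzLp_eq_zero {u : L2Disk} (h : WeakDzbarZero u) (φ : 𝓓(disk, ℂ)) :
    inner ℂ (dzLp φ) u = 0 := by
  rw [← conjTest_conjTest φ, inner_dzLp_conjTest]
  exact h _

theorem inner_dzbarLp_eq_zero {u : L2Disk} (h : WeakDzZero u) (φ : 𝓓(disk, ℂ)) :
    inner ℂ (dzbarLp φ) u = 0 := by
  rw [← conjTest_conjTest φ, inner_dzbarLp_conjTest]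
  exact h _

/-- The differential equations satisfied by the harmonic components of a reduced tensor. -/
structure IsGauge (u : ℤ → L2Disk) : Prop where
  top : ∀ k, 2 ≤ k → ∀ φ, inner ℂ (dzLp φ) (u k) = 0
  bot : ∀ k, k ≤ -2 → ∀ φ, inner ℂ (dzbarLp φ) (u k) = 0
  mid : WeakDivZero (u 1) (u (-1))

theorem IsGauge.sub {u v : ℤ → L2Disk} (hu : IsGauge u) (hv : IsGauge v) : IsGauge (u - v) where
  top k hk φ := by rw [Pi.sub_apply, inner_sub_right, hu.top k hk, hv.top k hk, sub_zero]
  bot k hk φ := by rw [Pi.sub_apply, inner_sub_right, hu.bot k hk, hv.bot k hk, sub_zero]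
  mid φ := by
    rw [Pi.sub_apply, Pi.sub_apply, inner_sub_right, inner_sub_right]
    linear_combination hu.mid φ - hv.mid φ

theorem IsGauge.exists_add_two {u : ℤ → L2Disk} (hu : IsGauge u) (m : ℕ) {a b : L2Disk}
    (ha : WeakDzbarZero a) (hb : WeakDzZero b) : ∃ v, IsGauge v ∧
      tensorLM (m + 2) v = tensorLM m u + (emb (m + 2) a + emb (-(m + 2)) b) := by
  refine ⟨fun k => if k = m + 2 then a else if k = -(m + 2) then b else u k, ⟨?_, ?_, ?_⟩, ?_⟩
  · intro k hk φ
    split_ifs with h1 h2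
    · exact inner_dzLp_eq_zero ha φ
    · omega
    · exact hu.top k hk φ
  · intro k hk φ
    split_ifs with h1 h2
    · omega
    · exact inner_dzbarLp_eq_zero hb φ
    · exact hu.bot k hk φ
  · rw [if_neg (by omega), if_neg (by omega), if_neg (by omega), if_neg (by omega)]
    exact hu.mid
  · rw [tensorLM_add_two, if_pos rfl, if_neg (by omega), if_pos rfl, tensorLM_apply,
      tensorLM_apply]
    congr 1
    refine Finset.sum_congr rfl fun j hj => ?_
    rw [Finset.mem_range] at hj
    rw [if_neg (by omega), if_neg (by omega)]

theorem exists_eq_emb_of_mem_kerEtaMinus {k : ℤ} {h : L2SD} (hh : h ∈ kerEtaMinus k) :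
    ∃ a : L2Disk, WeakDzbarZero a ∧ h = emb k a := by
  obtain ⟨u, hu, hw, he⟩ := hh
  refine ⟨hu.toLp, fun φ => ?_, (emb_eq_iff k u hu h).mpr he⟩
  rw [← hw φ]
  refine integral_congr_ae ?_
  filter_upwards [hu.coeFn_toLp] with z hz
  rw [hz]

theorem exists_eq_emb_of_mem_kerEtaPlus {k : ℤ} {h : L2SD} (hh : h ∈ kerEtaPlus k) :
    ∃ a : L2Disk, WeakDzZero a ∧ h = emb k a := by
  obtain ⟨u, hu, hw, he⟩ := hh
  refine ⟨hu.toLp, fun φ => ?_, (emb_eq_iff k u hu h).mpr he⟩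
  rw [← hw φ]
  refine integral_congr_ae ?_
  filter_upwards [hu.coeFn_toLp] with z hz
  rw [hz]

theorem IsReducedEven.exists_isGauge {n : ℕ} {g : L2SD} (hg : IsReducedEven n g) :
    ∃ u, IsGauge u ∧ g = tensorLM (2 * n) u := by
  obtain ⟨g₀, G₀, h₁, h₂, hg₀, hG₀, h1, h2, rfl⟩ := hg
  induction n with
  | zero =>
    -- Components of odd index do not enter an even tensor; set to zero, they satisfy the middle
    -- equation trivially.
    refine ⟨Pi.single 0 hg₀.toLp, ⟨fun k hk φ => ?_, fun k hk φ => ?_, fun φ => ?_⟩, ?_⟩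
    · rw [Pi.single_eq_of_ne (by omega), inner_zero_right]
    · rw [Pi.single_eq_of_ne (by omega), inner_zero_right]
    · rw [Pi.single_eq_of_ne (by omega), Pi.single_eq_of_ne (by omega), inner_zero_right,
        inner_zero_right, add_zero]
    · rw [(emb_eq_iff 0 g₀ hg₀ G₀).mpr hG₀, tensorLM_apply]
      simp
  | succ n ih =>
    obtain ⟨u, hu, e⟩ := ih (fun j hj => h1 j (Finset.Icc_subset_Icc_right n.le_succ hj))
      (fun j hj => h2 j (Finset.Icc_subset_Icc_right n.le_succ hj))
    obtain ⟨a, ha, ea⟩ := exists_eq_emb_of_mem_kerEtaMinus (h1 (n + 1) (by simp))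
    obtain ⟨b, hb, eb⟩ := exists_eq_emb_of_mem_kerEtaPlus (h2 (n + 1) (by simp))
    obtain ⟨v, hv, ev⟩ := hu.exists_add_two (2 * n) ha hb
    refine ⟨v, hv, ?_⟩
    have e1 : (2 * ((n + 1 : ℕ) : ℤ)) = (2 * n : ℕ) + 2 := by push_cast; ring
    rw [Finset.sum_Icc_succ_top (by omega), ← add_assoc, e, ea, eb, e1, mul_add_one, ev]

theorem IsReducedOdd.exists_isGauge {n : ℕ} {g : L2SD} (hg : IsReducedOdd n g) :
    ∃ u, IsGauge u ∧ g = tensorLM (2 * n + 1) u := by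
  obtain ⟨G₀, h₁, h₂, hG₀, h1, h2, rfl⟩ := hg
  induction n with
  | zero =>
    obtain ⟨A, B, rfl, hAB⟩ := exists_perp_of_mem_xPerpRange hG₀
    refine ⟨fun k => if k = 1 then A else if k = -1 then B else 0,
      ⟨fun k hk φ => ?_, fun k hk φ => ?_, ?_⟩, ?_⟩
    · rw [if_neg (by omega), if_neg (by omega), inner_zero_right]
    · rw [if_neg (by omega), if_neg (by omega), inner_zero_right]
    · simpa [WeakDivZero] using hAB
    · rw [tensorLM_apply]
      simp [Finset.sum_range_succ]
  | succ n ih =>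
    obtain ⟨u, hu, e⟩ := ih (fun j hj => h1 j (Finset.Icc_subset_Icc_right n.le_succ hj))
      (fun j hj => h2 j (Finset.Icc_subset_Icc_right n.le_succ hj))
    obtain ⟨a, ha, ea⟩ := exists_eq_emb_of_mem_kerEtaMinus (h1 (n + 1) (by simp))
    obtain ⟨b, hb, eb⟩ := exists_eq_emb_of_mem_kerEtaPlus (h2 (n + 1) (by simp))
    obtain ⟨v, hv, ev⟩ := hu.exists_add_two (2 * n + 1) ha hb
    refine ⟨v, hv, ?_⟩
    have e1 : (2 * ((n + 1 : ℕ) : ℤ) + 1) = (2 * n + 1 : ℕ) + 2 := by push_cast; ring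
    rw [Finset.sum_Icc_succ_top (by omega), ← add_assoc, e, ea, eb, e1,
      show 2 * (n + 1) + 1 = 2 * n + 1 + 2 by ring, ev]

/-- Induction from the outermost frequency inwards: once the higher components vanish, the extreme
moments of the next one vanish, and it is holomorphic. The bound on `i` says that the frequency is
at least 2. -/
theorem IsGauge.eq_zero_of_two_le {m : ℕ} {u : ℤ → L2Disk} (hu : IsGauge u)
    (h : tensorLM m u ∈ momentKer) (i : ℕ) (hi : 2 * i + 2 ≤ m) : u ((m : ℤ) - 2 * i) = 0 := by
  induction i using Nat.strong_induction_on with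
  | _ i ih =>
    rw [Lp.eq_zero_iff_ae_eq_zero]
    exact ae_eq_zero_of_weakDzbarZero (integrable_L2Disk _)
      (weakDzbarZero_of_inner (hu.top _ (by omega)))
      (diskMoment_zero_left_eq_zero h (by omega) fun j hj => ih j hj (by omega))

theorem IsGauge.eq_zero_of_le_neg_two {m : ℕ} {u : ℤ → L2Disk} (hu : IsGauge u)
    (h : tensorLM m u ∈ momentKer) (i : ℕ) (hi : 2 * i + 2 ≤ m) : u (-((m : ℤ) - 2 * i)) = 0 := by
  induction i using Nat.strong_induction_on with
  | _ i ih =>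
    -- From the bottom, the component is the one of index `m - i`.
    have e : -((m : ℤ) - 2 * i) = m - 2 * (m - i : ℕ) := by omega
    rw [Lp.eq_zero_iff_ae_eq_zero]
    refine ae_eq_zero_of_weakDzZero (integrable_L2Disk _)
      (weakDzZero_of_inner (hu.bot _ (by omega))) ?_
    rw [e]
    refine diskMoment_zero_right_eq_zero h (by omega) fun j hj hjm => ?_
    rw [← ih (m - j) (by omega) (by omega)]
    congr 1
    omega

theorem IsGauge.tensorLM_eq_zero {m : ℕ} {u : ℤ → L2Disk} (hu : IsGauge u)
    (h : tensorLM m u ∈ momentKer) : tensorLM m u = 0 := by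
  have htop := hu.eq_zero_of_two_le h
  have hbot : ∀ j ≤ m, m + 2 ≤ 2 * j → u ((m : ℤ) - 2 * j) = 0 := fun j hj hj' => by
    rw [← hu.eq_zero_of_le_neg_two h (m - j) (by omega)]
    congr 1
    omega
  rcases Nat.even_or_odd' m with ⟨n, rfl | rfl⟩
  · have e : tensorLM (2 * n) u = emb 0 (u 0) := by
      have e0 : ((2 * n : ℕ) : ℤ) - 2 * n = 0 := by push_cast; ring
      rw [tensorLM_apply, Finset.sum_eq_single n, e0]
      · intro j hj hne
        rw [Finset.mem_range] at hj
        rcases lt_or_gt_of_ne hne with hlt | hlt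
        · rw [htop j (by omega), map_zero]
        · rw [hbot j (by omega) (by omega), map_zero]
      · intro hn
        exact absurd (Finset.mem_range.mpr (by omega)) hn
    rw [e] at h ⊢
    rw [eq_zero_of_emb_zero_mem_momentKer h, map_zero]
  · have e : tensorLM (2 * n + 1) u = emb 1 (u 1) + emb (-1) (u (-1)) := by
      have e0 : ((2 * n + 1 : ℕ) : ℤ) - 2 * n = 1 := by push_cast; ring
      have e1 : ((2 * n + 1 : ℕ) : ℤ) - 2 * (n + 1 : ℕ) = -1 := by push_cast; ring
      rw [tensorLM_apply, Finset.sum_eq_add n (n + 1) (by omega), e0, e1]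
      · intro j hj hne
        rw [Finset.mem_range] at hj
        rcases lt_or_gt_of_ne hne.1 with hlt | hlt
        · rw [htop j (by omega), map_zero]
        · rw [hbot j (by omega) (by omega), map_zero]
      · intro hn
        exact absurd (Finset.mem_range.mpr (by omega)) hn
      · intro hn
        exact absurd (Finset.mem_range.mpr (by omega)) hn
    rw [e] at h ⊢
    obtain ⟨h1, h2⟩ := eq_zero_of_weakDivZero_of_mem_momentKer hu.mid h
    rw [h1, h2, map_zero, map_zero, add_zero]

/-! ### Existence of the reduced form -/

/-- The reduced form of an `m`-tensor, for either parity of `m`. -/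
def IsReduced (m : ℕ) (g : L2SD) : Prop :=
  (∀ n : ℕ, m = 2 * n → IsReducedEven n g) ∧ ∀ n : ℕ, m = 2 * n + 1 → IsReducedOdd n g

theorem IsReduced.exists_isGauge {m : ℕ} {g : L2SD} (hg : IsReduced m g) :
    ∃ u, IsGauge u ∧ g = tensorLM m u := by
  rcases Nat.even_or_odd' m with ⟨n, rfl | rfl⟩
  · exact (hg.1 n rfl).exists_isGauge
  · exact (hg.2 n rfl).exists_isGauge

/-- The equations of `IsGauge` are linear, so they hold for the difference, which is then a gauged
tensor without moments. -/
theorem IsReduced.eq {m : ℕ} {g g' : L2SD} (hg : IsReduced m g) (hg' : IsReduced m g')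
    (h : g - g' ∈ momentKer) : g = g' := by
  obtain ⟨u, hu, rfl⟩ := hg.exists_isGauge
  obtain ⟨v, hv, rfl⟩ := hg'.exists_isGauge
  rw [← map_sub] at h
  rw [← sub_eq_zero, ← map_sub]
  exact (hu.sub hv).tensorLM_eq_zero h

theorem sum_Icc_update {n : ℕ} (h₁ h₂ : ℕ → L2SD) (A B : L2SD) :
    ∑ j ∈ Finset.Icc 1 (n + 1),
      (Function.update h₁ (n + 1) A j + Function.update h₂ (n + 1) B j) =
    ∑ j ∈ Finset.Icc 1 n, (h₁ j + h₂ j) + (A + B) := by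
  rw [Finset.sum_Icc_succ_top (by omega), Function.update_self, Function.update_self]
  congr 1
  refine Finset.sum_congr rfl fun j hj => ?_
  rw [Finset.mem_Icc] at hj
  rw [Function.update_of_ne (by omega), Function.update_of_ne (by omega)]

theorem forall_update_mem {n : ℕ} {h : ℕ → L2SD} {S : ℕ → Set L2SD} {A : L2SD}
    (hh : ∀ j ∈ Finset.Icc 1 n, h j ∈ S j) (hA : A ∈ S (n + 1)) :
    ∀ j ∈ Finset.Icc 1 (n + 1), Function.update h (n + 1) A j ∈ S j := by
  intro j hj
  rw [Finset.mem_Icc] at hj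
  rcases eq_or_ne j (n + 1) with rfl | hne
  · rwa [Function.update_self]
  · rw [Function.update_of_ne hne]
    exact hh j (Finset.mem_Icc.mpr ⟨hj.1, by omega⟩)

theorem IsReduced.add_two {m : ℕ} {g : L2SD} (hg : IsReduced m g) {a b : L2Disk}
    (ha : WeakDzbarZero a) (hb : WeakDzZero b) :
    IsReduced (m + 2) (g + (emb (m + 2) a + emb (-(m + 2)) b)) := by
  have hA : emb (m + 2) a ∈ kerEtaMinus (m + 2) := ⟨a, Lp.memLp a, ha, coe_emb _ _⟩
  have hB : emb (-(m + 2)) b ∈ kerEtaPlus (-(m + 2)) := ⟨b, Lp.memLp b, hb, coe_emb _ _⟩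
  constructor
  · intro n hn
    obtain ⟨n, rfl⟩ : ∃ k, n = k + 1 := ⟨n - 1, by omega⟩
    have e : (m + 2 : ℤ) = 2 * (n + 1 : ℕ) := by omega
    obtain ⟨g₀, G₀, h₁, h₂, hg₀, hG₀, h1, h2, rfl⟩ := hg.1 n (by omega)
    rw [e] at hA hB ⊢
    refine ⟨g₀, G₀, Function.update h₁ (n + 1) _, Function.update h₂ (n + 1) _, hg₀, hG₀,
      forall_update_mem h1 hA, forall_update_mem h2 hB, ?_⟩
    rw [sum_Icc_update, add_assoc]
  · intro n hn
    obtain ⟨n, rfl⟩ : ∃ k, n = k + 1 := ⟨n - 1, by omega⟩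
    have e : (m + 2 : ℤ) = 2 * (n + 1 : ℕ) + 1 := by omega
    obtain ⟨G₀, h₁, h₂, hG₀, h1, h2, rfl⟩ := hg.2 n (by omega)
    rw [e] at hA hB ⊢
    refine ⟨G₀, Function.update h₁ (n + 1) _, Function.update h₂ (n + 1) _, hG₀,
      forall_update_mem h1 hA, forall_update_mem h2 hB, ?_⟩
    rw [sum_Icc_update, add_assoc]

theorem norm_emb_le_norm_emb {u v : L2Disk} (h : ‖u‖ ≤ ‖v‖) (k l : ℤ) :
    ‖emb k u‖ ≤ ‖emb l v‖ := by
  rw [norm_emb, norm_emb]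
  gcongr

theorem exists_isReduced (m : ℕ) : ∃ C : ℝ, 0 ≤ C ∧ ∀ f ∈ (tensorLM m).range,
    ∃ g, f - g ∈ momentKer ∧ IsReduced m g ∧ ‖g‖ ≤ C * ‖f‖ := by
  induction m using Nat.twoStepInduction with
  | zero =>
    refine ⟨1, zero_le_one, ?_⟩
    rintro _ ⟨u, rfl⟩
    refine ⟨_, by rw [sub_self]; exact momentKer.zero_mem, ⟨fun n hn => ?_, fun n hn => by omega⟩,
      (one_mul _).ge⟩
    obtain rfl : n = 0 := by omega
    refine ⟨u 0, tensorLM 0 u, 0, 0, Lp.memLp _, ?_, by simp, by simp, by simp⟩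
    rw [tensorLM_apply]
    simpa using coe_emb 0 (u 0)
  | one =>
    refine ⟨1, zero_le_one, ?_⟩
    rintro _ ⟨u, rfl⟩
    have e : tensorLM 1 u = emb 1 (u 1) + emb (-1) (u (-1)) := by
      rw [tensorLM_apply]
      simp [Finset.sum_range_succ]
    obtain ⟨a, b, hr, hk, hn⟩ := exists_perp_reduction (u 1) (u (-1))
    rw [e]
    refine ⟨perp a b, hk, ⟨fun n hn => by omega, fun n hn => ?_⟩, by rwa [one_mul]⟩
    obtain rfl : n = 0 := by omega
    exact ⟨perp a b, 0, 0, hr, by simp, by simp, by simp⟩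
  | more m ih _ =>
    obtain ⟨C, hC, ih⟩ := ih
    -- The inner `m`-tensor has norm at most `3‖f‖`, and the two displaced terms add `‖f‖` each,
    -- whence 5. The 2 accounts for the new extreme components.
    refine ⟨5 * C + 2, by positivity, ?_⟩
    rintro _ ⟨u, rfl⟩
    obtain ⟨a, w, ha, haw, na, nw⟩ := exists_weakDzbarZero_reduction (m + 2) (u (m + 2))
    obtain ⟨b, w', hb, hbw, nb, nw'⟩ := exists_weakDzZero_reduction (-(m + 2)) (u (-(m + 2)))
    rw [show (m + 2 - 2 : ℤ) = m by ring] at haw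
    rw [show (-(m + 2) + 2 : ℤ) = -m by ring] at hbw
    have e := tensorLM_add_two m u
    set f := tensorLM (m + 2) u with hf
    have r1 : emb (m : ℤ) w ∈ (tensorLM m).range := by
      simpa using emb_mem_range_tensorLM (Nat.zero_le m) w
    have r2 : emb (-(m : ℤ)) w' ∈ (tensorLM m).range := by
      have := emb_mem_range_tensorLM (le_refl m) w'
      rwa [show (m : ℤ) - 2 * m = -m by ring] at this
    have nu : ‖emb (m + 2) (u (m + 2))‖ ≤ ‖f‖ := by
      simpa using norm_emb_le_norm_tensorLM (Nat.zero_le (m + 2)) u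
    have nu' : ‖emb (-(m + 2)) (u (-(m + 2)))‖ ≤ ‖f‖ := by
      have := norm_emb_le_norm_tensorLM (le_refl (m + 2)) u
      rwa [show ((m + 2 : ℕ) : ℤ) - 2 * (m + 2 : ℕ) = -(m + 2) by push_cast; ring] at this
    have nA := (norm_emb_le_norm_emb na (m + 2) (m + 2)).trans nu
    have nW := (norm_emb_le_norm_emb nw m (m + 2)).trans nu
    have nB := (norm_emb_le_norm_emb nb (-(m + 2)) (-(m + 2))).trans nu'
    have nW' := (norm_emb_le_norm_emb nw' (-m) (-(m + 2))).trans nu'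
    obtain ⟨g, hfg, hg, hng⟩ := ih (tensorLM m u + (emb m w + emb (-m) w'))
      (add_mem ⟨u, rfl⟩ (add_mem r1 r2))
    refine ⟨_, ?_, hg.add_two ha hb, ?_⟩
    · convert! add_mem hfg (add_mem haw hbw) using 1
      rw [e]
      abel
    · have n1 : ‖tensorLM m u‖ ≤ 3 * ‖f‖ := by
        rw [eq_sub_of_add_eq e.symm]
        have := norm_sub_le f (emb (m + 2) (u (m + 2)) + emb (-(m + 2)) (u (-(m + 2))))
        have := norm_add_le (emb (m + 2) (u (m + 2))) (emb (-(m + 2)) (u (-(m + 2))))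
        linarith
      have n2 : ‖tensorLM m u + (emb m w + emb (-m) w')‖ ≤ 5 * ‖f‖ := by
        have := norm_add_le (tensorLM m u) (emb m w + emb (-m) w')
        have := norm_add_le (emb m w) (emb (-m) w')
        linarith
      have n3 := norm_add_le g (emb (m + 2) a + emb (-(m + 2)) b)
      have n4 := norm_add_le (emb (m + 2) a) (emb (-(m + 2)) b)
      have n5 := mul_le_mul_of_nonneg_left n2 hC
      linarith

/-- A reduced form is already an `m`-tensor, so membership in `tensors m` need not be imposed
separately. -/
theorem isDecomposition_iff {m : ℕ} {f g : L2SD} :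
    IsDecomposition m f g ↔ f - g ∈ momentKer ∧ IsReduced m g := by
  constructor
  · intro h
    exact ⟨xray_ae_eq_iff_sub_mem.mp h.xray_eq, h.even_form, h.odd_form⟩
  · rintro ⟨h1, h2⟩
    obtain ⟨u, -, hu⟩ := h2.exists_isGauge
    exact ⟨mem_tensors_iff.mpr ⟨u, hu.symm⟩, xray_ae_eq_iff_sub_mem.mpr h1, h2.1, h2.2⟩

theorem IsDecomposition.unique {m : ℕ} {f g g' : L2SD} (h : IsDecomposition m f g)
    (h' : IsDecomposition m f g') : g = g' := by
  rw [isDecomposition_iff] at h h'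
  refine h.2.eq h'.2 ?_
  rw [← sub_sub_sub_cancel_left g' g f]
  exact sub_mem h'.1 h.1

end DiskTensor
end

theorem theorem1 (m : ℕ) :
    (∀ f ∈ DiskTensor.tensors m, ∃! g : DiskTensor.L2SD, DiskTensor.IsDecomposition m f g) ∧
    ∃ C : ℝ, 0 < C ∧ ∀ f ∈ DiskTensor.tensors m, ∀ g : DiskTensor.L2SD,
      DiskTensor.IsDecomposition m f g → ‖g‖ ≤ C * ‖f‖ := by
  obtain ⟨C, hC, h⟩ := DiskTensor.exists_isReduced m
  refine ⟨fun f hf => ?_, C + 1, by positivity, fun f hf g hg => ?_⟩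
  · obtain ⟨g, h1, h2, -⟩ := h f (DiskTensor.mem_tensors_iff.mp hf)
    have hg := DiskTensor.isDecomposition_iff.mpr ⟨h1, h2⟩
    exact ⟨g, hg, fun g' hg' => hg'.unique hg⟩
  · obtain ⟨g', h1, h2, h3⟩ := h f (DiskTensor.mem_tensors_iff.mp hf)
    -- By uniqueness, an arbitrary decomposition is the constructed one, for which the estimate is
    -- known.
    rw [hg.unique (DiskTensor.isDecomposition_iff.mpr ⟨h1, h2⟩)]
    linarith [norm_nonneg f]
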